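/- **Setting.** Let $T>0$, let $\sigma_1,\sigma_2$ be measurable deterministic functions, positive and bounded on $[0,T]$, and let $\rho$ be a measurable deterministic function with values in $[-1,1]$. Let $B=(B_1,B_2)$ be a centred two-dimensional Gaussian process with independent increments, $E[B_{i,t}^2]=t$ and $E[B_{1,t}B_{2,t}]=\int_0^t\rho_s\,ds$ for $t\ge 0$, and let $X=(X_1,X_2)$ be a continuous process with $dX_{i,t}=\sigma_{i,t}\,dB_{i,t}$ on $[0,T]$, $i=1,2$. For every $n\in\mathbb N$ let $\Pi_n=(\Pi^1_n,\Pi^2_n)$ be a pair of random partitions of $(0,T]$ into finitely many (a random number of) intervals, $\Pi_n^1=\{I^i=(S^{i-1},S^i]:1\le i\le N_1\}$, $\Pi_n^2=\{J^j=(T^{j-1},T^j]:1\le j\le N_2\}$ with $0=S^0<\dots<S^{N_1}=T$ and $0=T^0<\dots<T^{N_2}=T$, such that $\Pi_n$ is independent of $\{X_{1,t}-X_{1,0},X_{2,t}-X_{2,0}\}_{t\in[0,T]}$. Let $r_n$ be the maximal length of these intervals, let $K_{IJ}=1$ if $I\cap J\ne\emptyset$ and $K_{IJ}=0$ otherwise,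 and put $$\theta=\int_0^T\rho_t\sigma_{1,t}\sigma_{2,t}\,dt,\qquad \hat\theta_n=\sum_{i=1}^{N_1}\sum_{j=1}^{N_2}(X_{1,S^i}-X_{1,S^{i-1}})(X_{2,T^j}-X_{2,T^{j-1}})K_{I^iJ^j}.$$ With $v(S)=\int_S\rho_t\sigma_{1,t}\sigma_{2,t}\,dt$, $v_i(S)=\int_S\sigma_{i,t}^2\,dt$ and $\sum_{I,J}=\sum_{I\in\Pi_n^1}\sum_{J\in\Pi_n^2}$, define $$\mu_{2,n}=\tfrac12\Big\{\sum_{I,J}v_1(I)v_2(J)K_{IJ}+\sum_{I}v(I)^2+\sum_{J}v(J)^2-\sum_{I,J}v(I\cap J)^2\Big\},$$ $$\mu_{3,n}=\tfrac14\Big\{\sum_{I}v(I)^3+\sum_{J}v(J)^3+2\sum_{I,J}v(I\cap J)^3+3\sum_{I,J}v_1(I)v_2(J)v(I\cup J)K_{IJ}-3\sum_{I,J}\big[v(I\cap J)^2(v(I)+v(J))-v(I\cap J)v(I)v(J)\big]\Big\}.$$ Let $(b_n)$ be a deterministic sequence of positive numbers tending to $0$, and put $\bar\lambda_{2,n}=2b_n^{-1}\mu_{2,n}$,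 $\bar\lambda_{3,n}=8b_n^{-2}\mu_{3,n}$, $\mathcal X_n=b_n^{-1/2}(\hat\theta_n-\theta)$. Let $\phi(z;c)$ be the density of the centred normal law with variance $c$ and $h_3(z;c)=-\phi(z;c)^{-1}\partial_z^3\phi(z;c)=(z^3-3cz)/c^3$. For positive $M,\gamma,C,\eta,r_0,c^*$ let $\mathcal F$ be the set of measurable $f:\mathbb R\to\mathbb R$ such that $|f(x)|\le M(1+|x|^\gamma)$ for all $x$ and $\int_{\mathbb R}\sup_{|x|\le r}|f(z+x)-f(z)|\,\phi(z;c^*)\,dz\le C r^\eta$ for all $0<r\le r_0$. **Theorem.** Let $M,\gamma,C,\eta,r_0,c^*>0$, $a\in(\tfrac34,1)$, $c\in(0,c^*)$ and $A_n(a)=\{(\bar\lambda_{2,n}-c)^2\le b_n^{2a-1},\ r_n\le b_n^a\}$. Assume that $P(A_n(a)^c)=o(b_n^p)$ for every $p>1$ and that $E[\bar\lambda_{2,n}-c]=O(b_n^{2a-1})$. Then $\bar\lambda_{2,n}$, $\bar\lambda_{3,n}$ and $f(\mathcal X_n)$, $f\in\mathcal F$, are integrable, and $$\sup_{f\in\mathcal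 F}\Big|E[f(\mathcal X_n)]-\int_{\mathbb R}f(z)\,p_n^*(z)\,dz\Big|=O(b_n^{2a-1}),\qquad p_n^*(z)=\phi(z;c)\Big[1+\frac{b_n^{1/2}}6E[\bar\lambda_{3,n}]\,h_3(z;c)\Big].$$ If moreover $\sup_{n}E[\bar\lambda_{3,n}]<\infty$, then the same relation holds with $p_n^*$ replaced by $$p_n^+(z)=\frac{\max(0,p_n^*(z))}{\int_{\mathbb R}\max(0,p_n^*(u))\,du},$$ which is a probability density. -/

import Mathlib

open MeasureTheory ProbabilityTheory Filter Topology Asymptotics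
open scoped NNReal ENNReal

namespace HYExpansion

noncomputable section

/-! ### Wiener integrals of deterministic functions and the observed diffusion -/

/-- A step function on the time axis, taking the value `coef k` on `(knot k, knot (k + 1)]`
for `k < len` and `0` elsewhere. -/
structure StepFun where
  len : ℕ
  knot : ℕ → ℝ≥0
  mono : Monotone knot
  coef : ℕ → ℝ

/-- The step function as a function of time. -/
def StepFun.eval (s : StepFun) (u : ℝ) : ℝ :=
  ∑ k ∈ Finset.range s.len,
    (Set.Ioc (s.knot k : ℝ) (s.knot (k + 1) : ℝ)).indicator (fun _ => s.coef k) u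

/-- The elementary stochastic integral of a step function against a process `W`. -/
def StepFun.integral {Ω : Type*} (s : StepFun) (W : ℝ≥0 → Ω → ℝ) (ω : Ω) : ℝ :=
  ∑ k ∈ Finset.range s.len, s.coef k * (W (s.knot (k + 1)) ω - W (s.knot k) ω)

/-- `Y = ∫₀ᵗ g dW` for a deterministic integrand `g`: the random variable `Y` is the limit in
`L²(P)` of elementary integrals of step functions on `(0, t]` converging to `g` in `L²(0, t)`. -/
def IsWienerIntegral {Ω : Type*} [MeasurableSpace Ω] (P : Measure Ω) (W : ℝ≥0 → Ω → ℝ)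
    (g : ℝ → ℝ) (t : ℝ≥0) (Y : Ω → ℝ) : Prop :=
  ∃ s : ℕ → StepFun, (∀ m k, (s m).knot k ≤ t) ∧
    Tendsto (fun m => eLpNorm (fun u => (s m).eval u - g u) 2
      (volume.restrict (Set.Ioc (0 : ℝ) (t : ℝ)))) atTop (𝓝 0) ∧
    Tendsto (fun m => eLpNorm (fun ω => Y ω - (s m).integral W ω) 2 P) atTop (𝓝 0)

/-- `B = (B₁, B₂)` is a centred two-dimensional Gaussian process with independent increments such
that `E[Bᵢ,ₜ²] = t` and `E[B₁,ₜ B₂,ₜ] = ∫₀ᵗ ρ_s ds`. -/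
structure IsCorrelatedBrownian {Ω : Type*} [MeasurableSpace Ω] (P : Measure Ω) (ρ : ℝ → ℝ)
    (B : Fin 2 → ℝ≥0 → Ω → ℝ) : Prop where
  gaussian : IsGaussianProcess (fun (p : Fin 2 × ℝ≥0) ω => B p.1 p.2 ω) P
  indepIncrements : HasIndepIncrements (fun (t : ℝ≥0) ω (i : Fin 2) => B i t ω) P
  mean_zero : ∀ i t, ∫ ω, B i t ω ∂P = 0
  variance_eq : ∀ i t, ∫ ω, B i t ω ^ 2 ∂P = (t : ℝ)
  covariance_eq : ∀ t, ∫ ω, B 0 t ω * B 1 t ω ∂P = ∫ s in (0 : ℝ)..(t : ℝ), ρ s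

/-- `X = (X₁, X₂)` is a continuous process on `[0, T]` with `dX_t = diag(σ₁,ₜ, σ₂,ₜ) dB_t`,
that is, `Xᵢ,ₜ - Xᵢ,₀ = ∫₀ᵗ σᵢ,ₛ dBᵢ,ₛ`. -/
structure IsDriftlessDiffusion {Ω : Type*} [MeasurableSpace Ω] (P : Measure Ω) (T : ℝ≥0)
    (σ : Fin 2 → ℝ → ℝ) (B X : Fin 2 → ℝ≥0 → Ω → ℝ) : Prop where
  measurable : ∀ i, ∀ t ≤ T, Measurable (X i t)
  continuousOn : ∀ i ω, ContinuousOn (fun t => X i t ω) (Set.Iic T)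
  integral_eq : ∀ i, ∀ t ≤ T,
    IsWienerIntegral P (B i) (σ i) t (fun ω => X i t ω - X i 0 ω)

/-! ### Partitions and the Hayashi–Yoshida estimator -/

/-- A partition of `(0, T]` with endpoints `0 = pt 0 < pt 1 < ... < pt card = T`.
The sequence of endpoints is continued by the constant value `T`. -/
structure Partition (T : ℝ≥0) where
  card : ℕ
  pt : ℕ → ℝ≥0
  pt_zero : pt 0 = 0
  pt_lt : ∀ k < card, pt k < pt (k + 1)
  pt_eq : ∀ k, card ≤ k → pt k = T

/-- The σ-algebra generated by the endpoints. -/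
instance {T : ℝ≥0} : MeasurableSpace (Partition T) :=
  MeasurableSpace.comap Partition.pt inferInstance

/-- The `k`-th interval `(pt k, pt (k + 1)]`, for `k < card`. -/
def Partition.interval {T : ℝ≥0} (π : Partition T) (k : ℕ) : Set ℝ :=
  Set.Ioc (π.pt k : ℝ) (π.pt (k + 1) : ℝ)

/-- The maximal length of the intervals. -/
def Partition.mesh {T : ℝ≥0} (π : Partition T) : ℝ≥0 :=
  (Finset.range π.card).sup fun k => π.pt (k + 1) - π.pt k

/-- The maximal sampling step `r` of a pair of partitions. -/
def mesh {T : ℝ≥0} (π : Partition T × Partition T) : ℝ :=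
  (max π.1.mesh π.2.mesh : ℝ≥0)

open Classical in
/-- `K_{IJ} = 1` if `I ∩ J ≠ ∅` and `0` otherwise. -/
def overlap (I J : Set ℝ) : ℝ := if (I ∩ J).Nonempty then 1 else 0

/-- The sum of `F I` over the intervals `I` of a partition. -/
def Partition.sum {T : ℝ≥0} (π : Partition T) (F : Set ℝ → ℝ) : ℝ :=
  ∑ k ∈ Finset.range π.card, F (π.interval k)

/-- The sum of `F I J` over the intervals `I` of the first and `J` of the second partition. -/
def sum₂ {T : ℝ≥0} (π : Partition T × Partition T) (F : Set ℝ → Set ℝ → ℝ) : ℝ :=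
  ∑ i ∈ Finset.range π.1.card, ∑ j ∈ Finset.range π.2.card, F (π.1.interval i) (π.2.interval j)

/-- The Hayashi–Yoshida estimator computed from the path `x = (x₁, x₂)`, with `x₁` sampled at the
endpoints of the first and `x₂` at the endpoints of the second partition. -/
def hyEstimator {T : ℝ≥0} (π : Partition T × Partition T) (x : Fin 2 → ℝ≥0 → ℝ) : ℝ :=
  ∑ i ∈ Finset.range π.1.card, ∑ j ∈ Finset.range π.2.card,
    (x 0 (π.1.pt (i + 1)) - x 0 (π.1.pt i)) * (x 1 (π.2.pt (j + 1)) - x 1 (π.2.pt j)) *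
      overlap (π.1.interval i) (π.2.interval j)

/-- The covariation `θ = ∫₀ᵀ ρ_t σ₁,ₜ σ₂,ₜ dt`. -/
def covariation (T : ℝ≥0) (ρ : ℝ → ℝ) (σ : Fin 2 → ℝ → ℝ) : ℝ :=
  ∫ t in (0 : ℝ)..(T : ℝ), ρ t * σ 0 t * σ 1 t

/-- The normalized error `b^{-1/2} (θ̂ - θ)`. -/
def normError {T : ℝ≥0} (ρ : ℝ → ℝ) (σ : Fin 2 → ℝ → ℝ) (b : ℝ)
    (π : Partition T × Partition T) (x : Fin 2 → ℝ≥0 → ℝ) : ℝ :=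
  (√b)⁻¹ * (hyEstimator π x - covariation T ρ σ)

/-! ### The coefficients of the expansion -/

/-- `v(S) = ∫_S ρ_t σ₁,ₜ σ₂,ₜ dt`. -/
def vol (ρ : ℝ → ℝ) (σ : Fin 2 → ℝ → ℝ) (S : Set ℝ) : ℝ := ∫ t in S, ρ t * σ 0 t * σ 1 t

/-- `vᵢ(S) = ∫_S σᵢ,ₜ² dt`. -/
def qvol (σ : Fin 2 → ℝ → ℝ) (i : Fin 2) (S : Set ℝ) : ℝ := ∫ t in S, σ i t ^ 2

/-- The coefficient `μ₂`. -/
def mu2 {T : ℝ≥0} (ρ : ℝ → ℝ) (σ : Fin 2 → ℝ → ℝ) (π : Partition T × Partition T) : ℝ :=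
  (1 / 2) * (sum₂ π (fun I J => qvol σ 0 I * qvol σ 1 J * overlap I J)
    + π.1.sum (fun I => vol ρ σ I ^ 2) + π.2.sum (fun J => vol ρ σ J ^ 2)
    - sum₂ π (fun I J => vol ρ σ (I ∩ J) ^ 2))

/-- The coefficient `μ₃`. -/
def mu3 {T : ℝ≥0} (ρ : ℝ → ℝ) (σ : Fin 2 → ℝ → ℝ) (π : Partition T × Partition T) : ℝ :=
  (1 / 4) * (π.1.sum (fun I => vol ρ σ I ^ 3) + π.2.sum (fun J => vol ρ σ J ^ 3)
    + 2 * sum₂ π (fun I J => vol ρ σ (I ∩ J) ^ 3)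
    + 3 * sum₂ π (fun I J => qvol σ 0 I * qvol σ 1 J * vol ρ σ (I ∪ J) * overlap I J)
    - 3 * sum₂ π (fun I J => vol ρ σ (I ∩ J) ^ 2 * (vol ρ σ I + vol ρ σ J)
        - vol ρ σ (I ∩ J) * vol ρ σ I * vol ρ σ J))

/-- `λ̄₂ = 2 b⁻¹ μ₂`. -/
def lam2 {T : ℝ≥0} (ρ : ℝ → ℝ) (σ : Fin 2 → ℝ → ℝ) (b : ℝ) (π : Partition T × Partition T) : ℝ :=
  2 * b⁻¹ * mu2 ρ σ π

/-- `λ̄₃ = 8 b⁻² μ₃`. -/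
def lam3 {T : ℝ≥0} (ρ : ℝ → ℝ) (σ : Fin 2 → ℝ → ℝ) (b : ℝ) (π : Partition T × Partition T) : ℝ :=
  8 * (b ^ 2)⁻¹ * mu3 ρ σ π

/-! ### Gaussian density, Hermite polynomials, approximating densities -/

/-- The density `φ(z; s)` of the centred normal distribution with variance `s > 0`. -/
def phi (s z : ℝ) : ℝ := gaussianPDFReal 0 s.toNNReal z

/-- The Hermite polynomial `h_r(z; s) = (-1)^r φ(z; s)⁻¹ ∂_z^r φ(z; s)`. -/
def hermite (r : ℕ) (s z : ℝ) : ℝ := (-1) ^ r * (phi s z)⁻¹ * iteratedDeriv r (phi s) z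

/-- `p*(z) = φ(z; c) [1 + (b^{1/2} / 6) ℓ₃ h₃(z; c)]`. -/
def pStar (c b ℓ₃ z : ℝ) : ℝ := phi c z * (1 + √b / 6 * ℓ₃ * hermite 3 c z)

/-- The renormalized positive part of `p*`. -/
def pPlus (c b ℓ₃ z : ℝ) : ℝ := max 0 (pStar c b ℓ₃ z) / ∫ u, max 0 (pStar c b ℓ₃ u)

/-! ### The class of test functions -/

/-- The modulus of oscillation `sup_{|x| ≤ r} |f(z + x) - f(z)|`. -/
def osc (f : ℝ → ℝ) (z r : ℝ) : ℝ≥0∞ :=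
  ⨆ (x : ℝ) (_ : |x| ≤ r), ENNReal.ofReal |f (z + x) - f z|

/-- Measurable functions with `|f(x)| ≤ M (1 + |x|^γ)`. -/
def growthClass (M γ : ℝ) : Set (ℝ → ℝ) :=
  {f | Measurable f ∧ ∀ x, |f x| ≤ M * (1 + |x| ^ γ)}

/-- Functions with `∫ sup_{|x| ≤ r} |f(z + x) - f(z)| φ(z; c*) dz ≤ C r^η` for all `r ≤ r₀`. -/
def oscClass (C η r₀ cstar : ℝ) : Set (ℝ → ℝ) :=
  {f | ∀ r, 0 < r → r ≤ r₀ →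
    ∫⁻ z, osc f z r * ENNReal.ofReal (phi cstar z) ≤ ENNReal.ofReal (C * r ^ η)}

/-- Uniformly over `f ∈ F`, the expectation `E[f(Y_n)]` equals `∫ f(z) q_n(z) dz` up to
`O(e_n)` as `n → ∞`, all the expectations and integrals involved being finite. -/
def UniformExpansion {Ω : Type*} [MeasurableSpace Ω] (P : Measure Ω) (F : Set (ℝ → ℝ))
    (Y : ℕ → Ω → ℝ) (q : ℕ → ℝ → ℝ) (e : ℕ → ℝ) : Prop :=
  (∀ n, ∀ f ∈ F, Integrable (fun ω => f (Y n ω)) P ∧ Integrable (fun z => f z * q n z)) ∧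
  ∃ K : ℝ, ∀ᶠ n in atTop, ∀ f ∈ F,
    |∫ ω, f (Y n ω) ∂P - ∫ z, f z * q n z| ≤ K * e n

end

end HYExpansion

/-! Freeze the partitions. Since they are independent of the path, the conditional law of `θ̂ - θ`
is that of a centred quadratic form `ZᵀAZ - tr(AS)`. Here `Z` is the Gaussian vector of all
increments, `S` is its covariance matrix and `A` is half the symmetric overlap matrix. Diagonalizing
`S` and `A` together turns it into `∑ d_k (N_k² - 1)` with independent standard normal `N_k`, where
`∑ d_k² = tr (AS)²`, `∑ d_k³ = tr (AS)³`, and `|d_k|` is at most a constant times the mesh. The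
overlapping pairs of intervals form a staircase. In a staircase a closed 2-cycle or 3-cycle of cells
can only lie in a row, in a column or in an L-shape of one orientation, and inclusion–exclusion over
these cases gives exactly `μ₂` and `μ₃`. This is `IsDriftlessDiffusion.exists_map_eq_chiSqLaw`.

Put `δ = b^(a - 1/2)` and `x_k = d_k / √b`. On `A_n(a)` the weights are `O(δ)`, `2 ∑ x_k² = λ̄₂` is
within `δ` of `c`, and `8 ∑ x_k³ = √b λ̄₃`. So what is needed is a one-term Edgeworth expansion of a
weighted chi-square law with error `O(δ²) = O(b^(2a-1))`, which is
`exists_abs_integral_chiSqLaw_sub_le`. Its Laplace transform is explicit. On the lines `Re w = ±1`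
it differs from the transform of the Edgeworth density by `O(δ²)` times an integrable function of
`Im w`: by Taylor expansion for `δ‖w‖` small, and because both transforms are already `O(δ²)`
otherwise. An `L¹` bound for a difference of transforms dominates the difference of the measures by
a multiple of Lebesgue measure. Using the two lines `Re w = ±1` inserts a weight `cosh z`, so the
estimate applies uniformly to all test functions of a given polynomial growth.

Finally average over the partitions. The integral of `f` against the Edgeworth density is affine in
`λ̄₂ - c` and `√b λ̄₃`, so only their expectations survive; `E[λ̄₂ - c]` is an error term by
assumption and `E[λ̄₃]` gives `p*`. Off `A_n(a)` everything is bounded by a power of `b⁻¹`, which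
the probability of that event beats. Passing from `p*` to `p⁺` costs the square of `√b E[λ̄₃] =
O(δ)`, which is again `O(δ²)`. -/

namespace HYExpansion

/-! ### From `L¹` closeness of characteristic functions to domination of measures. -/

section Fourier

open FourierTransform SchwartzMap

/-- Fourier inversion for `g`, then Fubini. The argument `2πξ` reconciles the normalization of `𝓕`
with that of `charFun`. -/
lemma integral_schwartz_eq_integral_fourier_mul_charFun (α : Measure ℝ) [IsFiniteMeasure α]
    (g : 𝓢(ℝ, ℂ)) :
    ∫ x, g x ∂α = ∫ ξ : ℝ, 𝓕 (g : ℝ → ℂ) ξ * charFun α (2 * Real.pi * ξ) := by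
  have hG : Integrable (𝓕 (g : ℝ → ℂ)) := by
    rw [← SchwartzMap.fourier_coe]; exact (𝓕 g).integrable
  have hinv : ∀ x : ℝ, g x = ∫ ξ : ℝ, Complex.exp ((2 * Real.pi * ξ : ℝ) * x * Complex.I) *
      𝓕 (g : ℝ → ℂ) ξ := by
    intro x
    have h := congrFun (Continuous.fourierInv_fourier_eq g.continuous g.integrable hG) x
    rw [← h, Real.fourierInv_eq']
    congr 1
    ext ξ
    simp only [smul_eq_mul]
    congr 2
    simp
    ring
  have hswap : ∫ x, g x ∂α = ∫ x, ∫ ξ : ℝ, Complex.exp ((2 * Real.pi * ξ : ℝ) * x * Complex.I) *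
      𝓕 (g : ℝ → ℂ) ξ ∂volume ∂α := integral_congr_ae (.of_forall hinv)
  rw [hswap, integral_integral_swap]
  · congr 1
    ext ξ
    rw [integral_mul_const, charFun_apply_real, mul_comm]
  · have hb : Integrable (fun p : ℝ × ℝ => 𝓕 (g : ℝ → ℂ) p.2) (α.prod volume) :=
      Integrable.comp_snd (μ := α) hG
    refine hb.bdd_mul (c := 1) (by fun_prop) (.of_forall fun p => ?_)
    rw [Complex.norm_exp]
    simp

variable {α β : Measure ℝ} [IsFiniteMeasure α] [IsFiniteMeasure β]

/-- The Fourier transform is moved from `g` to the difference `D` of characteristic functions, and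
`𝓕 D` is bounded by `‖D‖₁`. The point is that the right side contains `‖g‖₁` and not `‖𝓕 g‖₁`:
formally this is a sup bound on the density of `α - β`. -/
lemma norm_integral_schwartz_sub_le
    (hD : Integrable (fun u => charFun α u - charFun β u)) (g : 𝓢(ℝ, ℂ)) :
    ‖∫ x, g x ∂α - ∫ x, g x ∂β‖ ≤
      (2 * Real.pi)⁻¹ * (∫ u, ‖charFun α u - charFun β u‖) * ∫ x, ‖g x‖ := by
  have hG : Integrable (𝓕 (g : ℝ → ℂ)) := by
    rw [← SchwartzMap.fourier_coe]; exact (𝓕 g).integrable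
  have hpi : (2 * Real.pi) ≠ 0 := by positivity
  set D : ℝ → ℂ := fun ξ => charFun α (2 * Real.pi * ξ) - charFun β (2 * Real.pi * ξ) with hDdef
  have hDi : Integrable D := hD.comp_mul_left' hpi
  have hbd : ∀ (m : Measure ℝ) [IsFiniteMeasure m],
      Integrable (fun ξ : ℝ => 𝓕 (g : ℝ → ℂ) ξ * charFun m (2 * Real.pi * ξ)) := by
    intro m _
    refine hG.mul_bdd (c := m.real Set.univ) ?_ (.of_forall fun ξ => norm_charFun_le _)
    exact (measurable_charFun.comp (by fun_prop)).aestronglyMeasurable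
  rw [integral_schwartz_eq_integral_fourier_mul_charFun,
    integral_schwartz_eq_integral_fourier_mul_charFun, ← integral_sub (hbd α) (hbd β)]
  have h1 : ∫ ξ : ℝ, (𝓕 (g : ℝ → ℂ) ξ * charFun α (2 * Real.pi * ξ) -
      𝓕 (g : ℝ → ℂ) ξ * charFun β (2 * Real.pi * ξ)) = ∫ x, g x • 𝓕 D x := by
    have := VectorFourier.integral_fourierIntegral_smul_eq_flip (L := innerₗ ℝ)
      Real.continuous_fourierChar continuous_inner g.integrable hDi (μ := volume) (ν := volume)
    rw [flip_innerₗ] at this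
    refine Eq.trans ?_ this
    congr 1
    ext ξ
    simp only [hDdef, smul_eq_mul, mul_sub]
    rfl
  rw [h1]
  have h2 : ∀ x, ‖𝓕 D x‖ ≤ (2 * Real.pi)⁻¹ * (∫ u, ‖charFun α u - charFun β u‖) := by
    intro x
    refine (VectorFourier.norm_fourierIntegral_le_integral_norm _ _ _ _ _).trans ?_
    have := Measure.integral_comp_mul_left (fun u => ‖charFun α u - charFun β u‖) (2 * Real.pi)
    rw [this, abs_of_pos (by positivity), smul_eq_mul]
  calc ‖∫ x, g x • 𝓕 D x‖ ≤ ∫ x, ‖g x • 𝓕 D x‖ := norm_integral_le_integral_norm _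
    _ ≤ ∫ x, (2 * Real.pi)⁻¹ * (∫ u, ‖charFun α u - charFun β u‖) * ‖g x‖ := by
        refine integral_mono_of_nonneg (.of_forall fun x => norm_nonneg _)
          (g.integrable.norm.const_mul _) (.of_forall fun x => ?_)
        simp only [norm_smul]
        rw [mul_comm]
        gcongr
        exact h2 x
    _ = _ := integral_const_mul _ _

/-- A bound for the difference of the characteristic functions in `L¹` bounds the difference of
two finite measures by a multiple of Lebesgue measure. -/
lemma measure_le_add_smul_volume
    (hD : Integrable (fun u => charFun α u - charFun β u)) :
    α ≤ β + ((2 * Real.pi)⁻¹ * ∫ u, ‖charFun α u - charFun β u‖).toNNReal •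
      (volume : Measure ℝ) := by
  set κ := (2 * Real.pi)⁻¹ * ∫ u, ‖charFun α u - charFun β u‖ with hκ
  have hκ0 : 0 ≤ κ := by positivity
  set ν := β + κ.toNNReal • (volume : Measure ℝ) with hν
  have hlf : IsLocallyFiniteMeasure ν := by
    refine ⟨fun x => ?_⟩
    refine ⟨Set.Ioo (x - 1) (x + 1), Ioo_mem_nhds (by linarith) (by linarith), ?_⟩
    rw [hν, Measure.add_apply, Measure.smul_apply, ENNReal.add_lt_top]
    exact ⟨measure_lt_top _ _, ENNReal.mul_lt_top ENNReal.coe_lt_top (by simp)⟩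
  -- A smooth function between the indicators of `K` and `U` is a Schwartz function. Inner
  -- regularity of `α` and outer regularity of `ν` on compact sets extend the inequality to all
  -- measurable sets.
  have key : ∀ K : Set ℝ, IsCompact K → ∀ U, IsOpen U → K ⊆ U → α K ≤ ν U := by
    intro K hK U hU hKU
    obtain ⟨V, hV, hKV, hVU, hVc⟩ := exists_open_between_and_isCompact_closure hK hU hKU
    obtain ⟨f, hf, hrange, hsupp, hone⟩ := exists_contMDiff_support_eq_eq_one_iff
      (modelWithCornersSelf ℝ ℝ) (n := ⊤) hV hK.isClosed hKV
    have hfc : ContDiff ℝ (⊤ : ℕ∞) (fun x => (f x : ℂ)) :=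
      Complex.ofRealCLM.contDiff.comp hf.contDiff
    have hcs : HasCompactSupport (fun x => (f x : ℂ)) := by
      refine HasCompactSupport.of_support_subset_isCompact hVc ?_
      intro x hx
      apply subset_closure
      rw [← hsupp]
      simpa using hx
    have h01 : ∀ x, 0 ≤ f x ∧ f x ≤ 1 := fun x => hrange ⟨x, rfl⟩
    set g : 𝓢(ℝ, ℂ) := hcs.toSchwartzMap hfc
    have hg : ∀ x, g x = (f x : ℂ) := fun x => rfl
    have hmain := norm_integral_schwartz_sub_le hD g
    simp only [hg] at hmain
    rw [integral_complex_ofReal, integral_complex_ofReal, ← Complex.ofReal_sub, Complex.norm_real,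
      Real.norm_eq_abs, ← hκ] at hmain
    have hle := (le_abs_self _).trans hmain
    have hn : ∀ x, ‖((f x : ℝ) : ℂ)‖ = f x := fun x => by
      rw [Complex.norm_real, Real.norm_of_nonneg (h01 x).1]
    simp only [hn] at hle
    have hcont : Continuous f := hf.continuous
    have hfi : ∀ (m : Measure ℝ) [IsLocallyFiniteMeasure m], Integrable f m := fun m _ => by
      refine hcont.integrable_of_hasCompactSupport ?_
      exact HasCompactSupport.of_support_subset_isCompact hVc (hsupp ▸ subset_closure)
    have hle2 : ∫ x, f x ∂α ≤ ∫ x, f x ∂ν := by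
      rw [hν, integral_add_measure (hfi _) (hfi _), integral_smul_nnreal_measure,
        NNReal.smul_def, Real.coe_toNNReal _ hκ0, smul_eq_mul]
      linarith
    have hlint : ∫⁻ x, ENNReal.ofReal (f x) ∂α ≤ ∫⁻ x, ENNReal.ofReal (f x) ∂ν := by
      rw [← ofReal_integral_eq_lintegral_ofReal (hfi _) (.of_forall fun x => (h01 x).1),
        ← ofReal_integral_eq_lintegral_ofReal (hfi _) (.of_forall fun x => (h01 x).1)]
      exact ENNReal.ofReal_le_ofReal hle2
    calc α K = ∫⁻ x, K.indicator 1 x ∂α := (lintegral_indicator_one hK.measurableSet).symm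
      _ ≤ ∫⁻ x, ENNReal.ofReal (f x) ∂α := by
          refine lintegral_mono fun x => ?_
          by_cases hx : x ∈ K
          · simp [hx, (hone x).1 hx]
          · simp [hx]
      _ ≤ _ := hlint
      _ ≤ ∫⁻ x, U.indicator 1 x ∂ν := by
          refine lintegral_mono fun x => ?_
          by_cases hx : x ∈ U
          · simp [hx, (h01 x).2]
          · have : f x = 0 := by
              by_contra h
              exact hx (hVU (subset_closure (hsupp ▸ h)))
            simp [this]
      _ = ν U := lintegral_indicator_one hU.measurableSet
  refine Measure.le_intro fun s hs _ => ?_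
  rw [hs.measure_eq_iSup_isCompact_of_ne_top (measure_ne_top _ _)]
  refine iSup₂_le fun K hKs => iSup_le fun hK => ?_
  refine le_trans ?_ (measure_mono hKs)
  rw [hK.measure_eq_iInf_isOpen (μ := ν)]
  exact le_iInf₂ fun U hKU => le_iInf fun hU => key K hK U hU hKU

end Fourier

end HYExpansion

/-! ### Comparison of integrals through Laplace transforms on two vertical lines. -/

namespace HYExpansion

section FourierComparison

lemma integral_le_of_measure_le_add {α β : Measure ℝ} {k : ℝ≥0}
    (hle : α ≤ β + k • (volume : Measure ℝ)) {h : ℝ → ℝ} (h0 : 0 ≤ h)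
    (hv : Integrable h) (hβ : Integrable h β) :
    ∫ x, h x ∂α ≤ ∫ x, h x ∂β + k * ∫ x, h x := by
  have hs : Integrable h (k • (volume : Measure ℝ)) := hv.smul_measure_nnreal
  refine (integral_mono_measure hle (.of_forall h0) (hβ.add_measure hs)).trans ?_
  rw [integral_add_measure hβ hs, integral_smul_nnreal_measure, NNReal.smul_def, smul_eq_mul]

/-- Domination holds in both directions, which settles nonnegative functions. The bounds for the
positive and negative parts of `h` add up to `∫ |h|` with no loss. -/
lemma abs_integral_sub_le_of_charFun {α β : Measure ℝ} [IsFiniteMeasure α] [IsFiniteMeasure β]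
    (hD : Integrable (fun u => charFun α u - charFun β u)) {h : ℝ → ℝ}
    (hv : Integrable h) (hα : Integrable h α) (hβ : Integrable h β) :
    |∫ x, h x ∂α - ∫ x, h x ∂β| ≤
      (2 * Real.pi)⁻¹ * (∫ u, ‖charFun α u - charFun β u‖) * ∫ x, |h x| := by
  set κ := (2 * Real.pi)⁻¹ * (∫ u, ‖charFun α u - charFun β u‖) with hκ
  have hκ0 : 0 ≤ κ := by positivity
  have h1 := measure_le_add_smul_volume hD
  have h2 : β ≤ α + κ.toNNReal • (volume : Measure ℝ) := by
    have hs : (∫ u, ‖charFun β u - charFun α u‖) = ∫ u, ‖charFun α u - charFun β u‖ := by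
      simp_rw [norm_sub_rev]
    have := measure_le_add_smul_volume (α := β) (β := α) 
      (hD.neg.congr (.of_forall fun u => by simp))
    rwa [hs] at this
  rw [← hκ] at h1
  have key : ∀ g : ℝ → ℝ, 0 ≤ g → Integrable g → Integrable g α → Integrable g β →
      |∫ x, g x ∂α - ∫ x, g x ∂β| ≤ κ * ∫ x, g x := by
    intro g g0 gv gα gβ
    have e1 := integral_le_of_measure_le_add h1 g0 gv gβ
    have e2 := integral_le_of_measure_le_add h2 g0 gv gα
    rw [Real.coe_toNNReal _ hκ0] at e1 e2
    rw [abs_le]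
    constructor <;> linarith
  have kp := key (fun x => max (h x) 0) (fun x => le_max_right _ _) hv.pos_part hα.pos_part
    hβ.pos_part
  have kn := key (fun x => max (-h x) 0) (fun x => le_max_right _ _) hv.neg_part hα.neg_part
    hβ.neg_part
  have hdec : ∀ m : Measure ℝ, Integrable h m → ∫ x, h x ∂m =
      ∫ x, max (h x) 0 ∂m - ∫ x, max (-h x) 0 ∂m := fun m hm => by
    rw [← integral_sub hm.pos_part hm.neg_part]
    congr 1; ext x
    rcases le_total 0 (h x) with hx | hx <;> simp [hx]
  have habs : ∫ x, |h x| = (∫ x, max (h x) 0) + ∫ x, max (-h x) 0 := by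
    rw [← integral_add hv.pos_part hv.neg_part]
    congr 1; ext x
    rcases le_total 0 (h x) with hx | hx <;> simp [hx, abs_of_nonneg, abs_of_nonpos]
  rw [hdec α hα, hdec β hβ, habs, mul_add]
  refine le_trans (le_of_eq_of_le ?_ (abs_sub _ _)) (add_le_add kp kn)
  congr 1; ring

/-- Comparison of a probability measure with a signed density through their two-sided Laplace
transforms on the lines `Re w = 1` and `Re w = -1`. -/
lemma abs_integral_sub_integral_mul_le (μ : Measure ℝ) [IsFiniteMeasure μ] {q : ℝ → ℝ}
    (hμ : ∀ s : ℝ, |s| = 1 → Integrable (fun z => Real.exp (s * z)) μ)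
    (hq : ∀ s : ℝ, |s| = 1 → Integrable (fun z => Real.exp (s * z) * q z)) {κ : ℝ}
    (hD : ∀ s : ℝ, |s| = 1 → Integrable (fun u : ℝ =>
      ∫ z, Complex.exp ((s + u * Complex.I) * z) ∂μ
        - ∫ z : ℝ, Complex.exp ((s + u * Complex.I) * z) * q z))
    (hκ : ∀ s : ℝ, |s| = 1 → ∫ u : ℝ, ‖∫ z, Complex.exp ((s + u * Complex.I) * z) ∂μ
        - ∫ z : ℝ, Complex.exp ((s + u * Complex.I) * z) * q z‖ ≤ κ)
    {f : ℝ → ℝ} (hf : Integrable (fun z => f z / Real.cosh z)) (hfμ : Integrable f μ)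
    (hfq : Integrable (fun z => f z * q z)) :
    |∫ z, f z ∂μ - ∫ z, f z * q z| ≤ (2 * Real.pi)⁻¹ * κ * ∫ z, |f z| / Real.cosh z := by
  have hc0 : ∀ z, 0 < Real.cosh z := Real.cosh_pos
  have hqm : AEStronglyMeasurable q := by
    have h := (hq 1 (by simp)).aestronglyMeasurable
    have h2 : AEStronglyMeasurable (fun z : ℝ => Real.exp (-z)) :=
      (by fun_prop : Continuous fun z : ℝ => Real.exp (-z)).aestronglyMeasurable
    refine (h2.mul h).congr (.of_forall fun z => ?_)
    simp only [Pi.mul_apply]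
    rw [← mul_assoc, ← Real.exp_add]; simp
  have hcq : Integrable (fun z => Real.cosh z * q z) := by
    have h := ((hq 1 (by simp)).add (hq (-1) (by simp))).div_const 2
    refine h.congr (.of_forall fun z => ?_)
    simp only [Pi.add_apply, Real.cosh_eq]
    ring_nf
  have hcμ : Integrable (fun z => Real.cosh z) μ := by
    have h := ((hμ 1 (by simp)).add (hμ (-1) (by simp))).div_const 2
    refine h.congr (.of_forall fun z => ?_)
    simp only [Pi.add_apply, Real.cosh_eq]
    ring_nf
  have hqp : Integrable (fun z => Real.cosh z * max (q z) 0) := by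
    refine hcq.pos_part.congr (.of_forall fun z => ?_)
    simp only [mul_max_of_nonneg _ _ (hc0 z).le, mul_zero]
  have hqn : Integrable (fun z => Real.cosh z * max (-q z) 0) := by
    refine hcq.neg_part.congr (.of_forall fun z => ?_)
    simp only [mul_max_of_nonneg _ _ (hc0 z).le, mul_zero, mul_neg]
  -- The signed measure `cosh z · (μ - q dz)` is `α1 + α2 - β`: the negative part of `q` is moved to
  -- the side of `μ` so that only positive measures occur. As `cosh z = (eᶻ + e⁻ᶻ)/2`, its
  -- characteristic function is the mean of the transform differences on `Re w = 1` and `Re w = -1`.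
  -- The test function becomes `f / cosh`, which is integrable.
  set α1 := μ.withDensity (fun z => ENNReal.ofReal (Real.cosh z)) with hα1
  set α2 := (volume : Measure ℝ).withDensity
    (fun z => ENNReal.ofReal (Real.cosh z * max (-q z) 0)) with hα2
  set β := (volume : Measure ℝ).withDensity
    (fun z => ENNReal.ofReal (Real.cosh z * max (q z) 0)) with hβ
  have f1 : IsFiniteMeasure α1 := isFiniteMeasure_withDensity_ofReal hcμ.2
  have f2 : IsFiniteMeasure α2 := isFiniteMeasure_withDensity_ofReal hqn.2
  have f3 : IsFiniteMeasure β := isFiniteMeasure_withDensity_ofReal hqp.2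
  have hdens : ∀ {E : Type} [NormedAddCommGroup E] [NormedSpace ℝ E] (m : Measure ℝ) (d : ℝ → ℝ)
      (g : ℝ → E), AEMeasurable d m → (∀ z, 0 ≤ d z) →
      ∫ z, g z ∂(m.withDensity fun z => ENNReal.ofReal (d z)) = ∫ z, d z • g z ∂m := by
    intro E _ _ m d g hd hd0
    rw [integral_withDensity_eq_integral_toReal_smul₀ hd.ennreal_ofReal
      (.of_forall fun _ => ENNReal.ofReal_lt_top)]
    simp_rw [ENNReal.toReal_ofReal (hd0 _)]
  have hdensi : ∀ (m : Measure ℝ) (d : ℝ → ℝ)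
      (g : ℝ → ℝ), AEMeasurable d m → (∀ z, 0 ≤ d z) → Integrable (fun z => d z • g z) m →
      Integrable g (m.withDensity fun z => ENNReal.ofReal (d z)) := by
    intro m d g hd hd0 hi
    rw [integrable_withDensity_iff_integrable_smul₀' hd.ennreal_ofReal
      (.of_forall fun _ => ENNReal.ofReal_lt_top)]
    simp_rw [ENNReal.toReal_ofReal (hd0 _)]
    exact hi
  have hp0 : ∀ z, 0 ≤ Real.cosh z * max (q z) 0 := fun z => by have := hc0 z; positivity
  have hn0 : ∀ z, 0 ≤ Real.cosh z * max (-q z) 0 := fun z => by have := hc0 z; positivity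
  have hexp : ∀ (m : Measure ℝ) (d : ℝ → ℝ), Integrable d m → ∀ u : ℝ,
      Integrable (fun z => d z • Complex.exp (u * z * Complex.I)) m := by
    intro m d hd u
    refine (hd.norm.mono' (hd.aestronglyMeasurable.smul (by fun_prop)) (.of_forall fun z => ?_))
    rw [norm_smul, Complex.norm_exp]
    simp
  have hbddexp : ∀ (m : Measure ℝ) [IsFiniteMeasure m] (u : ℝ),
      Integrable (fun z : ℝ => Complex.exp (u * z * Complex.I)) m := by
    intro m _ u
    simpa using hexp m (fun _ => 1) (integrable_const _) u
  have hsplit : ∀ (s : ℝ) (u z : ℝ), Complex.exp ((s + u * Complex.I) * z)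
      = (Real.exp (s * z)) • Complex.exp (u * z * Complex.I) := by
    intro s u z
    rw [Complex.real_smul, Complex.ofReal_exp, ← Complex.exp_add]
    congr 1; push_cast; ring
  have hchar : ∀ u : ℝ, charFun (α1 + α2) u - charFun β u =
      (1 / 2 : ℂ) * ((∫ z, Complex.exp (((1 : ℝ) + u * Complex.I) * z) ∂μ
        - ∫ z : ℝ, Complex.exp (((1 : ℝ) + u * Complex.I) * z) * q z)
        + (∫ z, Complex.exp (((-1 : ℝ) + u * Complex.I) * z) ∂μ
        - ∫ z : ℝ, Complex.exp (((-1 : ℝ) + u * Complex.I) * z) * q z)) := by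
    intro u
    have eμ : ∀ s : ℝ, |s| = 1 →
        Integrable (fun z : ℝ => Complex.exp ((s + u * Complex.I) * z)) μ := fun s hs => by
      simp_rw [hsplit]; exact hexp μ _ (hμ s hs) u
    have eq' : ∀ s : ℝ, |s| = 1 →
        Integrable (fun z : ℝ => Complex.exp ((s + u * Complex.I) * z) * q z) := fun s hs => by
      refine (hexp volume _ (hq s hs) u).congr (.of_forall fun z => ?_)
      simp only [hsplit, Complex.real_smul]; push_cast; ring
    rw [charFun_apply_real, charFun_apply_real, integral_add_measure (hbddexp _ _) (hbddexp _ _),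
      hdens μ _ _ (by fun_prop) (fun z => (hc0 z).le),
      hdens volume _ _ hqn.aemeasurable hn0, hdens volume _ _ hqp.aemeasurable hp0, add_sub_assoc,
      ← integral_sub (hexp _ _ hqn u) (hexp _ _ hqp u), sub_add_sub_comm,
      ← integral_add (eμ 1 (by simp)) (eμ (-1) (by simp)),
      ← integral_add (eq' 1 (by simp)) (eq' (-1) (by simp)), mul_sub, sub_eq_add_neg,
      ← integral_const_mul, ← integral_const_mul, ← integral_neg]
    congr 2
    · ext z
      rw [hsplit, hsplit, ← add_smul, Real.cosh_eq, Complex.real_smul, Complex.real_smul]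
      push_cast
      ring_nf
    · ext z
      rw [hsplit, hsplit, ← add_mul, ← add_smul, ← sub_smul, ← mul_sub, Real.cosh_eq,
        Complex.real_smul, Complex.real_smul]
      have : max (-q z) 0 - max (q z) 0 = - q z := by
        rcases le_total 0 (q z) with h | h <;> simp [h]
      rw [this]
      push_cast
      ring_nf
  have hDi : Integrable (fun u => charFun (α1 + α2) u - charFun β u) := by
    simp_rw [hchar]
    exact ((hD 1 (by simp)).add (hD (-1) (by simp))).const_mul _
  have hDn : ∫ u, ‖charFun (α1 + α2) u - charFun β u‖ ≤ κ := by
    have i1 := (hD 1 (by simp)).norm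
    have i2 := (hD (-1) (by simp)).norm
    have k1 := hκ 1 (by simp)
    have k2 := hκ (-1) (by simp)
    have h := integral_mono hDi.norm ((i1.add i2).const_mul (1 / 2)) (fun u => by
      simp only [hchar, norm_mul, Pi.add_apply]
      have : ‖(1 / 2 : ℂ)‖ = 1 / 2 := by norm_num
      rw [this]
      gcongr
      exact norm_add_le _ _)
    rw [integral_const_mul, integral_add' i1 i2] at h
    linarith
  have e : ∀ z, Real.cosh z * (f z / Real.cosh z) = f z := fun z =>
    mul_div_cancel₀ _ (hc0 z).ne'
  have h1 : Integrable (fun z => Real.cosh z • (f z / Real.cosh z)) μ := by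
    simpa only [smul_eq_mul, e] using hfμ
  have hpi : Integrable (fun z => (Real.cosh z * max (q z) 0) • (f z / Real.cosh z)) := by
    refine hfq.abs.mono' ?_ (.of_forall fun z => ?_)
    · exact hqp.aestronglyMeasurable.smul hf.aestronglyMeasurable
    · rw [smul_eq_mul, mul_right_comm, e, Real.norm_eq_abs, abs_mul, abs_mul]
      refine mul_le_mul_of_nonneg_left ?_ (abs_nonneg _)
      rcases le_total 0 (q z) with h | h <;> simp [h]
  have hni : Integrable (fun z => (Real.cosh z * max (-q z) 0) • (f z / Real.cosh z)) := by
    refine hfq.abs.mono' ?_ (.of_forall fun z => ?_)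
    · exact hqn.aestronglyMeasurable.smul hf.aestronglyMeasurable
    · rw [smul_eq_mul, mul_right_comm, e, Real.norm_eq_abs, abs_mul, abs_mul]
      refine mul_le_mul_of_nonneg_left ?_ (abs_nonneg _)
      rcases le_total 0 (q z) with h | h <;> simp [h]
  have i1 : Integrable (fun z => f z / Real.cosh z) α1 :=
    hdensi _ _ _ (by fun_prop) (fun z => (hc0 z).le) h1
  have i2 : Integrable (fun z => f z / Real.cosh z) α2 := hdensi _ _ _ hqn.aemeasurable hn0 hni
  have i3 : Integrable (fun z => f z / Real.cosh z) β := hdensi _ _ _ hqp.aemeasurable hp0 hpi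
  have main := abs_integral_sub_le_of_charFun hDi hf (i1.add_measure i2) i3
  have hleft : ∫ z, f z / Real.cosh z ∂(α1 + α2) - ∫ z, f z / Real.cosh z ∂β =
      ∫ z, f z ∂μ - ∫ z, f z * q z := by
    rw [integral_add_measure i1 i2, hdens μ _ _ (by fun_prop) (fun z => (hc0 z).le),
      hdens volume _ _ hqn.aemeasurable hn0, hdens volume _ _ hqp.aemeasurable hp0, add_sub_assoc,
      ← integral_sub hni hpi, sub_eq_add_neg, ← integral_neg]
    congr 2
    · ext z; exact e z
    · ext z
      rw [← sub_smul, ← mul_sub, smul_eq_mul, mul_right_comm, e]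
      have : max (-q z) 0 - max (q z) 0 = - q z := by
        rcases le_total 0 (q z) with h | h <;> simp [h]
      rw [this]; ring
  rw [hleft] at main
  have habs : ∀ z, |f z / Real.cosh z| = |f z| / Real.cosh z := fun z => by
    rw [abs_div, abs_of_pos (hc0 z)]
  simp_rw [habs] at main
  refine main.trans ?_
  gcongr

end FourierComparison

end HYExpansion

/-! ### The Laplace transform of a weighted sum of centred chi-squares. -/

namespace HYExpansion

noncomputable section

/-- The exponent of `E exp(y (Z² - 1))` for a standard normal variable `Z`. -/
def chiSqExponent (y : ℂ) : ℂ := -(1 / 2) * Complex.log (1 - 2 * y) - y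

/-- Taylor's formula for `log (1 + z)` at `z = -2y`: the remainder is `(2‖y‖)⁴ (1 - 2‖y‖)⁻¹ / 4 ≤
8‖y‖⁴`, since `2‖y‖ ≤ 1/2`, and the factor `1/2` in front of the logarithm halves it. -/
lemma norm_chiSqExponent_sub_le {y : ℂ} (hy : ‖y‖ ≤ 1 / 4) :
    ‖chiSqExponent y - (y ^ 2 + 4 / 3 * y ^ 3)‖ ≤ 4 * ‖y‖ ^ 4 := by
  have hz : ‖-2 * y‖ = 2 * ‖y‖ := by rw [norm_mul]; simp
  have h := Complex.norm_log_sub_logTaylor_le 3 (z := -2 * y) (by rw [hz]; linarith)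
  rw [hz] at h
  have ht : Complex.logTaylor (3 + 1) (-2 * y) = -2 * y - 2 * y ^ 2 - 8 / 3 * y ^ 3 := by
    simp [Complex.logTaylor, Finset.sum_range_succ]
    ring
  rw [ht] at h
  have he : chiSqExponent y - (y ^ 2 + 4 / 3 * y ^ 3) =
      -(1 / 2) * (Complex.log (1 + -2 * y) - (-2 * y - 2 * y ^ 2 - 8 / 3 * y ^ 3)) := by
    rw [chiSqExponent, show 1 + -2 * y = 1 - 2 * y by ring]
    ring
  rw [he, norm_mul]
  have h2 : ‖(-(1 / 2) : ℂ)‖ = 1 / 2 := by norm_num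
  rw [h2]
  have h3 : (1 - 2 * ‖y‖)⁻¹ ≤ 2 := by
    rw [inv_le_comm₀ (by linarith) (by norm_num)]; linarith
  have h4 : (2 * ‖y‖) ^ (3 + 1) * (1 - 2 * ‖y‖)⁻¹ / ((3 : ℕ) + 1) ≤ 8 * ‖y‖ ^ 4 := by
    calc (2 * ‖y‖) ^ (3 + 1) * (1 - 2 * ‖y‖)⁻¹ / ((3 : ℕ) + 1)
        ≤ (2 * ‖y‖) ^ (3 + 1) * 2 / ((3 : ℕ) + 1) := by gcongr
      _ = 8 * ‖y‖ ^ 4 := by push_cast; ring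
  linarith

/-- For `|t| ≤ 1/4` the terms of the expansion are at most `1`, `1/3` and `1/4` times `t²`, with sum
below `2`. -/
lemma chiSqExponent_ofReal_re_le {t : ℝ} (ht : |t| ≤ 1 / 4) :
    (chiSqExponent t).re ≤ 2 * t ^ 2 := by
  have hn : ‖(t : ℂ)‖ = |t| := by rw [Complex.norm_real, Real.norm_eq_abs]
  have h := norm_chiSqExponent_sub_le (y := (t : ℂ)) (by rwa [hn])
  have h1 := (Complex.re_le_norm _).trans h
  have h2 : ((t : ℂ) ^ 2 + 4 / 3 * (t : ℂ) ^ 3).re = t ^ 2 + 4 / 3 * t ^ 3 := by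
    have : (t : ℂ) ^ 2 + 4 / 3 * (t : ℂ) ^ 3 = ((t ^ 2 + 4 / 3 * t ^ 3 : ℝ) : ℂ) := by push_cast; ring
    rw [this, Complex.ofReal_re]
  rw [Complex.sub_re, h2, hn] at h1
  have h3 : t ^ 3 ≤ 1 / 4 * t ^ 2 := by
    have := abs_le.1 ht
    nlinarith [sq_nonneg t]
  have h4 : |t| ^ 4 ≤ 1 / 16 * t ^ 2 := by
    have : |t| ^ 4 = |t| ^ 2 * |t| ^ 2 := by ring
    rw [this, sq_abs]
    have := abs_le.1 ht
    nlinarith [sq_nonneg t]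
  nlinarith

lemma norm_exp_chiSqExponent {y : ℂ} (hy : y.re < 1 / 2) :
    ‖Complex.exp (chiSqExponent y)‖ = ‖1 - 2 * y‖ ^ (-(1 / 2) : ℝ) * Real.exp (-y.re) := by
  have h0 : (1 - 2 * y) ≠ 0 := by
    intro h
    have := congrArg Complex.re h
    simp at this
    linarith
  rw [Complex.norm_exp, chiSqExponent, Complex.sub_re, sub_eq_add_neg, Real.exp_add,
    Real.rpow_def_of_pos (norm_pos_iff.2 h0)]
  congr 2
  have : ((-(1 / 2) : ℂ) * Complex.log (1 - 2 * y)).re = -(1 / 2) * (Complex.log (1 - 2 * y)).re := by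
    have : (-(1 / 2) : ℂ) = ((-(1 / 2) : ℝ) : ℂ) := by push_cast; ring
    rw [this, Complex.re_ofReal_mul]
  rw [this, Complex.log_re]
  ring

/-- Off the real line, the Laplace transform decays. -/
lemma norm_exp_chiSqExponent_le {s u x : ℝ} (hs : |s| = 1) (hx : |x| ≤ 1 / 8) :
    ‖Complex.exp (chiSqExponent ((s + u * Complex.I) * x))‖ ≤
      Real.exp (2 * x ^ 2) * (1 + u ^ 2 * x ^ 2) ^ (-(1 / 4) : ℝ) := by
  have hsx : |s * x| ≤ 1 / 8 := by rw [abs_mul, hs, one_mul]; exact hx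
  have hsx' := abs_le.1 hsx
  have hre : ((s + u * Complex.I) * x : ℂ).re = s * x := by simp
  have hs2 : s ^ 2 = 1 := by rw [← sq_abs, hs]; norm_num
  have hre2 : ((s * x : ℝ) : ℂ).re = s * x := Complex.ofReal_re _
  have h1 := norm_exp_chiSqExponent (y := (s + u * Complex.I) * x) (by rw [hre]; linarith)
  have h2 := norm_exp_chiSqExponent (y := ((s * x : ℝ) : ℂ)) (by rw [hre2]; linarith)
  have h3 : ‖Complex.exp (chiSqExponent ((s * x : ℝ) : ℂ))‖ ≤ Real.exp (2 * x ^ 2) := by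
    rw [Complex.norm_exp]
    refine Real.exp_le_exp.2 ((chiSqExponent_ofReal_re_le (by linarith)).trans ?_)
    rw [mul_pow, hs2]; linarith
  rw [hre] at h1
  rw [hre2] at h2
  rw [h2] at h3
  rw [h1]
  have hpos : 0 < 1 - 2 * (s * x) := by linarith
  have hn2 : ‖1 - 2 * ((s * x : ℝ) : ℂ)‖ = 1 - 2 * (s * x) := by
    have : (1 - 2 * ((s * x : ℝ) : ℂ)) = ((1 - 2 * (s * x) : ℝ) : ℂ) := by push_cast; ring
    rw [this, Complex.norm_real, Real.norm_of_nonneg hpos.le]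
  rw [hn2] at h3
  have hbase : 0 < 1 + u ^ 2 * x ^ 2 := by positivity
  -- The value at `u = 0`, already bounded by `h3`, is split off. The squared modulus is `(1 - 2sx)²
  -- + 4u²x²`, and `(1 - 2sx)² ≤ 4` allows `(1 - 2sx)²` to be factored out of both terms.
  have hlow : (1 - 2 * (s * x)) * (1 + u ^ 2 * x ^ 2) ^ (1 / 2 : ℝ) ≤
      ‖1 - 2 * ((s + u * Complex.I) * x : ℂ)‖ := by
    rw [← Real.sqrt_eq_rpow, Complex.norm_eq_sqrt_sq_add_sq]
    apply Real.le_sqrt_of_sq_le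
    rw [mul_pow, Real.sq_sqrt hbase.le]
    have e1 : (1 - 2 * ((s + u * Complex.I) * x : ℂ)).re = 1 - 2 * (s * x) := by simp
    have e2 : (1 - 2 * ((s + u * Complex.I) * x : ℂ)).im = -2 * (u * x) := by simp
    rw [e1, e2]
    have : (1 - 2 * (s * x)) ^ 2 ≤ 4 := by nlinarith
    nlinarith [sq_nonneg (u * x)]
  have hpow : ‖1 - 2 * ((s + u * Complex.I) * x : ℂ)‖ ^ (-(1 / 2) : ℝ) ≤
      (1 - 2 * (s * x)) ^ (-(1 / 2) : ℝ) * (1 + u ^ 2 * x ^ 2) ^ (-(1 / 4) : ℝ) := by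
    calc _ ≤ ((1 - 2 * (s * x)) * (1 + u ^ 2 * x ^ 2) ^ (1 / 2 : ℝ)) ^ (-(1 / 2) : ℝ) :=
          Real.rpow_le_rpow_of_nonpos (by positivity) hlow (by norm_num)
      _ = _ := by
          rw [Real.mul_rpow hpos.le (by positivity), ← Real.rpow_mul hbase.le]
          norm_num
  calc _ ≤ (1 - 2 * (s * x)) ^ (-(1 / 2) : ℝ) * (1 + u ^ 2 * x ^ 2) ^ (-(1 / 4) : ℝ) *
        Real.exp (-(s * x)) := by gcongr
    _ = ((1 - 2 * (s * x)) ^ (-(1 / 2) : ℝ) * Real.exp (-(s * x))) *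
        (1 + u ^ 2 * x ^ 2) ^ (-(1 / 4) : ℝ) := by ring
    _ ≤ _ := by gcongr

variable {ι : Type*} [Fintype ι]

/-- The two-sided Laplace transform of `∑ xⱼ (Zⱼ² - 1)`. -/
def chiSqLaplace (x : ι → ℝ) (w : ℂ) : ℂ := Complex.exp (∑ j, chiSqExponent (w * x j))

/-- Of the four powers of `x j` in the remainder, two go into the uniform bound `m` and two are
kept. With `m = O(δ)` and `∑ x j ^ 2` bounded the error is `O(δ²‖w‖⁴)`, whatever the number of
weights. -/
lemma norm_sum_chiSqExponent_sub_le (x : ι → ℝ) {m : ℝ} (hx : ∀ j, |x j| ≤ m) {w : ℂ}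
    (hw : ‖w‖ * m ≤ 1 / 4) :
    ‖∑ j, chiSqExponent (w * x j) - (w ^ 2 * (∑ j, x j ^ 2 : ℝ) + 4 / 3 * w ^ 3 *
      (∑ j, x j ^ 3 : ℝ))‖ ≤ 4 * ‖w‖ ^ 4 * m ^ 2 * ∑ j, x j ^ 2 := by
  have e : ∑ j, chiSqExponent (w * x j) - (w ^ 2 * (∑ j, x j ^ 2 : ℝ) + 4 / 3 * w ^ 3 *
      (∑ j, x j ^ 3 : ℝ)) =
      ∑ j, (chiSqExponent (w * x j) - ((w * x j) ^ 2 + 4 / 3 * (w * x j) ^ 3)) := by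
    rw [Finset.sum_sub_distrib, Finset.sum_add_distrib]
    push_cast
    rw [Finset.mul_sum, Finset.mul_sum]
    congr 2 <;> refine Finset.sum_congr rfl fun j _ => by ring
  rw [e, Finset.mul_sum]
  refine (norm_sum_le _ _).trans (Finset.sum_le_sum fun j _ => ?_)
  have hn : ‖w * x j‖ = ‖w‖ * |x j| := by rw [norm_mul, Complex.norm_real, Real.norm_eq_abs]
  refine (norm_chiSqExponent_sub_le ?_).trans ?_
  · rw [hn]; exact (mul_le_mul_of_nonneg_left (hx j) (norm_nonneg _)).trans hw
  · rw [hn]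
    have : (‖w‖ * |x j|) ^ 4 = ‖w‖ ^ 4 * (|x j| ^ 2 * x j ^ 2) := by rw [← sq_abs (x j)]; ring
    rw [this]
    have h2 : |x j| ^ 2 ≤ m ^ 2 := by gcongr; exact hx j
    calc 4 * (‖w‖ ^ 4 * (|x j| ^ 2 * x j ^ 2)) ≤ 4 * (‖w‖ ^ 4 * (m ^ 2 * x j ^ 2)) := by gcongr
      _ = _ := by ring

/-- Bernoulli's inequality `(1 + v²)^p ≤ 1 + p v²` with `p = t² x j ^ 2 ≤ 1` gives all factors the
same base `1 + v²`. The exponents then add up, and the decay is governed by `∑ x j ^ 2` alone. -/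
lemma norm_chiSqLaplace_le (x : ι → ℝ) (hx : ∀ j, |x j| ≤ 1 / 8) {s u v : ℝ} (hs : |s| = 1)
    {t : ℝ} (hu : u = t * v) (ht : ∀ j, t ^ 2 * x j ^ 2 ≤ 1) :
    ‖chiSqLaplace x (s + u * Complex.I)‖ ≤
      Real.exp (2 * ∑ j, x j ^ 2) * (1 + v ^ 2) ^ (-(1 / 4) * (t ^ 2 * ∑ j, x j ^ 2)) := by
  rw [chiSqLaplace, Complex.exp_sum, norm_prod, Finset.mul_sum, Finset.mul_sum, Finset.mul_sum,
    Real.exp_sum, Real.rpow_sum_of_pos (by positivity), ← Finset.prod_mul_distrib]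
  refine Finset.prod_le_prod (fun _ _ => norm_nonneg _) fun j _ => ?_
  refine (norm_exp_chiSqExponent_le hs (hx j)).trans ?_
  gcongr
  have hb : (1 + v ^ 2) ^ (t ^ 2 * x j ^ 2) ≤ 1 + (t ^ 2 * x j ^ 2) * v ^ 2 :=
    rpow_one_add_le_one_add_mul_self (by nlinarith [sq_nonneg v]) (by positivity) (ht j)
  have hb' : (1 + v ^ 2) ^ (t ^ 2 * x j ^ 2) ≤ 1 + u ^ 2 * x j ^ 2 := by
    rw [hu]; refine hb.trans_eq (by ring)
  calc (1 + u ^ 2 * x j ^ 2) ^ (-(1 / 4) : ℝ)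
      ≤ ((1 + v ^ 2) ^ (t ^ 2 * x j ^ 2)) ^ (-(1 / 4) : ℝ) :=
        Real.rpow_le_rpow_of_nonpos (by positivity) hb' (by norm_num)
    _ = _ := by rw [← Real.rpow_mul (by positivity)]; ring_nf

end

end HYExpansion

/-! ### Edgeworth expansion of the Laplace transform. -/

namespace HYExpansion

noncomputable section

/-- The two-sided Laplace transform of the first order Edgeworth density with variance `l`
expanded around `c`, and third cumulant `k`. -/
def edgeworthLaplace (c l k : ℝ) (w : ℂ) : ℂ :=
  Complex.exp (c * w ^ 2 / 2) * (1 + (l - c : ℝ) / 2 * w ^ 2 + k / 6 * w ^ 3)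

section

variable {s u : ℝ}

lemma normSq_line (hs : |s| = 1) : ‖(s + u * Complex.I : ℂ)‖ ^ 2 = 1 + u ^ 2 := by
  have hs2 : s ^ 2 = 1 := by rw [← sq_abs, hs]; norm_num
  rw [Complex.sq_norm, Complex.normSq_add_mul_I, hs2]

lemma one_le_norm_line (hs : |s| = 1) : 1 ≤ ‖(s + u * Complex.I : ℂ)‖ := by
  have h := normSq_line (u := u) hs
  nlinarith [norm_nonneg (s + u * Complex.I : ℂ), sq_nonneg u]

lemma norm_exp_line (hs : |s| = 1) (c : ℝ) :
    ‖Complex.exp (c * (s + u * Complex.I : ℂ) ^ 2 / 2)‖ = Real.exp (c * (1 - u ^ 2) / 2) := by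
  have hs2 : s ^ 2 = 1 := by rw [← sq_abs, hs]; norm_num
  rw [Complex.norm_exp]
  congr 1
  have : (c * (s + u * Complex.I : ℂ) ^ 2 / 2) =
      ((c * (s ^ 2 - u ^ 2) / 2 : ℝ) : ℂ) + ((c * s * u : ℝ) : ℂ) * Complex.I := by
    push_cast
    ring_nf
    rw [Complex.I_sq]
    ring
  rw [this, Complex.add_re, Complex.re_ofReal_mul, Complex.ofReal_re, Complex.I_re, hs2]
  ring

end

/-- Absorbs the factor `‖w‖⁶ = (1 + u²)³` into a small part of the Gaussian decay. -/
lemma cube_le_mul_exp {κ y : ℝ} (hκ : 0 < κ) (hy : 0 ≤ y) :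
    y ^ 3 ≤ 6 / κ ^ 3 * Real.exp (κ * y) := by
  have h := Real.pow_div_factorial_le_exp (κ * y) (by positivity) 3
  have h3 : (Nat.factorial 3 : ℝ) = 6 := by norm_num [Nat.factorial]
  rw [h3] at h
  have : y ^ 3 = 6 / κ ^ 3 * ((κ * y) ^ 3 / 6) := by field_simp
  rw [this]
  gcongr

variable {ι : Type*} [Fintype ι]

lemma abs_sum_cube_le (x : ι → ℝ) {m : ℝ} (hx : ∀ j, |x j| ≤ m) :
    |∑ j, x j ^ 3| ≤ m * ∑ j, x j ^ 2 := by
  rw [Finset.mul_sum]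
  refine (Finset.abs_sum_le_sum_abs _ _).trans (Finset.sum_le_sum fun j _ => ?_)
  have : |x j ^ 3| = |x j| * x j ^ 2 := by rw [abs_pow, ← sq_abs (x j)]; ring
  rw [this]
  gcongr
  exact hx j

/-- The first order term of the exponent after removal of the Gaussian part. -/
lemma norm_edgeworth_correction_le (x : ι → ℝ) {c δ C₀ : ℝ} (hC₀ : 0 < C₀) (hδ : 0 < δ)
    (hδ1 : δ ≤ 1) (hx : ∀ j, |x j| ≤ C₀ * δ) (hvar : |2 * ∑ j, x j ^ 2 - c| ≤ δ) {w : ℂ}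
    (hw : 1 ≤ ‖w‖) :
    ‖((2 * ∑ j, x j ^ 2 - c : ℝ) : ℂ) / 2 * w ^ 2 + ((8 * ∑ j, x j ^ 3 : ℝ) : ℂ) / 6 * w ^ 3‖ ≤
      (1 / 2 + 4 / 3 * C₀ * (c + 1)) * δ * ‖w‖ ^ 3 := by
  have hS := abs_le.1 hvar
  have hS0 : 0 ≤ ∑ j, x j ^ 2 := Finset.sum_nonneg fun j _ => sq_nonneg _
  have hS3 := abs_sum_cube_le x hx
  have h23 : ‖w‖ ^ 2 ≤ ‖w‖ ^ 3 := pow_le_pow_right₀ hw (by norm_num)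
  refine (norm_add_le _ _).trans ?_
  rw [norm_mul, norm_mul, norm_div, norm_div, Complex.norm_real, Complex.norm_real, norm_pow,
    norm_pow, Real.norm_eq_abs, Real.norm_eq_abs, abs_mul]
  simp only [Complex.norm_ofNat, Nat.abs_ofNat]
  have h1 : |2 * ∑ j, x j ^ 2 - c| / 2 * ‖w‖ ^ 2 ≤ δ / 2 * ‖w‖ ^ 3 := by gcongr
  have h2 : 8 * |∑ j, x j ^ 3| / 6 * ‖w‖ ^ 3 ≤ 8 * (C₀ * δ * (c + 1)) / 6 * ‖w‖ ^ 3 := by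
    gcongr
    refine hS3.trans ?_
    gcongr
    linarith
  nlinarith

/-- Beyond `cw²/2` the exponent is `E₁ + R` with `E₁ = O(δ‖w‖³)` and `R = O(δ²‖w‖⁴)`, while the
Edgeworth transform is `exp(cw²/2)(1 + E₁)`. The difference is therefore `exp(cw²/2)` times `(exp(E₁
+ R) - 1 - (E₁ + R)) + R`, of second order in `δ`. The condition on `ε` forces `‖E₁ + R‖ ≤
(c/8)‖w‖²`, so the Gaussian factor wins over `exp ‖E₁ + R‖`. -/
lemma norm_chiSqLaplace_sub_le_of_small (x : ι → ℝ) {c δ C₀ ε A₁ A₂ : ℝ} (hc : 0 < c)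
    (hC₀ : 0 < C₀)
    (hδ : 0 < δ) (hδ1 : δ ≤ 1) (hx : ∀ j, |x j| ≤ C₀ * δ) (hvar : |2 * ∑ j, x j ^ 2 - c| ≤ δ)
    (hε1 : ε ≤ 1) (hεC : ε * C₀ ≤ 1 / 4) (hA₁ : A₁ = 1 / 2 + 4 / 3 * C₀ * (c + 1))
    (hA₂ : A₂ = 4 * C₀ ^ 2 * (c + 1)) (hεA : (A₁ + A₂) * ε ≤ c / 8)
    {s u : ℝ} (hs : |s| = 1) (hw : δ * ‖(s + u * Complex.I : ℂ)‖ ≤ ε) :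
    ‖chiSqLaplace x (s + u * Complex.I) -
      edgeworthLaplace c (2 * ∑ j, x j ^ 2) (8 * ∑ j, x j ^ 3) (s + u * Complex.I)‖ ≤
    ((A₁ + A₂) ^ 2 + A₂) * (3072 / c ^ 3) * Real.exp (3 / 4 * c) * δ ^ 2 *
      Real.exp (-(c / 4) * u ^ 2) := by
  have hw1 := one_le_norm_line (u := u) hs
  have hr2 := normSq_line (u := u) hs
  have hE := norm_exp_line (u := u) hs c
  set w : ℂ := s + u * Complex.I with hwdef
  set S2 := ∑ j, x j ^ 2 with hS2
  set S3 := ∑ j, x j ^ 3 with hS3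
  have hS0 : 0 ≤ S2 := Finset.sum_nonneg fun j _ => sq_nonneg _
  have hvar' := abs_le.1 hvar
  have hA₁0 : 0 ≤ A₁ := by rw [hA₁]; positivity
  have hA₂0 : 0 ≤ A₂ := by rw [hA₂]; positivity
  have hrem := norm_sum_chiSqExponent_sub_le x hx (w := w)
    (by nlinarith [norm_nonneg w])
  rw [← hS2, ← hS3] at hrem
  have hcor := norm_edgeworth_correction_le x hC₀ hδ hδ1 hx hvar hw1
  rw [← hS2, ← hS3, ← hA₁] at hcor
  set E₁ : ℂ := ((2 * S2 - c : ℝ) : ℂ) / 2 * w ^ 2 + ((8 * S3 : ℝ) : ℂ) / 6 * w ^ 3 with hE₁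
  set R : ℂ := ∑ j, chiSqExponent (w * x j) - (w ^ 2 * (S2 : ℝ) + 4 / 3 * w ^ 3 * (S3 : ℝ)) with hR
  have hR' : ‖R‖ ≤ A₂ * δ ^ 2 * ‖w‖ ^ 4 := by
    refine hrem.trans ?_
    have : S2 ≤ c + 1 := by linarith
    calc 4 * ‖w‖ ^ 4 * (C₀ * δ) ^ 2 * S2 ≤ 4 * ‖w‖ ^ 4 * (C₀ * δ) ^ 2 * (c + 1) := by gcongr
      _ = _ := by rw [hA₂]; ring
  have hM : chiSqLaplace x w = Complex.exp (c * w ^ 2 / 2) * Complex.exp (E₁ + R) := by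
    rw [chiSqLaplace, ← Complex.exp_add]
    congr 1
    rw [hE₁, hR]
    push_cast
    ring
  have hdiff : chiSqLaplace x w - edgeworthLaplace c (2 * S2) (8 * S3) w =
      Complex.exp (c * w ^ 2 / 2) * ((Complex.exp (E₁ + R) - (1 + (E₁ + R))) + R) := by
    rw [hM, edgeworthLaplace, hE₁]
    ring
  have hET : ‖E₁ + R‖ ≤ (A₁ + A₂) * δ * ‖w‖ ^ 3 := by
    refine (norm_add_le _ _).trans ?_
    have : A₂ * δ ^ 2 * ‖w‖ ^ 4 ≤ A₂ * δ * ‖w‖ ^ 3 := by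
      have h1 : δ * ‖w‖ ≤ 1 := hw.trans hε1
      calc A₂ * δ ^ 2 * ‖w‖ ^ 4 = A₂ * δ * ‖w‖ ^ 3 * (δ * ‖w‖) := by ring
        _ ≤ A₂ * δ * ‖w‖ ^ 3 * 1 := by gcongr
        _ = _ := by ring
    calc ‖E₁‖ + ‖R‖ ≤ A₁ * δ * ‖w‖ ^ 3 + A₂ * δ * ‖w‖ ^ 3 := add_le_add hcor (hR'.trans this)
      _ = _ := by ring
  have hET2 : ‖E₁ + R‖ ≤ c / 8 * (1 + u ^ 2) := by
    refine hET.trans ?_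
    calc (A₁ + A₂) * δ * ‖w‖ ^ 3 = (A₁ + A₂) * (δ * ‖w‖) * ‖w‖ ^ 2 := by ring
      _ ≤ (A₁ + A₂) * ε * ‖w‖ ^ 2 := by gcongr
      _ ≤ c / 8 * ‖w‖ ^ 2 := by gcongr
      _ = _ := by rw [hr2]
  have hexp2 : ‖Complex.exp (E₁ + R) - (1 + (E₁ + R))‖ ≤
      ‖E₁ + R‖ ^ 2 * Real.exp ‖E₁ + R‖ := by
    have := Complex.norm_exp_sub_sum_le_norm_mul_exp (E₁ + R) 2
    simpa [Finset.sum_range_succ] using this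
  have hr6 : ‖w‖ ^ 6 = (1 + u ^ 2) ^ 3 := by rw [← hr2]; ring
  have hr46 : ‖w‖ ^ 4 ≤ ‖w‖ ^ 6 := pow_le_pow_right₀ hw1 (by norm_num)
  have hbig : ‖(Complex.exp (E₁ + R) - (1 + (E₁ + R))) + R‖ ≤
      ((A₁ + A₂) ^ 2 + A₂) * δ ^ 2 * (1 + u ^ 2) ^ 3 * Real.exp (c / 8 * (1 + u ^ 2)) := by
    have hone : 1 ≤ Real.exp (c / 8 * (1 + u ^ 2)) := Real.one_le_exp (by positivity)
    calc _ ≤ ‖E₁ + R‖ ^ 2 * Real.exp ‖E₁ + R‖ + ‖R‖ :=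
          (norm_add_le _ _).trans (by gcongr)
      _ ≤ ((A₁ + A₂) * δ * ‖w‖ ^ 3) ^ 2 * Real.exp (c / 8 * (1 + u ^ 2)) +
          A₂ * δ ^ 2 * ‖w‖ ^ 6 * Real.exp (c / 8 * (1 + u ^ 2)) := by
          gcongr
          refine hR'.trans ?_
          calc A₂ * δ ^ 2 * ‖w‖ ^ 4 ≤ A₂ * δ ^ 2 * ‖w‖ ^ 6 * 1 := by rw [mul_one]; gcongr
            _ ≤ _ := by gcongr
      _ = _ := by rw [← hr6]; ring
  rw [hdiff, norm_mul, hE]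
  calc _ ≤ Real.exp (c * (1 - u ^ 2) / 2) * (((A₁ + A₂) ^ 2 + A₂) * δ ^ 2 * (1 + u ^ 2) ^ 3 *
        Real.exp (c / 8 * (1 + u ^ 2))) := by gcongr
    _ ≤ Real.exp (c * (1 - u ^ 2) / 2) * (((A₁ + A₂) ^ 2 + A₂) * δ ^ 2 *
        (6 / (c / 8) ^ 3 * Real.exp (c / 8 * (1 + u ^ 2))) * Real.exp (c / 8 * (1 + u ^ 2))) := by
        gcongr
        exact cube_le_mul_exp (by positivity) (by positivity)
    _ = ((A₁ + A₂) ^ 2 + A₂) * (6 / (c / 8) ^ 3) * δ ^ 2 *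
        (Real.exp (c * (1 - u ^ 2) / 2) * Real.exp (c / 8 * (1 + u ^ 2)) *
          Real.exp (c / 8 * (1 + u ^ 2))) := by ring
    -- Here `6 / (c/8)³ = 3072 / c³`, and the exponents `c(1 - u²)/2 + 2 · (c/8)(1 + u²)` add up to
    -- `3c/4 - cu²/4`.
    _ = ((A₁ + A₂) ^ 2 + A₂) * (3072 / c ^ 3) * δ ^ 2 *
        (Real.exp (3 / 4 * c) * Real.exp (-(c / 4) * u ^ 2)) := by
        rw [← Real.exp_add, ← Real.exp_add, ← Real.exp_add]
        congr 2
        · field_simp; ring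
        · ring_nf
    _ = _ := by ring

/-- Where `δ‖w‖ > ε`, the factor `(δ‖w‖/ε)² ≥ 1` can be inserted for free. It produces `δ²`, and the
Gaussian decay absorbs the extra powers of `‖w‖`. -/
lemma norm_edgeworthLaplace_le_of_large (x : ι → ℝ) {c δ C₀ ε A₁ : ℝ} (hc : 0 < c)
    (hC₀ : 0 < C₀)
    (hδ : 0 < δ) (hδ1 : δ ≤ 1) (hx : ∀ j, |x j| ≤ C₀ * δ) (hvar : |2 * ∑ j, x j ^ 2 - c| ≤ δ)
    (hε : 0 < ε) (hA₁ : A₁ = 1 / 2 + 4 / 3 * C₀ * (c + 1))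
    {s u : ℝ} (hs : |s| = 1) (hw : ε < δ * ‖(s + u * Complex.I : ℂ)‖) :
    ‖edgeworthLaplace c (2 * ∑ j, x j ^ 2) (8 * ∑ j, x j ^ 3) (s + u * Complex.I)‖ ≤
    (1 + A₁) * (3072 / c ^ 3) / ε ^ 2 * Real.exp (3 / 4 * c) * δ ^ 2 *
      Real.exp (-(c / 4) * u ^ 2) := by
  have hw1 := one_le_norm_line (u := u) hs
  have hr2 := normSq_line (u := u) hs
  have hE := norm_exp_line (u := u) hs c
  have hA₁0 : 0 ≤ A₁ := by rw [hA₁]; positivity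
  set w : ℂ := s + u * Complex.I with hwdef
  have hcor := norm_edgeworth_correction_le x hC₀ hδ hδ1 hx hvar hw1
  rw [← hA₁] at hcor
  have hr6 : ‖w‖ ^ 6 = (1 + u ^ 2) ^ 3 := by rw [← hr2]; ring
  have hfac : ‖1 + ((2 * ∑ j, x j ^ 2 - c : ℝ) : ℂ) / 2 * w ^ 2 +
      ((8 * ∑ j, x j ^ 3 : ℝ) : ℂ) / 6 * w ^ 3‖ ≤ (1 + A₁) * ‖w‖ ^ 3 := by
    rw [add_assoc]
    refine (norm_add_le _ _).trans ?_
    rw [norm_one]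
    have h1 : 1 ≤ ‖w‖ ^ 3 := one_le_pow₀ hw1
    have h2 : A₁ * δ * ‖w‖ ^ 3 ≤ A₁ * 1 * ‖w‖ ^ 3 := by gcongr
    nlinarith
  have hsq : 1 ≤ (δ * ‖w‖ / ε) ^ 2 := one_le_pow₀ ((one_le_div hε).2 hw.le)
  have hfac2 : (1 + A₁) * ‖w‖ ^ 3 ≤ (1 + A₁) / ε ^ 2 * δ ^ 2 * (1 + u ^ 2) ^ 3 := by
    calc (1 + A₁) * ‖w‖ ^ 3 ≤ (1 + A₁) * ‖w‖ ^ 3 * (δ * ‖w‖ / ε) ^ 2 * 1 := by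
          rw [mul_one]
          exact le_mul_of_one_le_right (by positivity) hsq
      _ ≤ (1 + A₁) * ‖w‖ ^ 3 * (δ * ‖w‖ / ε) ^ 2 * ‖w‖ := by gcongr
      _ = _ := by rw [← hr6]; field_simp
  rw [edgeworthLaplace, norm_mul, hE]
  have hexple : c * (1 - u ^ 2) / 2 + c / 8 * (1 + u ^ 2) ≤ 3 / 4 * c + -(c / 4) * u ^ 2 := by
    nlinarith [sq_nonneg u]
  calc _ ≤ Real.exp (c * (1 - u ^ 2) / 2) * ((1 + A₁) / ε ^ 2 * δ ^ 2 * (1 + u ^ 2) ^ 3) := by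
        gcongr
        exact hfac.trans hfac2
    _ ≤ Real.exp (c * (1 - u ^ 2) / 2) * ((1 + A₁) / ε ^ 2 * δ ^ 2 *
        (6 / (c / 8) ^ 3 * Real.exp (c / 8 * (1 + u ^ 2)))) := by
        gcongr
        exact cube_le_mul_exp (by positivity) (by positivity)
    _ = (1 + A₁) / ε ^ 2 * δ ^ 2 * (6 / (c / 8) ^ 3) *
        Real.exp (c * (1 - u ^ 2) / 2 + c / 8 * (1 + u ^ 2)) := by rw [Real.exp_add]; ring
    _ ≤ (1 + A₁) / ε ^ 2 * δ ^ 2 * (6 / (c / 8) ^ 3) *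
        Real.exp (3 / 4 * c + -(c / 4) * u ^ 2) := by gcongr
    _ = _ := by rw [Real.exp_add]; field_simp; norm_num

/-- One factor `(1 + (u/t)²)⁻¹` is kept to ensure integrability in `u`. In the other `N - 1` the
base is at least `2`, and the exponential smallness `2^(-(N-1))` is weakened to `16/N²`. -/
lemma rpow_neg_le_of_one_le {N t u : ℝ} (hN1 : 1 ≤ N) (ht1 : 1 ≤ t) (hut : t ^ 2 ≤ u ^ 2) :
    (1 + (u / t) ^ 2) ^ (-N) ≤ (t ^ 2 * (1 + u ^ 2)⁻¹) * (16 / N ^ 2) := by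
  have hv : 1 ≤ (u / t) ^ 2 := by
    rw [div_pow, one_le_div (by positivity)]; exact hut
  have hb2 : (2 : ℝ) ≤ 1 + (u / t) ^ 2 := by linarith
  have hb0 : (0 : ℝ) < 1 + (u / t) ^ 2 := by linarith
  have s2 : (1 + (u / t) ^ 2) ^ (-N) = (1 + (u / t) ^ 2)⁻¹ * (1 + (u / t) ^ 2) ^ (-(N - 1)) := by
    rw [← Real.rpow_neg_one, ← Real.rpow_add hb0]; ring_nf
  have s3 : (1 + (u / t) ^ 2) ^ (-(N - 1)) ≤ (2 : ℝ) ^ (-(N - 1)) :=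
    Real.rpow_le_rpow_of_nonpos (by norm_num) hb2 (by linarith)
  have s4 : (2 : ℝ) ^ (-(N - 1)) ≤ 16 / N ^ 2 := by
    rw [Real.rpow_neg (by norm_num), Real.rpow_sub (by norm_num), Real.rpow_one]
    have h2 : N ^ 2 / 8 ≤ (2 : ℝ) ^ N := by
      rw [Real.rpow_def_of_pos (by norm_num)]
      have hl : (1 / 2 : ℝ) ≤ Real.log 2 := by have := Real.log_two_gt_d9; linarith
      have hN0 : 0 ≤ N := by linarith
      have hq := Real.pow_div_factorial_le_exp (Real.log 2 * N) (by positivity) 2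
      have h3 : (Nat.factorial 2 : ℝ) = 2 := by norm_num [Nat.factorial]
      rw [h3] at hq
      refine le_trans ?_ hq
      calc N ^ 2 / 8 = (1 / 2 * N) ^ 2 / 2 := by ring
        _ ≤ _ := by gcongr
    rw [inv_div, div_le_div_iff₀ (by positivity) (by positivity)]
    linarith
  have s5 : (1 + (u / t) ^ 2)⁻¹ ≤ t ^ 2 * (1 + u ^ 2)⁻¹ := by
    rw [← div_eq_mul_inv, inv_le_comm₀ hb0 (by positivity), inv_div, div_pow,
      div_le_iff₀ (by positivity)]
    have : (1 + u ^ 2 / t ^ 2) * t ^ 2 = t ^ 2 + u ^ 2 := by field_simp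
    rw [this]
    have : 1 ≤ t ^ 2 := one_le_pow₀ ht1
    linarith
  rw [s2]
  gcongr
  exact s3.trans s4

/-- Take `t = ε/(2δ)` in `norm_chiSqLaplace_le`. Then `t² x j ^ 2 ≤ (εC₀/2)² ≤ 1`, and since `∑ x j
^ 2 ≥ c/4` the exponent is at least `N = ε²c/(64δ²)`. The bound `t² · 16/N²` of
`rpow_neg_le_of_one_le` is of order `δ⁻² · δ⁴ = δ²`. The smallness conditions on `δ` ensure `t ≥ 1`
and `N ≥ 1`. -/
lemma norm_chiSqLaplace_le_of_large (x : ι → ℝ) {c δ C₀ ε : ℝ} (hc : 0 < c)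
    (hC₀ : 0 < C₀)
    (hδ : 0 < δ) (hδ1 : δ ≤ 1) (hx : ∀ j, |x j| ≤ C₀ * δ) (hvar : |2 * ∑ j, x j ^ 2 - c| ≤ δ)
    (hε : 0 < ε) (hε1 : ε ≤ 1) (hεC : ε * C₀ ≤ 1 / 4)
    (hδC : C₀ * δ ≤ 1 / 8) (hδc : δ ≤ c / 2) (hδε : δ ≤ ε / 2) (hδN : δ ≤ ε ^ 2 * c / 64)
    {s u : ℝ} (hs : |s| = 1) (hw : ε < δ * ‖(s + u * Complex.I : ℂ)‖) :
    ‖chiSqLaplace x (s + u * Complex.I)‖ ≤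
    Real.exp (2 * (c + 1)) * 16 / (ε ^ 2 * c / 64) ^ 2 * δ ^ 2 * (1 + u ^ 2)⁻¹ := by
  have hr2 := normSq_line (u := u) hs
  set r := ‖(s + u * Complex.I : ℂ)‖ with hr
  set S2 := ∑ j, x j ^ 2 with hS2
  have hvar' := abs_le.1 hvar
  set t := ε / (2 * δ) with ht
  have ht1 : 1 ≤ t := by rw [ht, le_div_iff₀ (by positivity)]; linarith
  have ht2 : t * δ = ε / 2 := by rw [ht]; field_simp
  have hut : t ^ 2 ≤ u ^ 2 := by
    have h1 : 2 * t ≤ r := by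
      have : 2 * t * δ < r * δ := by nlinarith
      exact (lt_of_mul_lt_mul_right this hδ.le).le
    nlinarith
  have hv : 1 ≤ (u / t) ^ 2 := by
    rw [div_pow, one_le_div (by positivity)]; exact hut
  have h := norm_chiSqLaplace_le x (fun j => (hx j).trans hδC) (s := s) (u := u) (v := u / t)
    (t := t) hs (by field_simp) (fun j => by
      have h1 : x j ^ 2 ≤ (C₀ * δ) ^ 2 := by rw [← sq_abs]; gcongr; exact hx j
      calc t ^ 2 * x j ^ 2 ≤ t ^ 2 * (C₀ * δ) ^ 2 := by gcongr
        _ = (ε * C₀ / 2) ^ 2 := by rw [show t ^ 2 * (C₀ * δ) ^ 2 = (t * δ * C₀) ^ 2 by ring, ht2]; ring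
        _ ≤ 1 := by
          have : 0 ≤ ε * C₀ := by positivity
          nlinarith)
  rw [← hS2] at h
  set A := ε ^ 2 * c / 64 with hA
  have hA0 : 0 < A := by positivity
  set N := A / δ ^ 2 with hN
  have hN1 : 1 ≤ N := by
    rw [hN, one_le_div (by positivity)]
    nlinarith
  have hexpo : N ≤ 1 / 4 * (t ^ 2 * S2) := by
    have h1 : c / 4 ≤ S2 := by linarith
    calc N = 1 / 4 * (t ^ 2 * (c / 4)) := by rw [hN, hA, ht]; field_simp; norm_num
      _ ≤ _ := by gcongr
  have hdecay : (1 + (u / t) ^ 2) ^ (-(1 / 4) * (t ^ 2 * S2)) ≤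
      16 / A ^ 2 * δ ^ 2 * (1 + u ^ 2)⁻¹ := by
    calc _ ≤ (1 + (u / t) ^ 2) ^ (-N) :=
          Real.rpow_le_rpow_of_exponent_le (by linarith) (by linarith)
      _ ≤ (t ^ 2 * (1 + u ^ 2)⁻¹) * (16 / N ^ 2) := rpow_neg_le_of_one_le hN1 ht1 hut
      _ = (ε ^ 2 / 4) * (16 / A ^ 2 * δ ^ 2 * (1 + u ^ 2)⁻¹) := by
          rw [hN, ht]; field_simp; norm_num
      _ ≤ 1 * (16 / A ^ 2 * δ ^ 2 * (1 + u ^ 2)⁻¹) := by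
          gcongr
          have : ε ^ 2 ≤ 1 := pow_le_one₀ hε.le hε1
          linarith
      _ = _ := one_mul _
  refine h.trans ?_
  have hS : S2 ≤ c + 1 := by linarith
  calc _ ≤ Real.exp (2 * (c + 1)) * (16 / A ^ 2 * δ ^ 2 * (1 + u ^ 2)⁻¹) := by gcongr
    _ = _ := by ring

/-- The Edgeworth expansion on the level of Laplace transforms, with an integrable bound. -/
theorem exists_norm_chiSqLaplace_sub_edgeworthLaplace_le {c C₀ : ℝ} (hc : 0 < c) (hC₀ : 0 < C₀) :
    ∃ δ₀ > 0, ∃ K > 0, ∀ (ι : Type) [Fintype ι] (x : ι → ℝ) (δ : ℝ), 0 < δ → δ ≤ δ₀ →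
      (∀ j, |x j| ≤ C₀ * δ) → |2 * ∑ j, x j ^ 2 - c| ≤ δ → ∀ s u : ℝ, |s| = 1 →
      ‖chiSqLaplace x (s + u * Complex.I) -
        edgeworthLaplace c (2 * ∑ j, x j ^ 2) (8 * ∑ j, x j ^ 3) (s + u * Complex.I)‖ ≤
      K * δ ^ 2 * (Real.exp (-(c / 4) * u ^ 2) + (1 + u ^ 2)⁻¹) := by
  set A₁ := 1 / 2 + 4 / 3 * C₀ * (c + 1) with hA₁
  set A₂ := 4 * C₀ ^ 2 * (c + 1) with hA₂
  have hA₁0 : 0 < A₁ := by positivity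
  have hA₂0 : 0 < A₂ := by positivity
  -- The zones are separated at `δ‖w‖ = ε`. The bound `1/(4C₀)` keeps every `w x j` of the inner
  -- zone within range of the Taylor expansion; the bound `c/(8(A₁ + A₂))` keeps the correction
  -- below `(c/8)‖w‖²`.
  set ε := min 1 (min (1 / (4 * C₀)) (c / (8 * (A₁ + A₂)))) with hε
  have hε0 : 0 < ε := by positivity
  have hε1 : ε ≤ 1 := min_le_left _ _
  have hεC : ε * C₀ ≤ 1 / 4 := by
    have : ε ≤ 1 / (4 * C₀) := (min_le_right _ _).trans (min_le_left _ _)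
    rw [le_div_iff₀ (by positivity)] at this
    linarith
  have hεA : (A₁ + A₂) * ε ≤ c / 8 := by
    have : ε ≤ c / (8 * (A₁ + A₂)) := (min_le_right _ _).trans (min_le_right _ _)
    rw [le_div_iff₀ (by positivity)] at this
    linarith
  set K₁ := ((A₁ + A₂) ^ 2 + A₂) * (3072 / c ^ 3) * Real.exp (3 / 4 * c) with hK₁
  set K₂ := (1 + A₁) * (3072 / c ^ 3) / ε ^ 2 * Real.exp (3 / 4 * c) with hK₂
  set K₃ := Real.exp (2 * (c + 1)) * 16 / (ε ^ 2 * c / 64) ^ 2 with hK₃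
  refine ⟨min (min 1 (c / 2)) (min (min (ε / 2) (1 / (8 * C₀))) (ε ^ 2 * c / 64)), by positivity,
    K₁ + K₂ + K₃, by positivity, ?_⟩
  intro ι _ x δ hδ hδ₀ hx hvar s u hs
  simp only [le_min_iff] at hδ₀
  obtain ⟨⟨hδ1, hδc⟩, ⟨hδε, hδC⟩, hδN⟩ := hδ₀
  rw [le_div_iff₀ (by positivity)] at hδC
  have hK₁0 : 0 < K₁ := by positivity
  have hK₂0 : 0 < K₂ := by positivity
  have hK₃0 : 0 < K₃ := by positivity
  have he := Real.exp_pos (-(c / 4) * u ^ 2)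
  have hi : 0 < (1 + u ^ 2)⁻¹ := by positivity
  set e := Real.exp (-(c / 4) * u ^ 2)
  set i := (1 + u ^ 2)⁻¹
  rcases le_or_gt (δ * ‖(s + u * Complex.I : ℂ)‖) ε with hw | hw
  · refine (norm_chiSqLaplace_sub_le_of_small x hc hC₀ hδ hδ1 hx hvar hε1 hεC hA₁ hA₂ hεA hs
      hw).trans ?_
    rw [← hK₁]
    have : 0 ≤ K₁ * δ ^ 2 * i + (K₂ + K₃) * δ ^ 2 * (e + i) := by positivity
    linear_combination this
  · refine (norm_sub_le _ _).trans ((add_le_add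
      (norm_chiSqLaplace_le_of_large x hc hC₀ hδ hδ1 hx hvar hε0 hε1 hεC (by linarith) hδc hδε hδN
        hs hw)
      (norm_edgeworthLaplace_le_of_large x hc hC₀ hδ hδ1 hx hvar hε0 hA₁ hs hw)).trans ?_)
    rw [← hK₂, ← hK₃]
    have : 0 ≤ K₁ * δ ^ 2 * (e + i) + K₂ * δ ^ 2 * i + K₃ * δ ^ 2 * e := by positivity
    linear_combination this

end

end HYExpansion

/-! ### Gaussian density, Hermite polynomials and the Edgeworth density. -/

namespace HYExpansion

noncomputable section

lemma exists_one_add_rpow_le_mul_exp {γ κ : ℝ} (hγ : 0 < γ) (hκ : 0 < κ) :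
    ∃ K > 0, ∀ y : ℝ, 0 ≤ y → 1 + y ^ γ ≤ K * Real.exp (κ * y) := by
  refine ⟨1 + (γ / κ) ^ γ, by positivity, fun y hy => ?_⟩
  have h1 : y ≤ γ / κ * Real.exp (κ * y / γ) := by
    have := Real.add_one_le_exp (κ * y / γ)
    calc y = γ / κ * (κ * y / γ) := by field_simp
      _ ≤ _ := by gcongr; linarith
  have h2 : y ^ γ ≤ (γ / κ) ^ γ * Real.exp (κ * y) := by
    calc y ^ γ ≤ (γ / κ * Real.exp (κ * y / γ)) ^ γ := by gcongr
      _ = _ := by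
        rw [Real.mul_rpow (by positivity) (Real.exp_pos _).le, ← Real.exp_mul]
        congr 2; field_simp
  have h3 : 1 ≤ Real.exp (κ * y) := Real.one_le_exp (by positivity)
  linarith

section GaussianDensity

variable {c : ℝ}

lemma phi_nonneg (c z : ℝ) : 0 ≤ phi c z := gaussianPDFReal_nonneg _ _ _

lemma measurable_phi (c : ℝ) : Measurable (phi c) := measurable_gaussianPDFReal _ _

lemma phi_pos (hc : 0 < c) (z : ℝ) : 0 < phi c z :=
  gaussianPDFReal_pos _ _ _ (by simpa using hc)

lemma hasDerivAt_phi (hc : 0 < c) (z : ℝ) : HasDerivAt (phi c) (-(z / c) * phi c z) z := by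
  have e : ∀ z, phi c z = (√(2 * Real.pi * c))⁻¹ * Real.exp (-z ^ 2 / (2 * c)) := fun z => by
    simp [phi, gaussianPDFReal, hc.le]
  rw [e z, show phi c = _ from funext e]
  have h1 : HasDerivAt (fun z : ℝ => -z ^ 2 / (2 * c)) (-(z / c)) z := by
    have := ((hasDerivAt_pow 2 z).neg).div_const (2 * c)
    convert! this using 1
    simp; field_simp
  convert! (h1.exp.const_mul ((√(2 * Real.pi * c))⁻¹)) using 1
  ring

lemma hasDerivAt_hermite_one_mul_phi (hc : 0 < c) (z : ℝ) :
    HasDerivAt (fun z => z / c * phi c z) (-((z ^ 2 - c) / c ^ 2) * phi c z) z := by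
  convert! ((hasDerivAt_id z).div_const c).mul (hasDerivAt_phi hc z) using 1
  simp only [id]; field_simp; ring

lemma hasDerivAt_hermite_two_mul_phi (hc : 0 < c) (z : ℝ) :
    HasDerivAt (fun z => (z ^ 2 - c) / c ^ 2 * phi c z)
      (-((z ^ 3 - 3 * c * z) / c ^ 3) * phi c z) z := by
  convert! ((((hasDerivAt_pow 2 z).sub_const c).div_const (c ^ 2))).mul (hasDerivAt_phi hc z) using 1
  simp; field_simp; ring

lemma hermite_three (hc : 0 < c) (z : ℝ) : hermite 3 c z = (z ^ 3 - 3 * c * z) / c ^ 3 := by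
  have d1 : deriv (phi c) = fun z => -(z / c * phi c z) := by
    ext z; rw [(hasDerivAt_phi hc z).deriv]; ring
  have d2 : deriv (fun z => -(z / c * phi c z)) = fun z => (z ^ 2 - c) / c ^ 2 * phi c z := by
    ext z; rw [(hasDerivAt_hermite_one_mul_phi hc z).fun_neg.deriv]; ring
  have h : iteratedDeriv 3 (phi c) z = -((z ^ 3 - 3 * c * z) / c ^ 3) * phi c z := by
    rw [iteratedDeriv_succ, iteratedDeriv_succ, iteratedDeriv_one, d1, d2,
      (hasDerivAt_hermite_two_mul_phi hc z).deriv]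
  have := (phi_pos hc z).ne'
  rw [hermite, h]
  field_simp

lemma integrable_exp_mul_phi (hc : 0 < c) (t : ℝ) :
    Integrable (fun z => Real.exp (t * z) * phi c z) := by
  have h := integrable_exp_mul_gaussianReal (μ := 0) (v := c.toNNReal) t
  have hv : c.toNNReal ≠ 0 := by simpa using hc
  rw [gaussianReal_of_var_ne_zero _ hv, integrable_withDensity_iff_integrable_smul₀'
    (measurable_gaussianPDF _ _).aemeasurable (.of_forall fun _ => gaussianPDF_lt_top)] at h
  refine h.congr (.of_forall fun z => ?_)
  simp only [toReal_gaussianPDF, smul_eq_mul, phi]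
  ring

lemma integral_cexp_mul_phi (hc : 0 < c) (w : ℂ) :
    ∫ z : ℝ, Complex.exp (w * z) * phi c z = Complex.exp (c * w ^ 2 / 2) := by
  have h := complexMGF_id_gaussianReal (μ := 0) (v := c.toNNReal) w
  have hv : c.toNNReal ≠ 0 := by simpa using hc
  rw [complexMGF, integral_gaussianReal_eq_integral_smul hv] at h
  simp only [id, Complex.ofReal_zero, mul_zero, zero_add, Complex.real_smul] at h
  have hcc : ((c.toNNReal : ℝ) : ℂ) = c := by rw [Real.coe_toNNReal _ hc.le]
  rw [hcc] at h
  rw [← h]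
  congr 1
  ext z
  rw [phi]; ring

lemma exp_abs_le (t z : ℝ) : Real.exp (t * |z|) ≤ Real.exp (t * z) + Real.exp (-t * z) := by
  rcases abs_cases z with ⟨h, _⟩ | ⟨h, _⟩ <;> rw [h]
  · linarith [Real.exp_pos (-t * z)]
  · rw [mul_neg, ← neg_mul]; linarith [Real.exp_pos (t * z)]

lemma integrable_mul_phi (hc : 0 < c) {E : Type*} [NormedAddCommGroup E] [NormedSpace ℝ E]
    {g : ℝ → E}
    (hg : AEStronglyMeasurable g) {K t : ℝ} (hb : ∀ z, ‖g z‖ ≤ K * Real.exp (t * |z|)) :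
    Integrable (fun z => phi c z • g z) := by
  have hK : 0 ≤ K := by
    have := (norm_nonneg _).trans (hb 0)
    simpa using this
  refine (((integrable_exp_mul_phi hc t).add (integrable_exp_mul_phi hc (-t))).const_mul K).mono'
    ((measurable_phi c).aestronglyMeasurable.smul hg) (.of_forall fun z => ?_)
  have h0 := phi_nonneg c z
  rw [norm_smul, Real.norm_of_nonneg h0, Pi.add_apply, ← add_mul, ← mul_assoc, mul_comm]
  gcongr
  refine (hb z).trans ?_
  gcongr
  exact exp_abs_le t z

lemma exists_abs_pow_le_mul_exp (n : ℕ) : ∃ K : ℝ, ∀ z : ℝ, |z| ^ n ≤ K * Real.exp (1 * |z|) := by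
  refine ⟨n.factorial, fun z => ?_⟩
  have := Real.pow_div_factorial_le_exp |z| (abs_nonneg z) n
  rw [div_le_iff₀ (by positivity)] at this
  rw [one_mul]; linarith

lemma integrable_cexp_mul_pow_mul_phi (hc : 0 < c) (w : ℂ) (n : ℕ) :
    Integrable (fun z : ℝ => Complex.exp (w * z) * ((z ^ n * phi c z : ℝ) : ℂ)) := by
  obtain ⟨K, hK⟩ := exists_abs_pow_le_mul_exp n
  have h := integrable_mul_phi hc (g := fun z : ℝ => Complex.exp (w * z) * (z : ℂ) ^ n)
    (K := K) (t := ‖w‖ + 1)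
    (by fun_prop) (fun z => by
      rw [norm_mul, norm_pow, Complex.norm_real, Real.norm_eq_abs, Complex.norm_exp, add_mul,
        Real.exp_add, mul_left_comm]
      have : (w * z).re ≤ ‖w‖ * |z| := by
        refine (Complex.re_le_norm _).trans ?_
        rw [norm_mul, Complex.norm_real, Real.norm_eq_abs]
      have h1 := hK z
      gcongr)
  refine h.congr (.of_forall fun z => ?_)
  simp only [Complex.real_smul]; push_cast; ring

/-- Integration by parts against an exponential. -/
lemma integral_cexp_mul_deriv {F F' : ℝ → ℝ} (w : ℂ) (hF : ∀ z, HasDerivAt F (F' z) z)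
    (h1 : Integrable (fun z : ℝ => Complex.exp (w * z) * F z))
    (h2 : Integrable (fun z : ℝ => Complex.exp (w * z) * F' z)) :
    ∫ z : ℝ, Complex.exp (w * z) * F' z = -w * ∫ z : ℝ, Complex.exp (w * z) * F z := by
  have hu : ∀ z : ℝ, HasDerivAt (fun z : ℝ => Complex.exp (w * z)) (w * Complex.exp (w * z)) z := by
    intro z
    have h : HasDerivAt (fun z : ℝ => w * z) (w * 1) z :=
      (Complex.ofRealCLM.hasDerivAt (x := z)).const_mul w
    convert! h.cexp using 1
    ring
  have := integral_mul_deriv_eq_deriv_mul_of_integrable (u := fun z : ℝ => Complex.exp (w * z))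
    (v := fun z => (F z : ℂ)) (u' := fun z : ℝ => w * Complex.exp (w * z)) (v' := fun z => (F' z : ℂ))
    (fun z _ => hu z) (fun z _ => (hF z).ofReal_comp) h2
    (by simpa [mul_assoc, Pi.mul_def] using h1.const_mul w) h1
  rw [this, ← integral_const_mul, ← integral_neg]
  congr 1; ext z; ring

lemma integrable_cexp_mul_hermite_one (hc : 0 < c) (w : ℂ) :
    Integrable (fun z : ℝ => Complex.exp (w * z) * ((z / c * phi c z : ℝ) : ℂ)) := by
  refine ((integrable_cexp_mul_pow_mul_phi hc w 1).div_const c).congr (.of_forall fun z => ?_)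
  push_cast; ring

lemma integrable_cexp_mul_hermite_two (hc : 0 < c) (w : ℂ) :
    Integrable (fun z : ℝ => Complex.exp (w * z) * (((z ^ 2 - c) / c ^ 2 * phi c z : ℝ) : ℂ)) := by
  refine (((integrable_cexp_mul_pow_mul_phi hc w 2).sub
    ((integrable_cexp_mul_pow_mul_phi hc w 0).const_mul c)).div_const (c ^ 2)).congr
    (.of_forall fun z => ?_)
  simp only [Pi.sub_apply]
  push_cast; ring

lemma integrable_cexp_mul_hermite_three (hc : 0 < c) (w : ℂ) :
    Integrable (fun z : ℝ => Complex.exp (w * z) *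
      (((z ^ 3 - 3 * c * z) / c ^ 3 * phi c z : ℝ) : ℂ)) := by
  refine (((integrable_cexp_mul_pow_mul_phi hc w 3).sub
    ((integrable_cexp_mul_pow_mul_phi hc w 1).const_mul (3 * c))).div_const (c ^ 3)).congr
    (.of_forall fun z => ?_)
  simp only [Pi.sub_apply]
  push_cast; ring

/-- The products `h_r φ` are, up to sign, the successive derivatives of `φ`, so each integration by
parts against `exp(wz)` contributes one factor `w`. -/
lemma integral_cexp_mul_hermite_two (hc : 0 < c) (w : ℂ) :
    ∫ z : ℝ, Complex.exp (w * z) * (((z ^ 2 - c) / c ^ 2 * phi c z : ℝ) : ℂ) =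
      w ^ 2 * Complex.exp (c * w ^ 2 / 2) := by
  have i0 := integrable_cexp_mul_pow_mul_phi hc w 0
  simp only [pow_zero, one_mul] at i0
  have s1 := integral_cexp_mul_deriv w (hasDerivAt_phi hc) i0
    ((integrable_cexp_mul_hermite_one hc w).neg.congr (.of_forall fun z => by
      simp only [Pi.neg_apply]; push_cast; ring))
  have s2 := integral_cexp_mul_deriv w (hasDerivAt_hermite_one_mul_phi hc)
    (integrable_cexp_mul_hermite_one hc w)
    ((integrable_cexp_mul_hermite_two hc w).neg.congr (.of_forall fun z => by
      simp only [Pi.neg_apply]; push_cast; ring))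
  rw [integral_cexp_mul_phi hc] at s1
  have e1 : ∫ z : ℝ, Complex.exp (w * z) * ((z / c * phi c z : ℝ) : ℂ) =
      w * Complex.exp (c * w ^ 2 / 2) := by
    rw [← neg_inj, ← neg_mul, ← s1, ← integral_neg]
    congr 1; ext z; push_cast; ring
  rw [e1] at s2
  rw [← neg_inj, ← integral_neg]
  refine Eq.trans ?_ (s2.trans (by ring))
  congr 1; ext z; push_cast; ring

lemma integral_cexp_mul_hermite_three (hc : 0 < c) (w : ℂ) :
    ∫ z : ℝ, Complex.exp (w * z) * (((z ^ 3 - 3 * c * z) / c ^ 3 * phi c z : ℝ) : ℂ) =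
      w ^ 3 * Complex.exp (c * w ^ 2 / 2) := by
  have s3 := integral_cexp_mul_deriv w (hasDerivAt_hermite_two_mul_phi hc)
    (integrable_cexp_mul_hermite_two hc w)
    ((integrable_cexp_mul_hermite_three hc w).neg.congr (.of_forall fun z => by
      simp only [Pi.neg_apply]; push_cast; ring))
  rw [integral_cexp_mul_hermite_two hc] at s3
  rw [← neg_inj, ← integral_neg]
  refine Eq.trans ?_ (s3.trans (by ring))
  congr 1; ext z; push_cast; ring

/-- The first order Edgeworth density with variance `l` expanded around `c`, and third
cumulant `k`. -/
def edgeworthDensity (c l k z : ℝ) : ℝ :=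
  phi c z * (1 + (l - c) / 2 * ((z ^ 2 - c) / c ^ 2) + k / 6 * ((z ^ 3 - 3 * c * z) / c ^ 3))

lemma edgeworthDensity_eq (c l k z : ℝ) : edgeworthDensity c l k z =
    phi c z + (l - c) / 2 * ((z ^ 2 - c) / c ^ 2 * phi c z) +
      k / 6 * ((z ^ 3 - 3 * c * z) / c ^ 3 * phi c z) := by
  rw [edgeworthDensity]; ring

lemma integral_cexp_mul_edgeworthDensity (hc : 0 < c) (l k : ℝ) (w : ℂ) :
    ∫ z : ℝ, Complex.exp (w * z) * edgeworthDensity c l k z = edgeworthLaplace c l k w := by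
  have i0 := integrable_cexp_mul_pow_mul_phi hc w 0
  simp only [pow_zero, one_mul] at i0
  have i2 := (integrable_cexp_mul_hermite_two hc w).const_mul ((l - c : ℝ) / 2 : ℂ)
  have i3 := (integrable_cexp_mul_hermite_three hc w).const_mul (k / 6 : ℂ)
  rw [edgeworthLaplace, mul_add, mul_add, mul_one]
  calc _ = ∫ z : ℝ, (Complex.exp (w * z) * phi c z + ((l - c : ℝ) / 2 : ℂ) *
          (Complex.exp (w * z) * (((z ^ 2 - c) / c ^ 2 * phi c z : ℝ) : ℂ)) + (k / 6 : ℂ) *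
          (Complex.exp (w * z) * (((z ^ 3 - 3 * c * z) / c ^ 3 * phi c z : ℝ) : ℂ))) := by
        congr 1; ext z; rw [edgeworthDensity_eq]; push_cast; ring
    _ = _ := by
        rw [integral_add (by exact i0.add i2) i3, integral_add i0 i2, integral_const_mul, integral_const_mul,
          integral_cexp_mul_phi hc, integral_cexp_mul_hermite_two hc,
          integral_cexp_mul_hermite_three hc]
        ring

lemma exists_abs_edgeworth_factor_le (c l k : ℝ) : ∃ K, ∀ z : ℝ,
    |1 + (l - c) / 2 * ((z ^ 2 - c) / c ^ 2) + k / 6 * ((z ^ 3 - 3 * c * z) / c ^ 3)| ≤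
      K * Real.exp (1 * |z|) := by
  obtain ⟨K0, h0⟩ := exists_abs_pow_le_mul_exp 0
  obtain ⟨K1, h1⟩ := exists_abs_pow_le_mul_exp 1
  obtain ⟨K2, h2⟩ := exists_abs_pow_le_mul_exp 2
  obtain ⟨K3, h3⟩ := exists_abs_pow_le_mul_exp 3
  refine ⟨|1 - (l - c) / 2 * (c / c ^ 2)| * K0 + |k / 6 * (3 * c / c ^ 3)| * K1 +
    |(l - c) / 2 / c ^ 2| * K2 + |k / 6 / c ^ 3| * K3, fun z => ?_⟩
  have e : 1 + (l - c) / 2 * ((z ^ 2 - c) / c ^ 2) + k / 6 * ((z ^ 3 - 3 * c * z) / c ^ 3) =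
    (1 - (l - c) / 2 * (c / c ^ 2)) * z ^ 0 + (-(k / 6 * (3 * c / c ^ 3))) * z ^ 1 +
    ((l - c) / 2 / c ^ 2) * z ^ 2 + (k / 6 / c ^ 3) * z ^ 3 := by ring
  rw [e]
  have t : ∀ (a K : ℝ) (n : ℕ), |z| ^ n ≤ K * Real.exp (1 * |z|) →
      |a * z ^ n| ≤ |a| * K * Real.exp (1 * |z|) := fun a K n h => by
    rw [abs_mul, abs_pow, mul_assoc]; gcongr
  have t0 := t (1 - (l - c) / 2 * (c / c ^ 2)) K0 0 (h0 z)
  have t1 := t (-(k / 6 * (3 * c / c ^ 3))) K1 1 (h1 z)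
  have t2 := t ((l - c) / 2 / c ^ 2) K2 2 (h2 z)
  have t3 := t (k / 6 / c ^ 3) K3 3 (h3 z)
  rw [abs_neg] at t1
  refine (abs_add_le _ _).trans ?_
  have := (abs_add_le ((1 - (l - c) / 2 * (c / c ^ 2)) * z ^ 0 + -(k / 6 * (3 * c / c ^ 3)) * z ^ 1)
    ((l - c) / 2 / c ^ 2 * z ^ 2))
  have := abs_add_le ((1 - (l - c) / 2 * (c / c ^ 2)) * z ^ 0) (-(k / 6 * (3 * c / c ^ 3)) * z ^ 1)
  nlinarith

lemma integrable_mul_edgeworthDensity (hc : 0 < c) (l k : ℝ) {f : ℝ → ℝ} (hf : Measurable f)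
    {K t : ℝ} (hb : ∀ z, |f z| ≤ K * Real.exp (t * |z|)) :
    Integrable (fun z => f z * edgeworthDensity c l k z) := by
  obtain ⟨K', hK'⟩ := exists_abs_edgeworth_factor_le c l k
  have := integrable_mul_phi hc (K := K * K') (t := t + 1) (g := fun z => f z * (1 + (l - c) / 2 *
    ((z ^ 2 - c) / c ^ 2) + k / 6 * ((z ^ 3 - 3 * c * z) / c ^ 3)))
    (by exact (hf.mul (by fun_prop)).aestronglyMeasurable) (fun z => by
      rw [Real.norm_eq_abs, abs_mul, add_mul, Real.exp_add, mul_mul_mul_comm]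
      exact mul_le_mul (hb z) (hK' z) (abs_nonneg _) ((abs_nonneg _).trans (hb z)))
  refine this.congr (.of_forall fun z => ?_)
  simp only [edgeworthDensity, smul_eq_mul]
  ring

end GaussianDensity

end

end HYExpansion

/-! ### Expansion of expectations under the weighted chi-square law. -/

namespace HYExpansion

noncomputable section

lemma integrable_exp_sq_sub_one {r : ℝ} (hr : r < 1 / 2) :
    Integrable (fun z : ℝ => Real.exp (r * (z ^ 2 - 1))) (gaussianReal 0 1) := by
  rw [gaussianReal_of_var_ne_zero _ one_ne_zero, integrable_withDensity_iff_integrable_smul₀'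
    (measurable_gaussianPDF _ _).aemeasurable (.of_forall fun _ => gaussianPDF_lt_top)]
  refine ((integrable_exp_neg_mul_sq (b := 1 / 2 - r) (by linarith)).const_mul
    ((√(2 * Real.pi))⁻¹ * Real.exp (-r))).congr (.of_forall fun z => ?_)
  simp only [toReal_gaussianPDF, smul_eq_mul, gaussianPDFReal, NNReal.coe_one, mul_one, sub_zero]
  rw [mul_assoc, mul_assoc, ← Real.exp_add, ← Real.exp_add]
  ring_nf

lemma integral_cexp_sq_sub_one {y : ℂ} (hy : y.re < 1 / 2) :
    ∫ z : ℝ, Complex.exp (y * (z ^ 2 - 1)) ∂gaussianReal 0 1 = Complex.exp (chiSqExponent y) := by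
  have hre : 0 < (1 - 2 * y).re := by simp; linarith
  have h0 : 1 - 2 * y ≠ 0 := by intro h; rw [h] at hre; simp at hre
  have hb : 0 < (1 / 2 - y).re := by simp; linarith
  have hpi : (0 : ℝ) < 2 * Real.pi := by positivity
  rw [integral_gaussianReal_eq_integral_smul one_ne_zero]
  have e : ∀ z : ℝ, gaussianPDFReal 0 1 z • Complex.exp (y * (z ^ 2 - 1)) =
      ((√(2 * Real.pi))⁻¹ : ℝ) * Complex.exp (-y) * Complex.exp (-(1 / 2 - y) * z ^ 2) := by
    intro z
    simp only [gaussianPDFReal, NNReal.coe_one, mul_one, sub_zero, Complex.real_smul]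
    rw [Complex.ofReal_mul, Complex.ofReal_exp, mul_assoc, mul_assoc, ← Complex.exp_add,
      ← Complex.exp_add]
    push_cast
    ring_nf
  simp_rw [e]
  rw [integral_const_mul, integral_gaussian_complex hb]
  have e2 : (Real.pi : ℂ) / (1 / 2 - y) = (2 * Real.pi : ℝ) * (1 - 2 * y)⁻¹ := by
    have : (1 / 2 - y) = (1 - 2 * y) / 2 := by ring
    rw [this]; push_cast; field_simp
  -- `1 - 2y` lies in the right half-plane, away from the branch cut, so `log` of its inverse is
  -- minus its `log`; this identifies the square root in the Gaussian integral with the principal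
  -- branch of `chiSqExponent`.
  have harg : (1 - 2 * y).arg ≠ Real.pi := by
    intro h
    rw [Complex.arg_eq_pi_iff] at h
    linarith [h.1]
  rw [e2, Complex.cpow_def_of_ne_zero (mul_ne_zero (by exact_mod_cast hpi.ne') (inv_ne_zero h0)),
    Complex.log_ofReal_mul hpi (inv_ne_zero h0), Complex.log_inv _ harg, chiSqExponent]
  have e3 : (((√(2 * Real.pi))⁻¹ : ℝ) : ℂ) = Complex.exp (-(Real.log (2 * Real.pi) / 2 : ℝ)) := by
    rw [← Complex.ofReal_neg, ← Complex.ofReal_exp, Real.exp_neg, Real.sqrt_eq_rpow,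
      Real.rpow_def_of_pos hpi]
    congr 3
    ring_nf
  rw [e3, ← Complex.exp_add, ← Complex.exp_add]
  congr 1
  push_cast
  ring

variable {ι : Type*} [Fintype ι]

/-- The law of `∑ xⱼ (Zⱼ² - 1)` for independent standard normal variables `Zⱼ`. -/
def chiSqLaw (x : ι → ℝ) : Measure ℝ :=
  (Measure.pi fun _ : ι => gaussianReal 0 1).map fun g => ∑ j, x j * (g j ^ 2 - 1)

lemma measurable_chiSqSum (x : ι → ℝ) :
    Measurable fun g : ι → ℝ => ∑ j, x j * (g j ^ 2 - 1) := by fun_prop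

instance (x : ι → ℝ) : IsProbabilityMeasure (chiSqLaw x) :=
  Measure.isProbabilityMeasure_map (measurable_chiSqSum x).aemeasurable

lemma integrable_exp_chiSqLaw (x : ι → ℝ) {t : ℝ} (ht : ∀ j, t * x j < 1 / 2) :
    Integrable (fun z => Real.exp (t * z)) (chiSqLaw x) := by
  rw [chiSqLaw, integrable_map_measure (by fun_prop) (measurable_chiSqSum x).aemeasurable]
  have e : (fun z => Real.exp (t * z)) ∘ (fun g : ι → ℝ => ∑ j, x j * (g j ^ 2 - 1)) =
      fun g => ∏ j, Real.exp (t * x j * (g j ^ 2 - 1)) := by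
    ext g
    rw [Function.comp_apply, Finset.mul_sum, Real.exp_sum]
    simp_rw [mul_assoc]
  rw [e]
  exact Integrable.fintype_prod fun j => integrable_exp_sq_sub_one (ht j)

lemma integral_cexp_chiSqLaw (x : ι → ℝ) {w : ℂ} (hw : ∀ j, (w * x j).re < 1 / 2) :
    ∫ z : ℝ, Complex.exp (w * z) ∂chiSqLaw x = chiSqLaplace x w := by
  rw [chiSqLaw, integral_map (measurable_chiSqSum x).aemeasurable (by fun_prop), chiSqLaplace,
    Complex.exp_sum]
  have e : ∀ g : ι → ℝ, Complex.exp (w * ((∑ j, x j * (g j ^ 2 - 1) : ℝ) : ℂ)) =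
      ∏ j, Complex.exp (w * x j * ((g j : ℂ) ^ 2 - 1)) := by
    intro g
    rw [← Complex.exp_sum]
    push_cast
    rw [Finset.mul_sum]
    simp_rw [mul_assoc]
  simp_rw [e]
  rw [integral_fintype_prod_eq_prod (fun j (z : ℝ) => Complex.exp (w * x j * ((z : ℂ) ^ 2 - 1)))]
  exact Finset.prod_congr rfl fun j _ => integral_cexp_sq_sub_one (hw j)

lemma integral_exp_chiSqLaw_le (x : ι → ℝ) {t : ℝ} (ht : ∀ j, |t * x j| ≤ 1 / 4) :
    ∫ z, Real.exp (t * z) ∂chiSqLaw x ≤ Real.exp (2 * t ^ 2 * ∑ j, x j ^ 2) := by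
  have h := integral_cexp_chiSqLaw x (w := (t : ℂ)) (fun j => by
    rw [← Complex.ofReal_mul, Complex.ofReal_re]
    have := (le_abs_self _).trans (ht j)
    linarith)
  have e : ∀ z : ℝ, Complex.exp (t * z) = ((Real.exp (t * z) : ℝ) : ℂ) := fun z => by push_cast; rfl
  simp_rw [e] at h
  rw [integral_complex_ofReal] at h
  calc ∫ z, Real.exp (t * z) ∂chiSqLaw x ≤ ‖((∫ z, Real.exp (t * z) ∂chiSqLaw x : ℝ) : ℂ)‖ := by
        rw [Complex.norm_real]; exact le_abs_self _
    _ = Real.exp (∑ j, (chiSqExponent (t * x j))).re := by rw [h, chiSqLaplace, Complex.norm_exp]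
    _ ≤ _ := by
        rw [Complex.re_sum, Finset.mul_sum]
        refine Real.exp_le_exp.2 (Finset.sum_le_sum fun j _ => ?_)
        rw [← Complex.ofReal_mul]
        refine (chiSqExponent_ofReal_re_le (ht j)).trans_eq (by ring)

lemma measurable_chiSqLaplace (x : ι → ℝ) : Measurable (chiSqLaplace x) := by
  unfold chiSqLaplace chiSqExponent
  fun_prop

lemma measurable_edgeworthLaplace (c l k : ℝ) : Measurable (edgeworthLaplace c l k) := by
  unfold edgeworthLaplace
  fun_prop

lemma integrable_exp_neg_mul_abs {κ : ℝ} (hκ : 0 < κ) :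
    Integrable fun z : ℝ => Real.exp (-κ * |z|) := by
  rw [← integrableOn_univ, ← Set.Iic_union_Ioi (a := (0 : ℝ))]
  refine IntegrableOn.union ?_ ?_
  · refine (integrableOn_exp_mul_Iic hκ 0).congr_fun (fun z hz => ?_) measurableSet_Iic
    simp only [abs_of_nonpos (Set.mem_Iic.1 hz)]; ring_nf
  · refine (exp_neg_integrableOn_Ioi 0 hκ).congr_fun (fun z hz => ?_) measurableSet_Ioi
    simp only [abs_of_pos (Set.mem_Ioi.1 hz)]

lemma exp_abs_div_two_le_cosh (z : ℝ) : Real.exp |z| / 2 ≤ Real.cosh z := by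
  rw [← Real.cosh_abs, Real.cosh_eq]
  have := Real.exp_pos (-|z|)
  linarith

lemma exists_growthClass_bound {M γ κ : ℝ} (hM : 0 < M) (hγ : 0 < γ) (hκ : 0 < κ) :
    ∃ K > 0, ∀ f ∈ growthClass M γ, ∀ z, |f z| ≤ K * Real.exp (κ * |z|) := by
  obtain ⟨K, hK, h⟩ := exists_one_add_rpow_le_mul_exp hγ hκ
  refine ⟨M * K, by positivity, fun f hf z => (hf.2 z).trans ?_⟩
  rw [mul_assoc]
  have := h |z| (abs_nonneg z)
  gcongr

/-- The conditional Edgeworth expansion for weighted sums of centred squares of independent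
standard normal variables. -/
theorem exists_abs_integral_chiSqLaw_sub_le {c C₀ M γ : ℝ} (hc : 0 < c) (hC₀ : 0 < C₀)
    (hM : 0 < M) (hγ : 0 < γ) :
    ∃ δ₀ > 0, ∃ K > 0, ∀ (ι : Type) [Fintype ι] (x : ι → ℝ) (δ : ℝ), 0 < δ → δ ≤ δ₀ →
      (∀ j, |x j| ≤ C₀ * δ) → |2 * ∑ j, x j ^ 2 - c| ≤ δ → ∀ f ∈ growthClass M γ,
      |∫ z, f z ∂chiSqLaw x -
        ∫ z, f z * edgeworthDensity c (2 * ∑ j, x j ^ 2) (8 * ∑ j, x j ^ 3) z| ≤ K * δ ^ 2 := by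
  obtain ⟨δ₁, hδ₁, K₁, hK₁, h⟩ := exists_norm_chiSqLaplace_sub_edgeworthLaplace_le hc hC₀
  -- Any rate below `1` would do: `f / cosh` then decays exponentially, with a bound uniform in `f`.
  obtain ⟨K₂, hK₂, hg⟩ := exists_growthClass_bound hM hγ (κ := 1 / 2) (by norm_num)
  set B : ℝ → ℝ := fun u => Real.exp (-(c / 4) * u ^ 2) + (1 + u ^ 2)⁻¹ with hB
  have hBi : Integrable B :=
    (integrable_exp_neg_mul_sq (by positivity)).add integrable_inv_one_add_sq
  have hB0 : 0 ≤ ∫ u, B u := integral_nonneg fun u => by simp only [hB]; positivity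
  set G := ∫ z : ℝ, 2 * K₂ * Real.exp (-(1 / 2) * |z|) with hG
  have hGi : Integrable fun z : ℝ => 2 * K₂ * Real.exp (-(1 / 2) * |z|) :=
    (integrable_exp_neg_mul_abs (by norm_num)).const_mul _
  have hG0 : 0 ≤ G := integral_nonneg fun z => by positivity
  -- The bound `1/(8C₀)` gives `|x j| ≤ 1/8`, hence finite exponential moments of order `±1`. The `+
  -- 1` only makes the constant positive.
  refine ⟨min δ₁ (1 / (8 * C₀)), by positivity, (2 * Real.pi)⁻¹ * (K₁ * ∫ u, B u) * G + 1,
    by positivity, ?_⟩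
  intro ι _ x δ hδ hδ₀ hx hvar f hf
  simp only [le_min_iff] at hδ₀
  have hδC := hδ₀.2
  rw [le_div_iff₀ (by positivity)] at hδC
  have hx8 : ∀ j, |x j| ≤ 1 / 8 := fun j => (hx j).trans (by linarith)
  have hsx : ∀ s : ℝ, |s| = 1 → ∀ j, s * x j < 1 / 2 := fun s hs j => by
    have : |s * x j| ≤ 1 / 8 := by rw [abs_mul, hs, one_mul]; exact hx8 j
    linarith [le_abs_self (s * x j)]
  set l := 2 * ∑ j, x j ^ 2
  set k := 8 * ∑ j, x j ^ 3
  have hDeq : ∀ s u : ℝ, |s| = 1 → ∫ z : ℝ, Complex.exp ((s + u * Complex.I) * z) ∂chiSqLaw x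
        - ∫ z : ℝ, Complex.exp ((s + u * Complex.I) * z) * edgeworthDensity c l k z =
      chiSqLaplace x (s + u * Complex.I) - edgeworthLaplace c l k (s + u * Complex.I) := by
    intro s u hs
    rw [integral_cexp_mul_edgeworthDensity hc, integral_cexp_chiSqLaw]
    intro j
    have : ((s + u * Complex.I) * x j : ℂ).re = s * x j := by simp
    rw [this]; exact hsx s hs j
  have hDi : ∀ s : ℝ, |s| = 1 → Integrable fun u : ℝ =>
      chiSqLaplace x (s + u * Complex.I) - edgeworthLaplace c l k (s + u * Complex.I) := by
    intro s hs
    refine (hBi.const_mul (K₁ * δ ^ 2)).mono' ?_ (.of_forall fun u => ?_)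
    · have hline : Measurable fun u : ℝ => (s + u * Complex.I : ℂ) := by fun_prop
      exact (((measurable_chiSqLaplace x).comp hline).sub
        ((measurable_edgeworthLaplace c l k).comp hline)).aestronglyMeasurable
    · exact h ι x δ hδ hδ₀.1 hx hvar s u hs
  have hfb := hg f hf
  have hfcosh : ∀ z, |f z| / Real.cosh z ≤ 2 * K₂ * Real.exp (-(1 / 2) * |z|) := by
    intro z
    have h1 := exp_abs_div_two_le_cosh z
    rw [div_le_iff₀ (Real.cosh_pos z)]
    refine (hfb z).trans ?_
    calc K₂ * Real.exp (1 / 2 * |z|) = 2 * K₂ * Real.exp (-(1 / 2) * |z|) * (Real.exp |z| / 2) := by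
          rw [show (1 / 2 : ℝ) * |z| = -(1 / 2) * |z| + |z| by ring, Real.exp_add]; ring
      _ ≤ _ := by gcongr
  have hfi : Integrable fun z => f z / Real.cosh z := by
    refine hGi.mono' (hf.1.div (by fun_prop)).aestronglyMeasurable (.of_forall fun z => ?_)
    rw [Real.norm_eq_abs, abs_div, abs_of_pos (Real.cosh_pos z)]
    exact hfcosh z
  have hexp : ∀ s : ℝ, |s| = 1 → Integrable (fun z => Real.exp (s * z)) (chiSqLaw x) :=
    fun s hs => integrable_exp_chiSqLaw x (hsx s hs)
  have hfμ : Integrable f (chiSqLaw x) := by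
    refine (((hexp 1 (by simp)).add (hexp (-1) (by simp))).const_mul K₂).mono'
      hf.1.aestronglyMeasurable (.of_forall fun z => (hfb z).trans ?_)
    simp only [Pi.add_apply]
    gcongr
    refine le_trans ?_ (exp_abs_le 1 z)
    gcongr
    norm_num
  have main := abs_integral_sub_integral_mul_le (chiSqLaw x) (q := edgeworthDensity c l k)
    (κ := K₁ * δ ^ 2 * ∫ u, B u) hexp
    (fun s hs => integrable_mul_edgeworthDensity hc l k (by fun_prop) (K := 1) (t := 1) fun z => by
      rw [abs_of_pos (Real.exp_pos _), one_mul, one_mul]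
      refine Real.exp_le_exp.2 ((le_abs_self _).trans_eq ?_)
      rw [abs_mul, hs, one_mul])
    (fun s hs => by simp_rw [hDeq s _ hs]; exact hDi s hs)
    (fun s hs => by
      simp_rw [hDeq s _ hs]
      rw [← integral_const_mul]
      exact integral_mono (hDi s hs).norm (hBi.const_mul _)
        fun u => h ι x δ hδ hδ₀.1 hx hvar s u hs)
    hfi hfμ (integrable_mul_edgeworthDensity hc l k hf.1 hfb)
  refine main.trans ?_
  have hGle : ∫ z, |f z| / Real.cosh z ≤ G :=
    integral_mono_of_nonneg (.of_forall fun z => by have := Real.cosh_pos z; positivity) hGi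
      (.of_forall hfcosh)
  calc (2 * Real.pi)⁻¹ * (K₁ * δ ^ 2 * ∫ u, B u) * ∫ z, |f z| / Real.cosh z
      ≤ (2 * Real.pi)⁻¹ * (K₁ * δ ^ 2 * ∫ u, B u) * G := by gcongr
    _ = (2 * Real.pi)⁻¹ * (K₁ * ∫ u, B u) * G * δ ^ 2 := by ring
    _ ≤ _ := by gcongr; linarith

end

end HYExpansion

/-! ### Quadratic forms of Gaussian vectors. -/

namespace HYExpansion

noncomputable section

section QuadraticForm

open Matrix

variable {ι : Type*} [Fintype ι] [DecidableEq ι]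

/-- Simultaneous diagonalization of a covariance matrix and a quadratic form. -/
lemma exists_factor_diagonal {S A : Matrix ι ι ℝ} (hS : S.PosSemidef) (hA : Aᵀ = A) :
    ∃ (L : Matrix ι ι ℝ) (d : ι → ℝ), L * Lᵀ = S ∧ Lᵀ * A * L = diagonal d := by
  open scoped MatrixOrder ComplexOrder in
  set R := CFC.sqrt S with hR
  have hRR : R * R = S := CFC.sqrt_mul_sqrt_self S hS.nonneg
  have hRt : Rᵀ = R := by
    have := (CFC.sqrt_nonneg S).posSemidef.1
    rwa [Matrix.IsHermitian, conjTranspose_eq_transpose_of_trivial] at this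
  have hM : (R * A * R).IsHermitian := by
    rw [Matrix.IsHermitian, conjTranspose_eq_transpose_of_trivial, transpose_mul, transpose_mul,
      hRt, hA, Matrix.mul_assoc]
  set U : Matrix ι ι ℝ := (hM.eigenvectorUnitary : Matrix ι ι ℝ) with hU
  have hUU : U * Uᵀ = 1 := by
    have := Unitary.coe_mul_star_self hM.eigenvectorUnitary
    rwa [Unitary.coe_star, star_eq_conjTranspose, conjTranspose_eq_transpose_of_trivial] at this
  refine ⟨R * U, hM.eigenvalues, ?_, ?_⟩
  · rw [transpose_mul, hRt, Matrix.mul_assoc, ← Matrix.mul_assoc U, hUU, Matrix.one_mul, hRR]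
  · have h := hM.conjStarAlgAut_star_eigenvectorUnitary
    rw [Unitary.conjStarAlgAut_star_apply, star_eq_conjTranspose,
      conjTranspose_eq_transpose_of_trivial, ← hU] at h
    rw [transpose_mul, hRt]
    simp only [Matrix.mul_assoc] at h ⊢
    exact h

variable {L S A : Matrix ι ι ℝ} {d : ι → ℝ}

/-- Power sums of `d` are traces of powers of `LᵀAL`; by cyclicity of the trace these are traces of
powers of `AS`, which do not involve the diagonalization. -/
lemma sum_diag_eq_trace (hL : L * Lᵀ = S) (hd : Lᵀ * A * L = diagonal d) :
    ∑ j, d j = (A * S).trace := by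
  rw [← trace_diagonal, ← hd, ← hL, Matrix.mul_assoc, trace_mul_comm, Matrix.mul_assoc]

lemma sum_diag_sq_eq_trace (hL : L * Lᵀ = S) (hd : Lᵀ * A * L = diagonal d) :
    ∑ j, d j ^ 2 = (A * S * (A * S)).trace := by
  have h : diagonal (fun j => d j ^ 2) = (Lᵀ * A * L) * (Lᵀ * A * L) := by
    rw [hd, diagonal_mul_diagonal]; simp_rw [sq]
  rw [← trace_diagonal, h, ← hL]
  simp only [Matrix.mul_assoc]
  rw [trace_mul_comm]
  simp only [Matrix.mul_assoc]

lemma sum_diag_cube_eq_trace (hL : L * Lᵀ = S) (hd : Lᵀ * A * L = diagonal d) :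
    ∑ j, d j ^ 3 = (A * S * (A * S) * (A * S)).trace := by
  have h : diagonal (fun j => d j ^ 3) = (Lᵀ * A * L) * (Lᵀ * A * L) * (Lᵀ * A * L) := by
    rw [hd, diagonal_mul_diagonal, diagonal_mul_diagonal]; simp_rw [pow_succ, pow_zero, one_mul]
  rw [← trace_diagonal, h, ← hL]
  simp only [Matrix.mul_assoc]
  rw [trace_mul_comm]
  simp only [Matrix.mul_assoc]

/-- Let `y` be the `k`-th column of `L` and `q = ∑ y a ^ 2 / D a`. Then `d k = yᵀAy`, so `|d k| ≤ R
q`. Testing the bound on `S` with `t = y / D` gives `q² = (Lᵀt)_k² ≤ tᵀSt ≤ 2q`, so `q ≤ 2`. -/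
lemma abs_diag_le (hL : L * Lᵀ = S) (hd : Lᵀ * A * L = diagonal d) {D : ι → ℝ}
    (hD : ∀ a, 0 < D a) {R : ℝ} (hS : ∀ t : ι → ℝ, t ⬝ᵥ (S *ᵥ t) ≤ 2 * ∑ a, D a * t a ^ 2)
    (hA : ∀ y : ι → ℝ, |y ⬝ᵥ (A *ᵥ y)| ≤ R * ∑ a, y a ^ 2 / D a) (hR : 0 ≤ R) (k : ι) :
    |d k| ≤ 2 * R := by
  set y : ι → ℝ := fun a => L a k with hy
  have h1 : d k = y ⬝ᵥ (A *ᵥ y) := by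
    have h := congrFun (congrFun hd k) k
    rw [diagonal_apply_eq] at h
    rw [← h, Matrix.mul_apply, dotProduct_mulVec, dotProduct]
    refine Finset.sum_congr rfl fun a _ => ?_
    rfl
  set q := ∑ a, y a ^ 2 / D a with hq
  have hq0 : 0 ≤ q := Finset.sum_nonneg fun a _ => div_nonneg (sq_nonneg _) (hD a).le
  set t : ι → ℝ := fun a => y a / D a with ht
  have h2 : q ^ 2 ≤ 2 * q := by
    have e1 : (Lᵀ *ᵥ t) k = q := by
      rw [mulVec, dotProduct, hq]
      refine Finset.sum_congr rfl fun a _ => ?_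
      simp only [transpose_apply, ht, hy]; ring
    have e2 : t ⬝ᵥ (S *ᵥ t) = ∑ j, (Lᵀ *ᵥ t) j ^ 2 := by
      rw [← hL, ← mulVec_mulVec, dotProduct_mulVec, ← mulVec_transpose, dotProduct]
      simp_rw [sq]
    have e3 : ∑ a, D a * t a ^ 2 = q := by
      refine Finset.sum_congr rfl fun a _ => ?_
      have := (hD a).ne'
      simp only [ht]; field_simp
    have h := hS t
    rw [e2, e3] at h
    rw [← e1] at h ⊢
    exact (Finset.single_le_sum (f := fun j => (Lᵀ *ᵥ t) j ^ 2) (fun _ _ => sq_nonneg _)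
      (Finset.mem_univ k)).trans h
  have h3 : q ≤ 2 := by nlinarith
  rw [h1]
  refine (hA y).trans ?_
  rw [← hq]
  nlinarith

/-- The centred quadratic form of a centred Gaussian vector is a weighted sum of centred squares
of independent standard normal variables. -/
lemma map_quadraticForm_eq_chiSqLaw {Ω : Type*} [MeasurableSpace Ω] (P : Measure Ω)
    [IsProbabilityMeasure P] {Z : Ω → ι → ℝ} (hZ : Measurable Z)
    (hchar : ∀ t : ι → ℝ, ∫ ω, Complex.exp (((t ⬝ᵥ Z ω : ℝ) : ℂ) * Complex.I) ∂P =
      Complex.exp (-((t ⬝ᵥ (S *ᵥ t) / 2 : ℝ) : ℂ)))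
    (hL : L * Lᵀ = S) (hd : Lᵀ * A * L = diagonal d) :
    P.map (fun ω => Z ω ⬝ᵥ (A *ᵥ Z ω) - (A * S).trace) = chiSqLaw d := by
  set γ := Measure.pi fun _ : ι => gaussianReal 0 1 with hγ
  have hLm : Measurable fun g : ι → ℝ => L *ᵥ g := by
    refine measurable_pi_lambda _ fun a => ?_
    simp only [mulVec, dotProduct]
    fun_prop
  have hlaw : P.map Z = γ.map (fun g => L *ᵥ g) := by
    have hto : Measurable (WithLp.toLp 2 : (ι → ℝ) → EuclideanSpace ℝ ι) := by fun_prop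
    have hof : Measurable (WithLp.ofLp : EuclideanSpace ℝ ι → (ι → ℝ)) := by fun_prop
    -- Characteristic functions determine laws on an inner product space, so both laws are carried
    -- to `EuclideanSpace`, compared there, and carried back.
    have h : (P.map Z).map (WithLp.toLp 2 : (ι → ℝ) → EuclideanSpace ℝ ι) =
        (γ.map (fun g => L *ᵥ g)).map (WithLp.toLp 2) := by
      have p1 : IsProbabilityMeasure (P.map Z) := Measure.isProbabilityMeasure_map hZ.aemeasurable
      have p2 : IsProbabilityMeasure (γ.map (fun g => L *ᵥ g)) :=
        Measure.isProbabilityMeasure_map hLm.aemeasurable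
      have p3 := Measure.isProbabilityMeasure_map (μ := P.map Z) hto.aemeasurable
      have p4 := Measure.isProbabilityMeasure_map (μ := γ.map (fun g => L *ᵥ g)) hto.aemeasurable
      refine Measure.ext_of_charFun (E := EuclideanSpace ℝ ι) (funext fun t => ?_)
      rw [Measure.map_map hto hZ, Measure.map_map hto hLm, charFun_apply, charFun_apply,
        integral_map (hto.comp hZ).aemeasurable (by fun_prop),
        integral_map (hto.comp hLm).aemeasurable (by fun_prop)]
      have ei : ∀ v : ι → ℝ, inner ℝ (WithLp.toLp 2 v : EuclideanSpace ℝ ι) t =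
          t.ofLp ⬝ᵥ v := fun v => by
        rw [EuclideanSpace.inner_eq_star_dotProduct]; simp
      simp only [Function.comp_apply, ei]
      rw [hchar]
      set s := Lᵀ *ᵥ t.ofLp with hs
      have e1 : ∀ g : ι → ℝ, Complex.exp (((t.ofLp ⬝ᵥ (L *ᵥ g) : ℝ) : ℂ) * Complex.I) =
          ∏ j, Complex.exp ((s j : ℂ) * (g j : ℂ) * Complex.I) := by
        intro g
        rw [← Complex.exp_sum, dotProduct_mulVec, ← mulVec_transpose, ← hs, dotProduct]
        push_cast
        rw [Finset.sum_mul]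
      simp_rw [e1]
      rw [hγ, integral_fintype_prod_eq_prod
        (fun j (z : ℝ) => Complex.exp ((s j : ℂ) * (z : ℂ) * Complex.I))]
      simp_rw [← charFun_apply_real, charFun_gaussianReal]
      rw [← Complex.exp_sum]
      congr 1
      rw [← hL, ← mulVec_mulVec, dotProduct_mulVec, ← mulVec_transpose, ← hs, dotProduct]
      push_cast
      rw [Finset.sum_div, ← Finset.sum_neg_distrib]
      refine Finset.sum_congr rfl fun j _ => ?_
      ring
    have h2 := congrArg (Measure.map (WithLp.ofLp : EuclideanSpace ℝ ι → (ι → ℝ))) h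
    rw [Measure.map_map hof hto, Measure.map_map hof hto] at h2
    have hid : (WithLp.ofLp : EuclideanSpace ℝ ι → (ι → ℝ)) ∘ (WithLp.toLp 2) = id := rfl
    rwa [hid, Measure.map_id, Measure.map_id] at h2
  have hq : Measurable fun z : ι → ℝ => z ⬝ᵥ (A *ᵥ z) - (A * S).trace := by
    simp only [mulVec, dotProduct]
    fun_prop
  have e : (fun ω => Z ω ⬝ᵥ (A *ᵥ Z ω) - (A * S).trace) =
      (fun z : ι → ℝ => z ⬝ᵥ (A *ᵥ z) - (A * S).trace) ∘ Z := rfl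
  rw [e, ← Measure.map_map hq hZ, hlaw, Measure.map_map hq hLm, chiSqLaw]
  congr 1
  ext g
  have e2 : (L *ᵥ g) ⬝ᵥ (A *ᵥ (L *ᵥ g)) = ∑ j, d j * g j ^ 2 := by
    have : (L *ᵥ g) ⬝ᵥ (A *ᵥ (L *ᵥ g)) = g ⬝ᵥ ((Lᵀ * A * L) *ᵥ g) := by
      rw [← mulVec_mulVec, ← mulVec_mulVec, dotProduct_mulVec g, vecMul_transpose]
    rw [this, hd, dotProduct]
    refine Finset.sum_congr rfl fun j _ => ?_
    rw [mulVec_diagonal]; ring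
  rw [Function.comp_apply, e2, ← sum_diag_eq_trace hL hd, ← Finset.sum_sub_distrib]
  refine Finset.sum_congr rfl fun j _ => by ring

end QuadraticForm

end

end HYExpansion

/-! ### Combinatorics of staircase relations and trace identities. -/

namespace HYExpansion

noncomputable section

section Staircase

variable {m n : ℕ} {R : Fin m → Fin n → Prop}

/-- A relation between two ordered sets whose pairs form a chain for the product order. -/
def IsStaircase (R : Fin m → Fin n → Prop) : Prop :=
  ∀ i j i' j', R i j → R i' j' → i < i' → j ≤ j'

/-- If the rows differ, monotonicity applied to the two given cells and to the two opposite corners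
gives both inequalities between `j₁` and `j₂`. -/
lemma IsStaircase.pair_iff (hR : IsStaircase R) {i₁ i₂ : Fin m} {j₁ j₂ : Fin n}
    (h₁ : R i₁ j₁) (h₂ : R i₂ j₂) : (R i₁ j₂ ∧ R i₂ j₁) ↔ (i₁ = i₂ ∨ j₁ = j₂) := by
  constructor
  · rintro ⟨h, h'⟩
    rcases lt_trichotomy i₁ i₂ with hi | hi | hi
    · have a := hR _ _ _ _ h₁ h₂ hi
      have b := hR _ _ _ _ h h' hi
      exact .inr (le_antisymm a b)
    · exact .inl hi
    · have a := hR _ _ _ _ h₂ h₁ hi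
      have b := hR _ _ _ _ h' h hi
      exact .inr (le_antisymm b a)
  · rintro (rfl | rfl)
    · exact ⟨h₂, h₁⟩
    · exact ⟨h₁, h₂⟩

/-- The alternatives are: one row, one column, or an L-shape whose corner is one of the three cells.
The orientation of the cycle matters: the corner shares its row with the next cell and its column
with the previous one. -/
lemma IsStaircase.triple_iff (hR : IsStaircase R) {i₁ i₂ i₃ : Fin m} {j₁ j₂ j₃ : Fin n}
    (h₁ : R i₁ j₁) (h₂ : R i₂ j₂) (h₃ : R i₃ j₃) :
    (R i₁ j₂ ∧ R i₂ j₃ ∧ R i₃ j₁) ↔ ((i₂ = i₁ ∧ i₃ = i₁) ∨ (j₂ = j₁ ∧ j₃ = j₁) ∨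
      (i₂ = i₁ ∧ j₃ = j₁) ∨ (i₃ = i₂ ∧ j₁ = j₂) ∨ (i₁ = i₃ ∧ j₂ = j₃)) := by
  constructor
  · rintro ⟨h12, h23, h31⟩
    unfold IsStaircase at hR
    grind
  · rintro (⟨rfl, rfl⟩ | ⟨rfl, rfl⟩ | ⟨rfl, rfl⟩ | ⟨rfl, rfl⟩ | ⟨rfl, rfl⟩) <;> simp_all

open Classical in
/-- The indicator of a relation as a real matrix. -/
def indMatrix (R : Fin m → Fin n → Prop) : Matrix (Fin m) (Fin n) ℝ :=
  fun i j => if R i j then 1 else 0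

/-- Indicator of equality. -/
def eqInd {α : Type*} [DecidableEq α] (a b : α) : ℝ := if a = b then 1 else 0

lemma IsStaircase.pair_eq (hR : IsStaircase R) {i₁ i₂ : Fin m} {j₁ j₂ : Fin n}
    (h₁ : R i₁ j₁) (h₂ : R i₂ j₂) : indMatrix R i₁ j₂ * indMatrix R i₂ j₁ =
      eqInd i₂ i₁ + eqInd j₂ j₁ - eqInd i₂ i₁ * eqInd j₂ j₁ := by
  have h := hR.pair_iff h₁ h₂
  have e : indMatrix R i₁ j₂ * indMatrix R i₂ j₁ =
      if i₁ = i₂ ∨ j₁ = j₂ then 1 else 0 := by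
    simp only [indMatrix, ite_zero_mul_ite_zero, mul_one, h]
  rw [e]
  by_cases hi : i₂ = i₁ <;> by_cases hj : j₂ = j₁ <;>
    simp [eqInd, hi, hj, eq_comm (a := i₁), eq_comm (a := j₁)]

/-- Inclusion–exclusion for the five events of `triple_iff`. The subtracted terms are those where
two cells coincide and the third shares their row or column. Each term is a product of two relations
to one common cell, the form in which the triple sums below factor. -/
lemma IsStaircase.triple_eq (hR : IsStaircase R) {i₁ i₂ i₃ : Fin m} {j₁ j₂ j₃ : Fin n}
    (h₁ : R i₁ j₁) (h₂ : R i₂ j₂) (h₃ : R i₃ j₃) :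
    indMatrix R i₁ j₂ * indMatrix R i₂ j₃ * indMatrix R i₃ j₁ =
      eqInd i₂ i₁ * eqInd i₃ i₁ + eqInd j₂ j₁ * eqInd j₃ j₁ +
      2 * ((eqInd i₂ i₁ * eqInd j₂ j₁) * (eqInd i₃ i₁ * eqInd j₃ j₁)) +
      (eqInd i₂ i₁ * eqInd j₃ j₁ + eqInd j₁ j₂ * eqInd i₃ i₂ + eqInd i₁ i₃ * eqInd j₂ j₃) -
      ((eqInd i₂ i₁ * eqInd j₂ j₁) * eqInd i₃ i₁ + eqInd i₁ i₂ * (eqInd i₃ i₂ * eqInd j₃ j₂) +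
        eqInd i₂ i₁ * (eqInd i₃ i₁ * eqInd j₃ j₁)) -
      ((eqInd i₂ i₁ * eqInd j₂ j₁) * eqInd j₃ j₁ + eqInd j₁ j₂ * (eqInd i₃ i₂ * eqInd j₃ j₂) +
        eqInd j₂ j₁ * (eqInd i₃ i₁ * eqInd j₃ j₁)) := by
  have h := hR.triple_iff h₁ h₂ h₃
  have e : indMatrix R i₁ j₂ * indMatrix R i₂ j₃ * indMatrix R i₃ j₁ =
      if ((i₂ = i₁ ∧ i₃ = i₁) ∨ (j₂ = j₁ ∧ j₃ = j₁) ∨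
      (i₂ = i₁ ∧ j₃ = j₁) ∨ (i₃ = i₂ ∧ j₁ = j₂) ∨ (i₁ = i₃ ∧ j₂ = j₃)) then 1 else 0 := by
    rw [mul_assoc]
    simp only [indMatrix, ite_zero_mul_ite_zero, mul_one, h]
  rw [e]
  clear e h h₁ h₂ h₃
  simp only [eqInd]
  by_cases a : i₂ = i₁
  · subst a
    by_cases b : i₃ = i₂
    · subst b
      by_cases c : j₂ = j₁
      · subst c
        by_cases d : j₃ = j₂
        · subst d; norm_num
        · simp [d, eq_comm (a := j₂)]
      · by_cases d : j₃ = j₁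
        · subst d; simp [c, eq_comm (a := j₃)]
        · by_cases f : j₂ = j₃
          · subst f; simp [d, eq_comm (a := j₁)]
          · simp [c, d, f, eq_comm (a := j₁), eq_comm (a := j₃)]
    · by_cases c : j₂ = j₁
      · subst c
        by_cases d : j₃ = j₂
        · subst d; simp [b, eq_comm (a := i₂)]
        · simp [b, d, eq_comm (a := j₂), eq_comm (a := i₂)]
      · by_cases d : j₃ = j₁
        · subst d; simp [b, c, eq_comm (a := j₃), eq_comm (a := i₂)]
        · simp [b, c, d, eq_comm (a := j₁), eq_comm (a := i₂)]
  · by_cases b : i₃ = i₂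
    · subst b
      by_cases c : j₂ = j₁
      · subst c
        by_cases d : j₃ = j₂
        · subst d; simp [a, eq_comm (a := i₁)]
        · simp [a, d, eq_comm (a := j₂), eq_comm (a := i₁)]
      · simp [a, c, eq_comm (a := j₁), eq_comm (a := i₁)]
    · by_cases f : i₃ = i₁
      · subst f
        by_cases c : j₂ = j₁
        · subst c
          by_cases d : j₃ = j₂
          · subst d; simp [a, b]
          · simp [a, b, d, eq_comm (a := j₂)]
        · by_cases d : j₂ = j₃
          · subst d; simp [a, b, c]
          · simp [a, b, c, d]
      · by_cases c : j₂ = j₁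
        · subst c
          by_cases d : j₃ = j₂
          · subst d; simp [a, b, f, eq_comm (a := i₁)]
          · simp [a, b, f, d, eq_comm (a := i₁)]
        · simp [a, b, c, f, eq_comm (a := i₁)]

section Sums

variable (w : Fin m → Fin n → ℝ)

/-- Row sums. -/
def rowSum (i : Fin m) : ℝ := ∑ j, w i j

/-- Column sums. -/
def colSum (j : Fin n) : ℝ := ∑ i, w i j

lemma sum_mul_eqInd_fst (i : Fin m) : ∑ e : Fin m × Fin n, w e.1 e.2 * eqInd e.1 i = rowSum w i := by
  simp [Fintype.sum_prod_type, eqInd, rowSum]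

lemma sum_mul_eqInd_snd (j : Fin n) : ∑ e : Fin m × Fin n, w e.1 e.2 * eqInd e.2 j = colSum w j := by
  simp [Fintype.sum_prod_type, eqInd, colSum]

lemma sum_mul_eqInd_both (i : Fin m) (j : Fin n) :
    ∑ e : Fin m × Fin n, w e.1 e.2 * (eqInd e.1 i * eqInd e.2 j) = w i j := by
  simp [Fintype.sum_prod_type, eqInd]

/-- With both kernels attached to the first cell, the sums over the other two separate. The next two
lemmas do the same for a kernel centred at the second or third cell. -/
lemma sum_three_fst {α : Type*} [Fintype α] (v : α → ℝ) (X Y : α → α → ℝ) :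
    ∑ e₁, ∑ e₂, ∑ e₃, v e₁ * v e₂ * v e₃ * (X e₂ e₁ * Y e₃ e₁) =
      ∑ e, v e * (∑ e', v e' * X e' e) * (∑ e', v e' * Y e' e) := by
  refine Finset.sum_congr rfl fun e _ => ?_
  rw [mul_assoc, Finset.sum_mul_sum, Finset.mul_sum]
  refine Finset.sum_congr rfl fun e' _ => ?_
  rw [Finset.mul_sum]
  exact Finset.sum_congr rfl fun e'' _ => by ring

lemma sum_three_snd {α : Type*} [Fintype α] (v : α → ℝ) (X Y : α → α → ℝ) :
    ∑ e₁, ∑ e₂, ∑ e₃, v e₁ * v e₂ * v e₃ * (X e₁ e₂ * Y e₃ e₂) =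
      ∑ e, v e * (∑ e', v e' * X e' e) * (∑ e', v e' * Y e' e) := by
  rw [Finset.sum_comm, ← sum_three_fst]
  refine Finset.sum_congr rfl fun _ _ => Finset.sum_congr rfl fun _ _ =>
    Finset.sum_congr rfl fun _ _ => by ring

lemma sum_three_trd {α : Type*} [Fintype α] (v : α → ℝ) (X Y : α → α → ℝ) :
    ∑ e₁, ∑ e₂, ∑ e₃, v e₁ * v e₂ * v e₃ * (X e₁ e₃ * Y e₂ e₃) =
      ∑ e, v e * (∑ e', v e' * X e' e) * (∑ e', v e' * Y e' e) := by
  have : ∀ e₁, ∑ e₂, ∑ e₃, v e₁ * v e₂ * v e₃ * (X e₁ e₃ * Y e₂ e₃) =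
      ∑ e₃, ∑ e₂, v e₁ * v e₂ * v e₃ * (X e₁ e₃ * Y e₂ e₃) := fun e₁ => Finset.sum_comm
  simp_rw [this]
  rw [← sum_three_snd]
  refine Finset.sum_congr rfl fun _ _ => Finset.sum_congr rfl fun _ _ =>
    Finset.sum_congr rfl fun _ _ => by ring

lemma sum_mul_row (F : Fin m → ℝ) : ∑ e : Fin m × Fin n, w e.1 e.2 * F e.1 =
    ∑ i, rowSum w i * F i := by
  simp [Fintype.sum_prod_type, rowSum, Finset.sum_mul]

lemma sum_mul_col (F : Fin n → ℝ) : ∑ e : Fin m × Fin n, w e.1 e.2 * F e.2 =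
    ∑ j, colSum w j * F j := by
  rw [Fintype.sum_prod_type, Finset.sum_comm]
  simp [colSum, Finset.sum_mul]

open Matrix

variable {w}

lemma trace_cube_eq_sum (K : Matrix (Fin m) (Fin n) ℝ) :
    (K * (of w)ᵀ * (K * (of w)ᵀ) * (K * (of w)ᵀ)).trace =
      ∑ e₁ : Fin m × Fin n, ∑ e₂ : Fin m × Fin n, ∑ e₃ : Fin m × Fin n,
        w e₁.1 e₁.2 * w e₂.1 e₂.2 * w e₃.1 e₃.2 *
          (K e₁.1 e₂.2 * K e₂.1 e₃.2 * K e₃.1 e₁.2) := by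
  have hP : ∀ i i', (K * (of w)ᵀ) i i' = ∑ j, K i j * w i' j := fun i i' => by
    simp [Matrix.mul_apply]
  have h1 : (K * (of w)ᵀ * (K * (of w)ᵀ) * (K * (of w)ᵀ)).trace =
      ∑ i₁, ∑ i₃, ∑ i₂, (∑ j₂, K i₁ j₂ * w i₂ j₂) * (∑ j₃, K i₂ j₃ * w i₃ j₃) *
        (∑ j₁, K i₃ j₁ * w i₁ j₁) := by
    rw [trace]
    refine Finset.sum_congr rfl fun i₁ _ => ?_
    rw [diag_apply, Matrix.mul_apply]
    refine Finset.sum_congr rfl fun i₃ _ => ?_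
    rw [Matrix.mul_apply, Finset.sum_mul]
    simp only [hP]
  rw [h1]
  have h2 : ∀ i₁ i₂ i₃ : Fin m, (∑ j₂, K i₁ j₂ * w i₂ j₂) * (∑ j₃, K i₂ j₃ * w i₃ j₃) *
        (∑ j₁, K i₃ j₁ * w i₁ j₁) = ∑ j₁, ∑ j₂, ∑ j₃, w i₁ j₁ * w i₂ j₂ * w i₃ j₃ *
          (K i₁ j₂ * K i₂ j₃ * K i₃ j₁) := by
    intro i₁ i₂ i₃
    rw [mul_comm, Finset.sum_mul]
    refine Finset.sum_congr rfl fun j₁ _ => ?_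
    rw [Finset.sum_mul_sum, Finset.mul_sum]
    refine Finset.sum_congr rfl fun j₂ _ => ?_
    rw [Finset.mul_sum]
    exact Finset.sum_congr rfl fun j₃ _ => by ring
  simp only [h2, Fintype.sum_prod_type]
  refine Finset.sum_congr rfl fun i₁ _ => ?_
  rw [Finset.sum_comm]
  have h3 : ∀ i₂ : Fin m, ∑ i₃, ∑ j₁, ∑ j₂, ∑ j₃, w i₁ j₁ * w i₂ j₂ * w i₃ j₃ *
          (K i₁ j₂ * K i₂ j₃ * K i₃ j₁) = ∑ j₁, ∑ j₂, ∑ i₃, ∑ j₃, w i₁ j₁ * w i₂ j₂ * w i₃ j₃ *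
          (K i₁ j₂ * K i₂ j₃ * K i₃ j₁) := by
    intro i₂
    rw [Finset.sum_comm]
    exact Finset.sum_congr rfl fun j₁ _ => Finset.sum_comm
  exact (Finset.sum_congr rfl fun i₂ _ => h3 i₂).trans Finset.sum_comm

lemma trace_sq_eq_sum (K : Matrix (Fin m) (Fin n) ℝ) :
    (K * (of w)ᵀ * (K * (of w)ᵀ)).trace =
      ∑ e₁ : Fin m × Fin n, ∑ e₂ : Fin m × Fin n,
        w e₁.1 e₁.2 * w e₂.1 e₂.2 * (K e₁.1 e₂.2 * K e₂.1 e₁.2) := by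
  have hP : ∀ i i', (K * (of w)ᵀ) i i' = ∑ j, K i j * w i' j := fun i i' => by
    simp [Matrix.mul_apply]
  rw [trace]
  simp only [diag_apply, Matrix.mul_apply, hP, Fintype.sum_prod_type]
  refine Finset.sum_congr rfl fun i₁ _ => ?_
  rw [Finset.sum_comm (γ := Fin n)]
  refine Finset.sum_congr rfl fun i₂ _ => ?_
  rw [mul_comm, Finset.sum_mul_sum]
  exact Finset.sum_congr rfl fun j₁ _ => Finset.sum_congr rfl fun j₂ _ => by ring

/-- The trace is a sum over triples of cells weighted by `w`. Only cells in `R` contribute, so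
`triple_eq` applies to each term, and summing out two cells produces row sums, column sums and
entries. -/
lemma IsStaircase.trace_cube (hR : IsStaircase R) (hw : ∀ i j, w i j ≠ 0 → R i j) :
    (indMatrix R * (of w)ᵀ * (indMatrix R * (of w)ᵀ) * (indMatrix R * (of w)ᵀ)).trace =
      ∑ i, rowSum w i ^ 3 + ∑ j, colSum w j ^ 3 + 2 * ∑ i, ∑ j, w i j ^ 3 -
        3 * ∑ i, ∑ j, (w i j ^ 2 * (rowSum w i + colSum w j) -
          w i j * rowSum w i * colSum w j) := by
  rw [trace_cube_eq_sum]
  set v : Fin m × Fin n → ℝ := fun e => w e.1 e.2 with hv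
  set X : Fin m × Fin n → Fin m × Fin n → ℝ := fun e' e => eqInd e'.1 e.1 with hX
  set Y : Fin m × Fin n → Fin m × Fin n → ℝ := fun e' e => eqInd e'.2 e.2 with hY
  set Z : Fin m × Fin n → Fin m × Fin n → ℝ := fun e' e => eqInd e'.1 e.1 * eqInd e'.2 e.2 with hZ
  have key : ∀ e₁ e₂ e₃ : Fin m × Fin n, w e₁.1 e₁.2 * w e₂.1 e₂.2 * w e₃.1 e₃.2 *
      (indMatrix R e₁.1 e₂.2 * indMatrix R e₂.1 e₃.2 * indMatrix R e₃.1 e₁.2) =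
      v e₁ * v e₂ * v e₃ * (X e₂ e₁ * X e₃ e₁) + v e₁ * v e₂ * v e₃ * (Y e₂ e₁ * Y e₃ e₁) +
      2 * (v e₁ * v e₂ * v e₃ * (Z e₂ e₁ * Z e₃ e₁)) +
      (v e₁ * v e₂ * v e₃ * (X e₂ e₁ * Y e₃ e₁) + v e₁ * v e₂ * v e₃ * (Y e₁ e₂ * X e₃ e₂) +
        v e₁ * v e₂ * v e₃ * (X e₁ e₃ * Y e₂ e₃)) -
      (v e₁ * v e₂ * v e₃ * (Z e₂ e₁ * X e₃ e₁) + v e₁ * v e₂ * v e₃ * (X e₁ e₂ * Z e₃ e₂) +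
        v e₁ * v e₂ * v e₃ * (X e₂ e₁ * Z e₃ e₁)) -
      (v e₁ * v e₂ * v e₃ * (Z e₂ e₁ * Y e₃ e₁) + v e₁ * v e₂ * v e₃ * (Y e₁ e₂ * Z e₃ e₂) +
        v e₁ * v e₂ * v e₃ * (Y e₂ e₁ * Z e₃ e₁)) := by
    intro e₁ e₂ e₃
    by_cases h : v e₁ * v e₂ * v e₃ = 0
    · simp only [hv] at h ⊢
      simp [h]
    · have h1 : w e₁.1 e₁.2 ≠ 0 := fun h0 => h (by simp [hv, h0])
      have h2 : w e₂.1 e₂.2 ≠ 0 := fun h0 => h (by simp [hv, h0])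
      have h3 : w e₃.1 e₃.2 ≠ 0 := fun h0 => h (by simp [hv, h0])
      rw [hR.triple_eq (hw _ _ h1) (hw _ _ h2) (hw _ _ h3)]
      simp only [hv, hX, hY, hZ]
      ring
  simp only [key, Finset.sum_add_distrib, Finset.sum_sub_distrib, ← Finset.mul_sum,
    sum_three_fst, sum_three_snd, sum_three_trd]
  have sX : ∀ e, ∑ e', v e' * X e' e = rowSum w e.1 := fun e => sum_mul_eqInd_fst w e.1
  have sY : ∀ e, ∑ e', v e' * Y e' e = colSum w e.2 := fun e => sum_mul_eqInd_snd w e.2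
  have sZ : ∀ e, ∑ e', v e' * Z e' e = v e := fun e => sum_mul_eqInd_both w e.1 e.2
  simp only [sX, sY, sZ]
  have t1 : ∑ e, v e * rowSum w e.1 * rowSum w e.1 = ∑ i, rowSum w i ^ 3 := by
    have := sum_mul_row w (fun i => rowSum w i * rowSum w i)
    simp only [hv, mul_assoc]
    rw [this]
    exact Finset.sum_congr rfl fun i _ => by ring
  have t2 : ∑ e, v e * colSum w e.2 * colSum w e.2 = ∑ j, colSum w j ^ 3 := by
    have := sum_mul_col w (fun j => colSum w j * colSum w j)
    simp only [hv, mul_assoc]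
    rw [this]
    exact Finset.sum_congr rfl fun i _ => by ring
  rw [t1, t2]
  have p : ∀ F : Fin m → Fin n → ℝ, ∑ i, ∑ j, F i j = ∑ e : Fin m × Fin n, F e.1 e.2 := fun F =>
    (Fintype.sum_prod_type (fun e : Fin m × Fin n => F e.1 e.2)).symm
  simp only [p]
  have u1 : ∀ e : Fin m × Fin n, w e.1 e.2 = v e := fun _ => rfl
  simp only [u1, mul_add, Finset.sum_add_distrib]
  have q1 : ∑ e, v e * v e * v e = ∑ e, v e ^ 3 := Finset.sum_congr rfl fun _ _ => by ring
  have q2 : ∑ e, v e * v e * rowSum w e.1 = ∑ e, v e ^ 2 * rowSum w e.1 :=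
    Finset.sum_congr rfl fun _ _ => by ring
  have q3 : ∑ e, v e * rowSum w e.1 * v e = ∑ e, v e ^ 2 * rowSum w e.1 :=
    Finset.sum_congr rfl fun _ _ => by ring
  have q4 : ∑ e, v e * v e * colSum w e.2 = ∑ e, v e ^ 2 * colSum w e.2 :=
    Finset.sum_congr rfl fun _ _ => by ring
  have q5 : ∑ e, v e * colSum w e.2 * v e = ∑ e, v e ^ 2 * colSum w e.2 :=
    Finset.sum_congr rfl fun _ _ => by ring
  have q6 : ∑ e, v e * colSum w e.2 * rowSum w e.1 = ∑ e, v e * rowSum w e.1 * colSum w e.2 :=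
    Finset.sum_congr rfl fun _ _ => by ring
  rw [q1, q2, q3, q4, q5, q6]
  ring

lemma IsStaircase.trace_sq (hR : IsStaircase R) (hw : ∀ i j, w i j ≠ 0 → R i j) :
    (indMatrix R * (of w)ᵀ * (indMatrix R * (of w)ᵀ)).trace =
      ∑ i, rowSum w i ^ 2 + ∑ j, colSum w j ^ 2 - ∑ i, ∑ j, w i j ^ 2 := by
  rw [trace_sq_eq_sum]
  have key : ∀ e₁ e₂ : Fin m × Fin n, w e₁.1 e₁.2 * w e₂.1 e₂.2 *
      (indMatrix R e₁.1 e₂.2 * indMatrix R e₂.1 e₁.2) =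
      w e₁.1 e₁.2 * (w e₂.1 e₂.2 * eqInd e₂.1 e₁.1) +
      w e₁.1 e₁.2 * (w e₂.1 e₂.2 * eqInd e₂.2 e₁.2) -
      w e₁.1 e₁.2 * (w e₂.1 e₂.2 * (eqInd e₂.1 e₁.1 * eqInd e₂.2 e₁.2)) := by
    intro e₁ e₂
    by_cases h1 : w e₁.1 e₁.2 = 0
    · simp [h1]
    by_cases h2 : w e₂.1 e₂.2 = 0
    · simp [h2]
    rw [hR.pair_eq (hw _ _ h1) (hw _ _ h2)]
    ring
  simp only [key, Finset.sum_add_distrib, Finset.sum_sub_distrib, ← Finset.mul_sum,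
    sum_mul_eqInd_fst, sum_mul_eqInd_snd, sum_mul_eqInd_both, sum_mul_row, sum_mul_col]
  rw [Fintype.sum_prod_type]
  simp only [sq]

/-- Only one of the two cells carries `w`; the other, `(i, j')`, carries `a i * b j'`. The pair
identity then sums `w` over the cross formed by row `i` and column `j'`, which is what becomes `v(I
∪ J)` in `μ₃`. -/
lemma IsStaircase.trace_mixed (hR : IsStaircase R) (hw : ∀ i j, w i j ≠ 0 → R i j)
    (a : Fin m → ℝ) (b : Fin n → ℝ) :
    (indMatrix R * (of w)ᵀ * (indMatrix R * diagonal b * ((indMatrix R)ᵀ * diagonal a))).trace =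
      ∑ i, ∑ j, a i * b j * (rowSum w i + colSum w j - w i j) * indMatrix R i j := by
  have hP : ∀ i i', (indMatrix R * (of w)ᵀ) i i' = ∑ j, indMatrix R i j * w i' j := fun i i' => by
    simp [Matrix.mul_apply]
  have hQ : ∀ i i', (indMatrix R * diagonal b * ((indMatrix R)ᵀ * diagonal a)) i' i =
      ∑ j', indMatrix R i' j' * b j' * (indMatrix R i j' * a i) := fun i i' => by
    rw [Matrix.mul_apply]
    simp only [mul_diagonal, transpose_apply]
  rw [trace]
  simp only [diag_apply]
  refine Finset.sum_congr rfl fun i _ => ?_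
  rw [Matrix.mul_apply]
  simp only [hP, hQ, Finset.sum_mul_sum]
  have h1 : ∑ i', ∑ j, ∑ j', indMatrix R i j * w i' j *
      (indMatrix R i' j' * b j' * (indMatrix R i j' * a i)) =
      ∑ j', ∑ i', ∑ j, indMatrix R i j * w i' j *
      (indMatrix R i' j' * b j' * (indMatrix R i j' * a i)) := by
    have : ∀ i', ∑ j, ∑ j', indMatrix R i j * w i' j *
      (indMatrix R i' j' * b j' * (indMatrix R i j' * a i)) = ∑ j', ∑ j, indMatrix R i j * w i' j *
      (indMatrix R i' j' * b j' * (indMatrix R i j' * a i)) := fun _ => Finset.sum_comm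
    simp_rw [this]
    exact Finset.sum_comm
  rw [h1]
  refine Finset.sum_congr rfl fun j' _ => ?_
  by_cases hij : R i j'
  · have hone : indMatrix R i j' = 1 := by simp [indMatrix, hij]
    have key : ∀ e : Fin m × Fin n, indMatrix R i e.2 * w e.1 e.2 *
        (indMatrix R e.1 j' * b j' * (indMatrix R i j' * a i)) =
        a i * b j' * (w e.1 e.2 * eqInd e.1 i) + a i * b j' * (w e.1 e.2 * eqInd e.2 j') -
        a i * b j' * (w e.1 e.2 * (eqInd e.1 i * eqInd e.2 j')) := by
      intro e
      by_cases h0 : w e.1 e.2 = 0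
      · simp [h0]
      have := hR.pair_eq hij (hw _ _ h0)
      rw [hone]
      linear_combination (a i * b j' * w e.1 e.2) * this
    have h2 := Fintype.sum_prod_type (fun e : Fin m × Fin n => indMatrix R i e.2 * w e.1 e.2 *
        (indMatrix R e.1 j' * b j' * (indMatrix R i j' * a i)))
    simp only at h2
    rw [← h2, Finset.sum_congr rfl fun e _ => key e]
    simp only [Finset.sum_add_distrib, Finset.sum_sub_distrib, ← Finset.mul_sum,
      sum_mul_eqInd_fst, sum_mul_eqInd_snd, sum_mul_eqInd_both, hone]
    ring
  · have hz : indMatrix R i j' = 0 := by simp [indMatrix, hij]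
    simp [hz]

end Sums

end Staircase

end

end HYExpansion

/-! ### Bilinear forms of two Gaussian families over a staircase. -/

namespace HYExpansion

noncomputable section

section Bipartite

open Matrix

variable {m n : ℕ} {R : Fin m → Fin n → Prop} {w : Fin m → Fin n → ℝ} {a : Fin m → ℝ}
  {b : Fin n → ℝ}

/-- The symmetric matrix of the bilinear form `∑ zᵢ zⱼ Rᵢⱼ`. -/
def bipartiteForm (R : Fin m → Fin n → Prop) : Matrix (Fin m ⊕ Fin n) (Fin m ⊕ Fin n) ℝ :=
  fromBlocks 0 ((1 / 2 : ℝ) • indMatrix R) ((1 / 2 : ℝ) • (indMatrix R)ᵀ) 0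

/-- The covariance matrix of two families, each with independent members. -/
def bipartiteCov (a : Fin m → ℝ) (b : Fin n → ℝ) (w : Fin m → Fin n → ℝ) :
    Matrix (Fin m ⊕ Fin n) (Fin m ⊕ Fin n) ℝ :=
  fromBlocks (diagonal a) (of w) (of w)ᵀ (diagonal b)

lemma bipartiteForm_transpose : (bipartiteForm R)ᵀ = bipartiteForm R := by
  simp [bipartiteForm, fromBlocks_transpose]

lemma bipartiteForm_quadratic (z : Fin m ⊕ Fin n → ℝ) :
    z ⬝ᵥ (bipartiteForm R *ᵥ z) =
      ∑ i, ∑ j, z (.inl i) * z (.inr j) * indMatrix R i j := by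
  have h : z ⬝ᵥ (bipartiteForm R *ᵥ z) = 1 / 2 * (∑ i, z (.inl i) * ∑ j, indMatrix R i j * z (.inr j))
      + 1 / 2 * ∑ j, z (.inr j) * ∑ i, indMatrix R i j * z (.inl i) := by
    simp only [dotProduct, mulVec, Fintype.sum_sum_type, bipartiteForm, fromBlocks_apply₁₁,
      fromBlocks_apply₁₂, fromBlocks_apply₂₁, fromBlocks_apply₂₂, Matrix.zero_apply, zero_mul,
      Finset.sum_const_zero, zero_add, add_zero, Matrix.smul_apply, smul_eq_mul, transpose_apply,
      Finset.mul_sum]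
    congr 1 <;> exact Finset.sum_congr rfl fun _ _ => Finset.sum_congr rfl fun _ _ => by ring
  rw [h]
  have h1 : ∑ i, z (.inl i) * ∑ j, indMatrix R i j * z (.inr j) =
      ∑ i, ∑ j, z (.inl i) * z (.inr j) * indMatrix R i j := by
    simp only [Finset.mul_sum]
    exact Finset.sum_congr rfl fun _ _ => Finset.sum_congr rfl fun _ _ => by ring
  have h2 : ∑ j, z (.inr j) * ∑ i, indMatrix R i j * z (.inl i) =
      ∑ i, ∑ j, z (.inl i) * z (.inr j) * indMatrix R i j := by
    simp only [Finset.mul_sum]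
    rw [Finset.sum_comm]
    exact Finset.sum_congr rfl fun _ _ => Finset.sum_congr rfl fun _ _ => by ring
  rw [h1, h2]
  ring

lemma bipartiteCov_quadratic (t : Fin m ⊕ Fin n → ℝ) :
    t ⬝ᵥ (bipartiteCov a b w *ᵥ t) = ∑ i, a i * t (.inl i) ^ 2 + ∑ j, b j * t (.inr j) ^ 2 +
      2 * ∑ i, ∑ j, t (.inl i) * t (.inr j) * w i j := by
  have h : t ⬝ᵥ (bipartiteCov a b w *ᵥ t) =
      ∑ i, t (.inl i) * (a i * t (.inl i) + ∑ j, w i j * t (.inr j)) +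
      ∑ j, t (.inr j) * (∑ i, w i j * t (.inl i) + b j * t (.inr j)) := by
    simp only [dotProduct, mulVec, Fintype.sum_sum_type, bipartiteCov, fromBlocks_apply₁₁,
      fromBlocks_apply₁₂, fromBlocks_apply₂₁, fromBlocks_apply₂₂, transpose_apply, of_apply,
      diagonal_apply, ite_mul, zero_mul, Finset.sum_ite_eq, Finset.mem_univ, if_true]
  have h1 : ∑ i, t (.inl i) * ∑ j, w i j * t (.inr j) =
      ∑ i, ∑ j, t (.inl i) * t (.inr j) * w i j := by
    simp only [Finset.mul_sum]
    exact Finset.sum_congr rfl fun _ _ => Finset.sum_congr rfl fun _ _ => by ring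
  have h2 : ∑ j, t (.inr j) * ∑ i, w i j * t (.inl i) =
      ∑ i, ∑ j, t (.inl i) * t (.inr j) * w i j := by
    simp only [Finset.mul_sum]
    rw [Finset.sum_comm]
    exact Finset.sum_congr rfl fun _ _ => Finset.sum_congr rfl fun _ _ => by ring
  rw [h]
  simp only [mul_add, Finset.sum_add_distrib, h1, h2]
  have h3 : ∑ i, t (.inl i) * (a i * t (.inl i)) = ∑ i, a i * t (.inl i) ^ 2 :=
    Finset.sum_congr rfl fun _ _ => by ring
  have h4 : ∑ j, t (.inr j) * (b j * t (.inr j)) = ∑ j, b j * t (.inr j) ^ 2 :=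
    Finset.sum_congr rfl fun _ _ => by ring
  rw [h3, h4]
  ring

lemma trace_fromBlocks_eq (A : Matrix (Fin m) (Fin m) ℝ) (B : Matrix (Fin m) (Fin n) ℝ)
    (C : Matrix (Fin n) (Fin m) ℝ) (D : Matrix (Fin n) (Fin n) ℝ) :
    (fromBlocks A B C D).trace = A.trace + D.trace := by
  simp [trace, Fintype.sum_sum_type]

lemma bipartiteForm_mul_cov : bipartiteForm R * bipartiteCov a b w = (1 / 2 : ℝ) •
    fromBlocks (indMatrix R * (of w)ᵀ) (indMatrix R * diagonal b)
      ((indMatrix R)ᵀ * diagonal a) ((indMatrix R)ᵀ * of w) := by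
  simp only [bipartiteForm, bipartiteCov, fromBlocks_multiply, Matrix.zero_mul, zero_add, add_zero,
    fromBlocks_smul, Matrix.smul_mul]

lemma trace_form_mul_cov (hw : ∀ i j, w i j ≠ 0 → R i j) :
    (bipartiteForm R * bipartiteCov a b w).trace = ∑ i, ∑ j, w i j := by
  have h1 : (indMatrix R * (of w)ᵀ).trace = ∑ i, ∑ j, w i j := by
    simp only [trace, diag_apply, Matrix.mul_apply, transpose_apply, of_apply]
    refine Finset.sum_congr rfl fun i _ => Finset.sum_congr rfl fun j _ => ?_
    by_cases h : w i j = 0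
    · simp [h]
    · simp [indMatrix, hw i j h]
  have h2 : ((indMatrix R)ᵀ * of w).trace = (indMatrix R * (of w)ᵀ).trace := by
    rw [← trace_transpose, transpose_mul, transpose_transpose, trace_mul_comm]
  rw [bipartiteForm_mul_cov, trace_smul, trace_fromBlocks_eq, h2, h1, smul_eq_mul]
  ring

/-- The square of the block matrix contributes two pure words with trace `tr (KWᵀ)²` and two mixed
words with trace `∑ a i * b j * K i j`, the latter because `K` has entries `0` and `1`. The
prefactor is `(1/2)² · 2`. -/
lemma trace_form_mul_cov_sq (hR : IsStaircase R) (hw : ∀ i j, w i j ≠ 0 → R i j) :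
    (bipartiteForm R * bipartiteCov a b w * (bipartiteForm R * bipartiteCov a b w)).trace =
      1 / 2 * (∑ i, ∑ j, a i * b j * indMatrix R i j + ∑ i, rowSum w i ^ 2 + ∑ j, colSum w j ^ 2 -
        ∑ i, ∑ j, w i j ^ 2) := by
  have h0 := hR.trace_sq hw
  rw [bipartiteForm_mul_cov]
  set K := indMatrix R with hK
  set W : Matrix (Fin m) (Fin n) ℝ := of w with hW
  have hKK : ∀ i j, K i j * K i j = K i j := fun i j => by
    rw [hK]; unfold indMatrix; split_ifs <;> simp
  have h1 : (Kᵀ * W * (Kᵀ * W)).trace = (K * Wᵀ * (K * Wᵀ)).trace := by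
    rw [← trace_transpose]
    simp only [transpose_mul, transpose_transpose, Matrix.mul_assoc]
    rw [trace_mul_comm]
    simp only [Matrix.mul_assoc]
  have h2 : (K * diagonal b * (Kᵀ * diagonal a)).trace = ∑ i, ∑ j, a i * b j * K i j := by
    rw [trace]
    refine Finset.sum_congr rfl fun i _ => ?_
    rw [diag_apply, Matrix.mul_apply]
    simp only [mul_diagonal, transpose_apply]
    exact Finset.sum_congr rfl fun j _ => by
      linear_combination a i * b j * hKK i j
  have h3 : (Kᵀ * diagonal a * (K * diagonal b)).trace = ∑ i, ∑ j, a i * b j * K i j := by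
    rw [trace_mul_comm, h2]
  simp only [Matrix.smul_mul, Matrix.mul_smul, smul_smul, fromBlocks_multiply, trace_smul,
    trace_fromBlocks_eq, trace_add, h1, h2, h3, h0, smul_eq_mul]
  ring

/-- The trace of the cube of a `2 × 2` block matrix has eight words: two pure ones, transposes of
each other up to cyclic order, and six mixed ones, all equal to `T` by cyclicity and transposition.
The weights are `(1/2)³ · 2 = 1/4` and `(1/2)³ · 6 = 3/4`. -/
lemma trace_form_mul_cov_cube (hR : IsStaircase R) (hw : ∀ i j, w i j ≠ 0 → R i j) :
    (bipartiteForm R * bipartiteCov a b w * (bipartiteForm R * bipartiteCov a b w) *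
      (bipartiteForm R * bipartiteCov a b w)).trace =
      1 / 4 * (∑ i, rowSum w i ^ 3 + ∑ j, colSum w j ^ 3 + 2 * ∑ i, ∑ j, w i j ^ 3 +
        3 * ∑ i, ∑ j, a i * b j * (rowSum w i + colSum w j - w i j) * indMatrix R i j -
        3 * ∑ i, ∑ j, (w i j ^ 2 * (rowSum w i + colSum w j) -
          w i j * rowSum w i * colSum w j)) := by
  have h0 := hR.trace_cube hw
  have m0 := hR.trace_mixed hw a b
  rw [bipartiteForm_mul_cov]
  set K := indMatrix R with hK
  set W : Matrix (Fin m) (Fin n) ℝ := of w with hW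
  set Da := diagonal a
  set Db := diagonal b
  have dA : Daᵀ = Da := diagonal_transpose a
  have dB : Dbᵀ = Db := diagonal_transpose b
  set T := (K * Wᵀ * (K * Db * (Kᵀ * Da))).trace with hT
  have a1 : (K * Db * (Kᵀ * Da) * (K * Wᵀ)).trace = T := by
    rw [hT, trace_mul_comm]
  have a2 : (K * Wᵀ * (K * Db) * (Kᵀ * Da)).trace = T := by
    rw [hT]; simp only [Matrix.mul_assoc]
  have a3 : (Kᵀ * Da * (K * Wᵀ) * (K * Db)).trace = T := by
    rw [hT]
    have : Kᵀ * Da * (K * Wᵀ) * (K * Db) = (Kᵀ * Da) * ((K * Wᵀ) * (K * Db)) := by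
      simp only [Matrix.mul_assoc]
    rw [this, trace_mul_comm]
    simp only [Matrix.mul_assoc]
  have b0 : (K * Db * (Kᵀ * W) * (Kᵀ * Da)).trace = T := by
    rw [hT, ← trace_transpose]
    simp only [transpose_mul, transpose_transpose, dA, dB, Matrix.mul_assoc]
    have : Da * (K * (Wᵀ * (K * (Db * Kᵀ)))) = Da * (K * (Wᵀ * (K * (Db * Kᵀ)))) := rfl
    rw [trace_mul_comm]
    simp only [Matrix.mul_assoc]
  have b1 : (Kᵀ * W * (Kᵀ * Da) * (K * Db)).trace = T := by
    rw [trace_mul_comm, ← b0]; simp only [Matrix.mul_assoc]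
  have b2 : (Kᵀ * Da * (K * Db) * (Kᵀ * W)).trace = T := by
    have : Kᵀ * Da * (K * Db) * (Kᵀ * W) = (Kᵀ * Da) * ((K * Db) * (Kᵀ * W)) := by
      simp only [Matrix.mul_assoc]
    rw [this, trace_mul_comm, ← b0]
  have c1 : (Kᵀ * W * (Kᵀ * W) * (Kᵀ * W)).trace = (K * Wᵀ * (K * Wᵀ) * (K * Wᵀ)).trace := by
    rw [← trace_transpose]
    simp only [transpose_mul, transpose_transpose, Matrix.mul_assoc]
    rw [trace_mul_comm]
    simp only [Matrix.mul_assoc]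
  simp only [Matrix.smul_mul, Matrix.mul_smul, smul_smul, fromBlocks_multiply, trace_smul,
    trace_fromBlocks_eq, Matrix.add_mul, trace_add, a1, a2, a3, b0, b1, b2, c1, h0, smul_eq_mul]
  rw [m0]
  ring

/-- Changing the sign of the second family changes only the sign of the cross term. Positivity at
the reflected vector thus bounds the cross term by the diagonal. -/
lemma bipartiteCov_le (hS : (bipartiteCov a b w).PosSemidef) (t : Fin m ⊕ Fin n → ℝ) :
    t ⬝ᵥ (bipartiteCov a b w *ᵥ t) ≤ 2 * ∑ k, Sum.elim a b k * t k ^ 2 := by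
  set t' : Fin m ⊕ Fin n → ℝ := Sum.elim (fun i => t (.inl i)) (fun j => -t (.inr j)) with ht'
  have h := hS.dotProduct_mulVec_nonneg t'
  rw [star_trivial, bipartiteCov_quadratic] at h
  rw [bipartiteCov_quadratic, Fintype.sum_sum_type]
  simp only [ht', Sum.elim_inl, Sum.elim_inr, neg_sq, mul_neg, neg_mul,
    Finset.sum_neg_distrib] at h ⊢
  linarith

/-- A Schur test: `|yᵢ yⱼ| ≤ (yᵢ² bⱼ / aᵢ + yⱼ² aᵢ / bⱼ) / 2`, then sum the variances of the
intervals overlapping a given one, at most `r` by assumption. -/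
lemma abs_bipartiteForm_le (ha : ∀ i, 0 < a i) (hb : ∀ j, 0 < b j) {r : ℝ}
    (hra : ∀ j, ∑ i, a i * indMatrix R i j ≤ r) (hrb : ∀ i, ∑ j, b j * indMatrix R i j ≤ r)
    (y : Fin m ⊕ Fin n → ℝ) :
    |y ⬝ᵥ (bipartiteForm R *ᵥ y)| ≤ r / 2 * ∑ k, y k ^ 2 / Sum.elim a b k := by
  have hK0 : ∀ i j, 0 ≤ indMatrix R i j := fun i j => by
    unfold indMatrix; split_ifs <;> norm_num
  rw [bipartiteForm_quadratic, Fintype.sum_sum_type]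
  simp only [Sum.elim_inl, Sum.elim_inr]
  have h1 : ∀ i j, |y (.inl i) * y (.inr j) * indMatrix R i j| ≤
      1 / 2 * (y (.inl i) ^ 2 / a i * (b j * indMatrix R i j) +
        y (.inr j) ^ 2 / b j * (a i * indMatrix R i j)) := by
    intro i j
    have hai := ha i
    have hbj := hb j
    rw [abs_mul, abs_of_nonneg (hK0 i j)]
    have : |y (.inl i) * y (.inr j)| ≤
        1 / 2 * (y (.inl i) ^ 2 / a i * b j + y (.inr j) ^ 2 / b j * a i) := by
      have e : y (.inl i) ^ 2 / a i * b j + y (.inr j) ^ 2 / b j * a i -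
          2 * |y (.inl i) * y (.inr j)| =
          (|y (.inl i)| * b j - |y (.inr j)| * a i) ^ 2 / (a i * b j) := by
        rw [abs_mul]
        field_simp
        rw [← sq_abs (y (.inl i)), ← sq_abs (y (.inr j))]
        ring
      have e2 : 0 ≤ (|y (.inl i)| * b j - |y (.inr j)| * a i) ^ 2 / (a i * b j) := by positivity
      linarith
    calc _ ≤ 1 / 2 * (y (.inl i) ^ 2 / a i * b j + y (.inr j) ^ 2 / b j * a i) *
          indMatrix R i j := mul_le_mul_of_nonneg_right this (hK0 i j)
      _ = _ := by ring
  calc |∑ i, ∑ j, y (.inl i) * y (.inr j) * indMatrix R i j|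
      ≤ ∑ i, ∑ j, |y (.inl i) * y (.inr j) * indMatrix R i j| :=
        (Finset.abs_sum_le_sum_abs _ _).trans
          (Finset.sum_le_sum fun i _ => Finset.abs_sum_le_sum_abs _ _)
    _ ≤ ∑ i, ∑ j, 1 / 2 * (y (.inl i) ^ 2 / a i * (b j * indMatrix R i j) +
        y (.inr j) ^ 2 / b j * (a i * indMatrix R i j)) :=
        Finset.sum_le_sum fun i _ => Finset.sum_le_sum fun j _ => h1 i j
    _ = 1 / 2 * (∑ i, y (.inl i) ^ 2 / a i * ∑ j, b j * indMatrix R i j +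
        ∑ j, y (.inr j) ^ 2 / b j * ∑ i, a i * indMatrix R i j) := by
        simp only [← Finset.mul_sum, Finset.sum_add_distrib]
        congr 2
        rw [Finset.sum_comm]
        simp only [Finset.mul_sum]
    _ ≤ 1 / 2 * (∑ i, y (.inl i) ^ 2 / a i * r + ∑ j, y (.inr j) ^ 2 / b j * r) := by
        gcongr with i _ j _
        · have := (ha i).le; positivity
        · exact hrb i
        · have := (hb j).le; positivity
        · exact hra j
    _ = _ := by rw [← Finset.sum_mul, ← Finset.sum_mul]; ring

/-- The law of the centred bilinear form of two jointly Gaussian families, each with independent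
members, over a staircase. -/
theorem exists_map_bilinear_eq_chiSqLaw {Ω : Type*} [MeasurableSpace Ω] (P : Measure Ω)
    [IsProbabilityMeasure P] (hR : IsStaircase R) (hw : ∀ i j, w i j ≠ 0 → R i j)
    (ha : ∀ i, 0 < a i) (hb : ∀ j, 0 < b j) {r : ℝ} (hr : 0 ≤ r)
    (hra : ∀ j, ∑ i, a i * indMatrix R i j ≤ r) (hrb : ∀ i, ∑ j, b j * indMatrix R i j ≤ r)
    {Z : Ω → Fin m ⊕ Fin n → ℝ} (hZ : Measurable Z) (hS : (bipartiteCov a b w).PosSemidef)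
    (hchar : ∀ t : Fin m ⊕ Fin n → ℝ, ∫ ω, Complex.exp (((t ⬝ᵥ Z ω : ℝ) : ℂ) * Complex.I) ∂P =
      Complex.exp (-((t ⬝ᵥ (bipartiteCov a b w *ᵥ t) / 2 : ℝ) : ℂ))) :
    ∃ d : Fin m ⊕ Fin n → ℝ,
      P.map (fun ω => ∑ i, ∑ j, Z ω (.inl i) * Z ω (.inr j) * indMatrix R i j -
        ∑ i, ∑ j, w i j) = chiSqLaw d ∧
      ∑ k, d k ^ 2 = 1 / 2 * (∑ i, ∑ j, a i * b j * indMatrix R i j + ∑ i, rowSum w i ^ 2 +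
        ∑ j, colSum w j ^ 2 - ∑ i, ∑ j, w i j ^ 2) ∧
      ∑ k, d k ^ 3 = 1 / 4 * (∑ i, rowSum w i ^ 3 + ∑ j, colSum w j ^ 3 +
        2 * ∑ i, ∑ j, w i j ^ 3 +
        3 * ∑ i, ∑ j, a i * b j * (rowSum w i + colSum w j - w i j) * indMatrix R i j -
        3 * ∑ i, ∑ j, (w i j ^ 2 * (rowSum w i + colSum w j) -
          w i j * rowSum w i * colSum w j)) ∧
      ∀ k, |d k| ≤ r := by
  obtain ⟨L, d, hL, hd⟩ := exists_factor_diagonal hS (bipartiteForm_transpose (R := R))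
  refine ⟨d, ?_, ?_, ?_, fun k => ?_⟩
  · rw [← map_quadraticForm_eq_chiSqLaw P hZ hchar hL hd, trace_form_mul_cov hw]
    simp only [bipartiteForm_quadratic]
  · rw [sum_diag_sq_eq_trace hL hd, trace_form_mul_cov_sq hR hw]
  · rw [sum_diag_cube_eq_trace hL hd, trace_form_mul_cov_cube hR hw]
  · have := abs_diag_le hL hd (D := Sum.elim a b) (R := r / 2)
      (fun k => by cases k <;> simp [ha, hb]) (bipartiteCov_le hS)
      (abs_bipartiteForm_le ha hb hra hrb) (by positivity) k
    linarith

end Bipartite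

end

end HYExpansion

/-! ### Wiener integrals: joint Gaussianity and covariances. -/

namespace HYExpansion

noncomputable section

section WienerIntegral

lemma tendsto_integral_mul_of_tendsto_eLpNorm {α : Type*} [MeasurableSpace α] {μ : Measure α}
    {F G : ℕ → α → ℝ} {f g : α → ℝ} (hF : ∀ m, MemLp (F m) 2 μ) (hG : ∀ m, MemLp (G m) 2 μ)
    (hf : MemLp f 2 μ) (hg : MemLp g 2 μ)
    (hFf : Tendsto (fun m => eLpNorm (F m - f) 2 μ) atTop (𝓝 0))
    (hGg : Tendsto (fun m => eLpNorm (G m - g) 2 μ) atTop (𝓝 0)) :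
    Tendsto (fun m => ∫ x, F m x * G m x ∂μ) atTop (𝓝 (∫ x, f x * g x ∂μ)) := by
  have h1 := (Lp.tendsto_Lp_iff_tendsto_eLpNorm'' F hF f hf).2 hFf
  have h2 := (Lp.tendsto_Lp_iff_tendsto_eLpNorm'' G hG g hg).2 hGg
  have h3 := Filter.Tendsto.inner (𝕜 := ℝ) h2 h1
  have e : ∀ (u v : α → ℝ) (hu : MemLp u 2 μ) (hv : MemLp v 2 μ),
      inner ℝ (hv.toLp v) (hu.toLp u) = ∫ x, u x * v x ∂μ := by
    intro u v hu hv
    rw [L2.inner_def]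
    refine integral_congr_ae ?_
    filter_upwards [hu.coeFn_toLp, hv.coeFn_toLp] with x hx hy
    rw [hx, hy]
    simp
  simpa only [e] using h3

/-- The indicator of `(0, t]`. -/
def ioc (t : ℝ≥0) (u : ℝ) : ℝ := (Set.Ioc (0 : ℝ) t).indicator (fun _ => 1) u

/-- The step function `∑ cₜ 1_{(0, t]}`. -/
def comboEval (L : ℝ≥0 →₀ ℝ) (u : ℝ) : ℝ := Finsupp.linearCombination ℝ (fun t => ioc t u) L

/-- The linear combination `∑ cₜ Wₜ`. -/
def comboIntegral {Ω : Type*} (W : ℝ≥0 → Ω → ℝ) (L : ℝ≥0 →₀ ℝ) (ω : Ω) : ℝ :=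
  Finsupp.linearCombination ℝ (fun t => W t ω) L

lemma memLp_ioc (t : ℝ≥0) : MemLp (ioc t) 2 volume :=
  memLp_indicator_const 2 measurableSet_Ioc 1 (Or.inr (by simp))

lemma ioc_mul_ioc (s t : ℝ≥0) (u : ℝ) : ioc s u * ioc t u = ioc (min s t) u := by
  simp only [ioc, Set.indicator_apply, Set.mem_Ioc, NNReal.coe_min, le_min_iff, ite_zero_mul_ite_zero,
    mul_one]
  congr 1
  simp only [eq_iff_iff]
  tauto

lemma memLp_comboEval (L : ℝ≥0 →₀ ℝ) : MemLp (comboEval L) 2 volume := by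
  have : comboEval L = fun u => ∑ t ∈ L.support, L t * ioc t u := by
    funext u
    simp [comboEval, Finsupp.linearCombination_apply, Finsupp.sum]
  rw [this]
  exact memLp_finsetSum _ fun t _ => (memLp_ioc t).const_mul _

/-- The correlation density of the components `i` and `j`. -/
def corr (ρ : ℝ → ℝ) (i j : Fin 2) (u : ℝ) : ℝ := if i = j then 1 else ρ u

lemma corr_comm (ρ : ℝ → ℝ) (i j : Fin 2) : corr ρ i j = corr ρ j i := by
  funext u; simp [corr, eq_comm]

lemma measurable_corr {ρ : ℝ → ℝ} (hρ : Measurable ρ) (i j : Fin 2) : Measurable (corr ρ i j) := by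
  unfold corr; split_ifs <;> fun_prop

lemma abs_corr_le {ρ : ℝ → ℝ} (hρ : ∀ t, 0 ≤ t → ρ t ∈ Set.Icc (-1 : ℝ) 1) (i j : Fin 2) {u : ℝ}
    (hu : 0 ≤ u) : |corr ρ i j u| ≤ 1 := by
  unfold corr; split_ifs
  · simp
  · exact abs_le.2 (hρ u hu)

/-- The Lebesgue measure on the positive half line. -/
def posVolume : Measure ℝ := volume.restrict (Set.Ioi 0)

lemma memLp_corr_mul {ρ : ℝ → ℝ} (hρm : Measurable ρ)
    (hρ : ∀ t, 0 ≤ t → ρ t ∈ Set.Icc (-1 : ℝ) 1) (i j : Fin 2) {f : ℝ → ℝ}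
    (hf : MemLp f 2 posVolume) : MemLp (fun u => corr ρ i j u * f u) 2 posVolume := by
  refine hf.of_le ((measurable_corr hρm i j).aestronglyMeasurable.mul hf.1) ?_
  filter_upwards [ae_restrict_mem (μ := volume) measurableSet_Ioi] with u hu
  rw [norm_mul]
  exact mul_le_of_le_one_left (norm_nonneg _) (abs_corr_le hρ i j (le_of_lt hu))

variable {Ω : Type*} [MeasurableSpace Ω] {P : Measure Ω} {ρ : ℝ → ℝ} {B : Fin 2 → ℝ≥0 → Ω → ℝ}

lemma IsCorrelatedBrownian.memLp (hB : IsCorrelatedBrownian P ρ B) (i : Fin 2) (t : ℝ≥0) :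
    MemLp (B i t) 2 P :=
  (hB.gaussian.hasGaussianLaw_eval (i, t)).memLp_two

lemma IsCorrelatedBrownian.zero_ae (hB : IsCorrelatedBrownian P ρ B) (i : Fin 2) :
    B i 0 =ᵐ[P] 0 := by
  have h := hB.variance_eq i 0
  rw [NNReal.coe_zero, integral_eq_zero_iff_of_nonneg (fun ω => sq_nonneg _)
    (hB.memLp i 0).integrable_sq] at h
  filter_upwards [h] with ω hω
  simpa using hω

/-- As `B i 0 = 0` almost surely, `B i s` is an increment independent of `B j t - B j s`, so the
covariance is the one at time `s`. -/
lemma IsCorrelatedBrownian.integral_mul_of_le (hB : IsCorrelatedBrownian P ρ B) (i j : Fin 2)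
    {s t : ℝ≥0} (hst : s ≤ t) :
    ∫ ω, B i s ω * B j t ω ∂P = ∫ u in Set.Ioc (0 : ℝ) s, corr ρ i j u := by
  have hind := hB.indepIncrements.indepFun_sub_sub (r := 0) zero_le hst
  have hind' : IndepFun (fun ω => B i s ω - B i 0 ω) (fun ω => B j t ω - B j s ω) P :=
    hind.comp (measurable_pi_apply i) (measurable_pi_apply j)
  have hz := hB.zero_ae i
  have hI : ∀ i t, Integrable (B i t) P := fun i t =>
    (hB.gaussian.hasGaussianLaw_eval (i, t)).integrable
  have h0 : ∫ ω, B i s ω * (B j t ω - B j s ω) ∂P = 0 := by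
    have e1 : ∫ ω, B i s ω * (B j t ω - B j s ω) ∂P =
        ∫ ω, (B i s ω - B i 0 ω) * (B j t ω - B j s ω) ∂P := by
      refine integral_congr_ae ?_
      filter_upwards [hz] with ω hω
      simp [hω]
    rw [e1]
    have := hind'.integral_fun_mul_eq_mul_integral ((hI i s).sub (hI i 0)).aestronglyMeasurable
      ((hI j t).sub (hI j s)).aestronglyMeasurable
    rw [this, integral_sub (hI j t) (hI j s), hB.mean_zero, hB.mean_zero, sub_self, mul_zero]
  have h1 : ∫ ω, B i s ω * B j t ω ∂P = ∫ ω, B i s ω * B j s ω ∂P := by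
    have i1 : Integrable (fun ω => B i s ω * B j t ω) P := (hB.memLp i s).integrable_mul (hB.memLp j t)
    have i2 : Integrable (fun ω => B i s ω * B j s ω) P := (hB.memLp i s).integrable_mul (hB.memLp j s)
    simp only [mul_sub] at h0
    rw [integral_sub i1 i2] at h0
    linarith
  rw [h1]
  by_cases hij : i = j
  · subst hij
    have := hB.variance_eq i s
    simp only [sq] at this
    rw [this]
    simp [corr]
  · have hc := hB.covariance_eq s
    rw [intervalIntegral.integral_of_le (NNReal.coe_nonneg s)] at hc
    have e : corr ρ i j = ρ := by funext u; simp [corr, hij]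
    rw [e, ← hc]
    fin_cases i <;> fin_cases j <;> simp_all [mul_comm]

lemma IsCorrelatedBrownian.integral_mul (hB : IsCorrelatedBrownian P ρ B) (i j : Fin 2)
    (s t : ℝ≥0) :
    ∫ ω, B i s ω * B j t ω ∂P = ∫ u, corr ρ i j u * (ioc s u * ioc t u) ∂posVolume := by
  have h : ∫ u, corr ρ i j u * (ioc s u * ioc t u) ∂posVolume =
      ∫ u in Set.Ioc (0 : ℝ) (min s t), corr ρ i j u := by
    rw [posVolume, ← integral_indicator measurableSet_Ioi, ← integral_indicator measurableSet_Ioc]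
    congr 1 with u
    simp only [ioc_mul_ioc]
    simp only [ioc, Set.indicator_apply, Set.mem_Ioi, Set.mem_Ioc, NNReal.coe_min]
    by_cases h0 : 0 < u <;> by_cases h1 : u ≤ min (s : ℝ) t <;> simp only [h0, h1, and_self, and_true, and_false,
      if_true, if_false, mul_one, mul_zero]
  rw [h]
  rcases le_total s t with hst | hst
  · rw [hB.integral_mul_of_le i j hst]; simp [hst]
  · simp only [mul_comm (B i s _)]
    rw [hB.integral_mul_of_le j i hst, corr_comm]; simp [hst]

lemma IsCorrelatedBrownian.memLp_comboIntegral (hB : IsCorrelatedBrownian P ρ B) (i : Fin 2)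
    (L : ℝ≥0 →₀ ℝ) : MemLp (comboIntegral (B i) L) 2 P := by
  have : comboIntegral (B i) L = fun ω => ∑ t ∈ L.support, L t * B i t ω := by
    funext ω
    simp [comboIntegral, Finsupp.linearCombination_apply, Finsupp.sum]
  rw [this]
  exact memLp_finsetSum _ fun t _ => (hB.memLp i t).const_mul _

lemma IsCorrelatedBrownian.integral_comboIntegral (hB : IsCorrelatedBrownian P ρ B) (i : Fin 2)
    (L : ℝ≥0 →₀ ℝ) : ∫ ω, comboIntegral (B i) L ω ∂P = 0 := by
  simp only [comboIntegral, Finsupp.linearCombination_apply, Finsupp.sum, smul_eq_mul]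
  rw [integral_finsetSum _ fun t _ =>
    ((hB.gaussian.hasGaussianLaw_eval (i, t)).integrable).const_mul _]
  simp [integral_const_mul, hB.mean_zero]

/-- The Itô isometry for step functions, by bilinearity from indicators of `(0, t]`. -/
lemma IsCorrelatedBrownian.integral_comboIntegral_mul (hB : IsCorrelatedBrownian P ρ B)
    (hρm : Measurable ρ) (hρ : ∀ t, 0 ≤ t → ρ t ∈ Set.Icc (-1 : ℝ) 1) (i j : Fin 2)
    (L L' : ℝ≥0 →₀ ℝ) :
    ∫ ω, comboIntegral (B i) L ω * comboIntegral (B j) L' ω ∂P =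
      ∫ u, (corr ρ i j u * comboEval L u) * comboEval L' u ∂posVolume := by
  simp only [comboIntegral, comboEval, Finsupp.linearCombination_apply, Finsupp.sum, smul_eq_mul,
    mul_assoc (corr ρ i j _), Finset.sum_mul_sum]
  simp only [Finset.mul_sum]
  have hioc : ∀ t, MemLp (ioc t) 2 posVolume := fun t => (memLp_ioc t).restrict _
  have hI : ∀ s t, Integrable (fun u => corr ρ i j u * (ioc s u * ioc t u)) posVolume := by
    intro s t
    have := (memLp_corr_mul hρm hρ i j (hioc s)).integrable_mul (hioc t)
    exact this.congr (ae_of_all _ fun u => by simp [mul_assoc])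
  have hI' : ∀ s t, Integrable (fun ω => B i s ω * B j t ω) P := fun s t =>
    (hB.memLp i s).integrable_mul (hB.memLp j t)
  have e1 : ∀ s t ω, L s * B i s ω * (L' t * B j t ω) = L s * L' t * (B i s ω * B j t ω) :=
    fun s t ω => by ring
  have e2 : ∀ s t u, corr ρ i j u * (L s * ioc s u * (L' t * ioc t u)) =
      L s * L' t * (corr ρ i j u * (ioc s u * ioc t u)) := fun s t u => by ring
  simp only [e1, e2]
  rw [integral_finsetSum _ fun s _ => integrable_finsetSum _ fun t _ => (hI' s t).const_mul _,
    integral_finsetSum _ fun s _ => integrable_finsetSum _ fun t _ => (hI s t).const_mul _]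
  refine Finset.sum_congr rfl fun s _ => ?_
  rw [integral_finsetSum _ fun t _ => (hI' s t).const_mul _,
    integral_finsetSum _ fun t _ => (hI s t).const_mul _]
  refine Finset.sum_congr rfl fun t _ => ?_
  rw [integral_const_mul, integral_const_mul, hB.integral_mul]

/-- The combinations for both components are merged into one linear functional of finitely many
coordinates of the process indexed by (component, time). -/
lemma IsCorrelatedBrownian.hasGaussianLaw_sum (hB : IsCorrelatedBrownian P ρ B)
    {ι : Type*} [Fintype ι] (c : ι → ℝ) (κ : ι → Fin 2) (L : ι → ℝ≥0 →₀ ℝ) :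
    HasGaussianLaw (fun ω => ∑ p, c p * comboIntegral (B (κ p)) (L p) ω) P := by
  classical
  set M : (Fin 2 × ℝ≥0) →₀ ℝ := ∑ p, c p • (L p).mapDomain (fun t => (κ p, t)) with hM
  have h : ∀ ω, ∑ p, c p * comboIntegral (B (κ p)) (L p) ω =
      Finsupp.linearCombination ℝ (fun q : Fin 2 × ℝ≥0 => B q.1 q.2 ω) M := by
    intro ω
    rw [hM, map_sum]
    refine Finset.sum_congr rfl fun p _ => ?_
    rw [map_smul, Finsupp.linearCombination_mapDomain, smul_eq_mul]
    rfl
  simp only [h]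
  have := (hB.gaussian.hasGaussianLaw M.support).map_fun
    (∑ q : M.support, M q • ContinuousLinearMap.proj (R := ℝ) (φ := fun _ : M.support => ℝ) q)
  refine this.congr (ae_of_all _ fun ω => ?_)
  simp only [Finsupp.linearCombination_apply, Finsupp.sum, smul_eq_mul]
  rw [← Finset.sum_coe_sort M.support (fun q => M q * B q.1 q.2 ω)]
  simp

lemma HasGaussianLaw.integral_cexp_of_integral_eq_zero [IsProbabilityMeasure P] {Y : Ω → ℝ}
    (hY : HasGaussianLaw Y P) (h0 : ∫ ω, Y ω ∂P = 0) :
    ∫ ω, Complex.exp ((Y ω : ℂ) * Complex.I) ∂P =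
      Complex.exp (-((∫ ω, Y ω * Y ω ∂P) / 2 : ℝ)) := by
  have h := hY.map_eq_gaussianReal
  have hv : Var[Y; P] = ∫ ω, Y ω * Y ω ∂P := by
    rw [variance_of_integral_eq_zero hY.aemeasurable h0]
    simp [sq]
  have h1 : charFun (P.map Y) 1 = ∫ ω, Complex.exp ((Y ω : ℂ) * Complex.I) ∂P := by
    rw [charFun_apply_real, integral_map hY.aemeasurable (by fun_prop)]
    simp
  rw [← h1, h, charFun_gaussianReal, h0, hv, Real.coe_toNNReal _ (integral_nonneg fun ω =>
    mul_self_nonneg _)]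
  congr 1
  push_cast
  ring

/-- `Y` is the `L²`-limit of linear combinations of values of `W` whose step functions converge
to `G` in `L²(0, ∞)`. -/
def IsWienerLimit (P : Measure Ω) (W : ℝ≥0 → Ω → ℝ) (G : ℝ → ℝ) (Y : Ω → ℝ) : Prop :=
  ∃ L : ℕ → ℝ≥0 →₀ ℝ,
    Tendsto (fun m => eLpNorm (comboEval (L m) - G) 2 posVolume) atTop (𝓝 0) ∧
    Tendsto (fun m => eLpNorm (comboIntegral W (L m) - Y) 2 P) atTop (𝓝 0)

/-- The step function of a `StepFun` as a linear combination of indicators of `(0, t]`. -/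
def StepFun.combo (s : StepFun) : ℝ≥0 →₀ ℝ :=
  ∑ k ∈ Finset.range s.len, s.coef k • (Finsupp.single (s.knot (k + 1)) 1 -
    Finsupp.single (s.knot k) 1)

lemma StepFun.comboIntegral_combo (s : StepFun) (W : ℝ≥0 → Ω → ℝ) :
    comboIntegral W s.combo = s.integral W := by
  funext ω
  simp [comboIntegral, StepFun.combo, StepFun.integral, map_sum]

lemma StepFun.comboEval_combo (s : StepFun) : comboEval s.combo = s.eval := by
  funext u
  simp only [comboEval, StepFun.combo, StepFun.eval, map_sum, map_smul, map_sub,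
    Finsupp.linearCombination_single, smul_eq_mul]
  refine Finset.sum_congr rfl fun k _ => ?_
  have h1 : (s.knot k : ℝ) ≤ s.knot (k + 1) := s.mono k.le_succ
  have h2 : (0 : ℝ) ≤ s.knot k := (s.knot k).2
  simp only [ioc, Set.indicator_apply, Set.mem_Ioc]
  by_cases a : 0 < u <;> by_cases b : u ≤ s.knot k <;> by_cases c : u ≤ s.knot (k + 1)
  all_goals first
    | (have h3 : (s.knot k : ℝ) < u := not_le.1 b
       simp [a, b, c, h3]; done)
    | (simp [a, b, c, not_lt.2 b]; done)
    | (exfalso; linarith)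

lemma StepFun.eval_eq_zero {s : StepFun} {t : ℝ≥0} (hs : ∀ k, s.knot k ≤ t) {u : ℝ}
    (hu : u ∉ Set.Ioc (0 : ℝ) t) : s.eval u = 0 := by
  refine Finset.sum_eq_zero fun k _ => Set.indicator_of_notMem (fun h => hu ?_) _
  exact ⟨lt_of_le_of_lt (s.knot k).2 h.1, h.2.trans (hs _)⟩

/-- Extending integrands by zero puts integrals up to different times in one `L²` space, where they
can be subtracted. Since the knots do not exceed `t`, the step functions vanish outside `(0, t]` as
well. -/
lemma IsWienerIntegral.isWienerLimit {W : ℝ≥0 → Ω → ℝ} {g : ℝ → ℝ} {t : ℝ≥0} {Y : Ω → ℝ}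
    (h : IsWienerIntegral P W g t Y) :
    IsWienerLimit P W ((Set.Ioc (0 : ℝ) t).indicator g) Y := by
  obtain ⟨s, hs, h1, h2⟩ := h
  refine ⟨fun m => (s m).combo, ?_, ?_⟩
  · refine h1.congr fun m => ?_
    rw [StepFun.comboEval_combo]
    have e : (s m).eval - (Set.Ioc (0 : ℝ) t).indicator g =
        (Set.Ioc (0 : ℝ) t).indicator (fun u => (s m).eval u - g u) := by
      funext u
      by_cases hu : u ∈ Set.Ioc (0 : ℝ) t
      · simp [hu]
      · simp [hu, StepFun.eval_eq_zero (hs m) hu]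
    rw [e, eLpNorm_indicator_eq_eLpNorm_restrict measurableSet_Ioc, posVolume,
      Measure.restrict_restrict measurableSet_Ioc]
    congr 2
    ext u
    simp only [Set.mem_inter_iff, Set.mem_Ioc, Set.mem_Ioi]
    tauto
  · refine h2.congr fun m => ?_
    rw [StepFun.comboIntegral_combo, eLpNorm_sub_comm]
    rfl

lemma comboEval_sub (L L' : ℝ≥0 →₀ ℝ) : comboEval (L - L') = comboEval L - comboEval L' := by
  funext u; simp [comboEval]

lemma comboIntegral_sub (W : ℝ≥0 → Ω → ℝ) (L L' : ℝ≥0 →₀ ℝ) :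
    comboIntegral W (L - L') = comboIntegral W L - comboIntegral W L' := by
  funext u; simp [comboIntegral]

lemma tendsto_eLpNorm_sub_sub {α : Type*} [MeasurableSpace α] {μ : Measure α}
    {F G : ℕ → α → ℝ} {f g : α → ℝ} (hF : ∀ m, AEStronglyMeasurable (F m) μ)
    (hG : ∀ m, AEStronglyMeasurable (G m) μ) (hf : AEStronglyMeasurable f μ)
    (hg : AEStronglyMeasurable g μ)
    (hFf : Tendsto (fun m => eLpNorm (F m - f) 2 μ) atTop (𝓝 0))
    (hGg : Tendsto (fun m => eLpNorm (G m - g) 2 μ) atTop (𝓝 0)) :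
    Tendsto (fun m => eLpNorm ((F m - G m) - (f - g)) 2 μ) atTop (𝓝 0) := by
  have h := hFf.add hGg
  rw [add_zero] at h
  refine tendsto_of_tendsto_of_tendsto_of_le_of_le tendsto_const_nhds h (fun _ => zero_le)
    fun m => ?_
  have e : (F m - G m) - (f - g) = (F m - f) - (G m - g) := by abel
  simp only [e]
  exact eLpNorm_sub_le ((hF m).sub hf) ((hG m).sub hg) (by norm_num)

lemma IsCorrelatedBrownian.isWienerLimit_sub (hB : IsCorrelatedBrownian P ρ B) {i : Fin 2}
    {G G' : ℝ → ℝ} {Y Y' : Ω → ℝ} (hG : Measurable G) (hG' : Measurable G') (hY : Measurable Y)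
    (hY' : Measurable Y') (h : IsWienerLimit P (B i) G Y) (h' : IsWienerLimit P (B i) G' Y') :
    IsWienerLimit P (B i) (G - G') (Y - Y') := by
  obtain ⟨L, h1, h2⟩ := h
  obtain ⟨L', h1', h2'⟩ := h'
  refine ⟨fun m => L m - L' m, ?_, ?_⟩
  · simp only [comboEval_sub]
    exact tendsto_eLpNorm_sub_sub (fun m => ((memLp_comboEval _).restrict _).1)
      (fun m => ((memLp_comboEval _).restrict _).1) hG.aestronglyMeasurable
      hG'.aestronglyMeasurable h1 h1'
  · simp only [comboIntegral_sub]
    exact tendsto_eLpNorm_sub_sub (fun m => (hB.memLp_comboIntegral _ _).1)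
      (fun m => (hB.memLp_comboIntegral _ _).1) hY.aestronglyMeasurable
      hY'.aestronglyMeasurable h2 h2'

lemma IsCorrelatedBrownian.memLp_of_isWienerLimit (hB : IsCorrelatedBrownian P ρ B) {i : Fin 2}
    {G : ℝ → ℝ} {Y : Ω → ℝ} (hY : Measurable Y) (h : IsWienerLimit P (B i) G Y) :
    MemLp Y 2 P := by
  obtain ⟨L, -, h2⟩ := h
  obtain ⟨m, hm⟩ := ((tendsto_order.1 h2).2 1 (by norm_num)).exists
  have hL := hB.memLp_comboIntegral i (L m)
  have h3 : MemLp (comboIntegral (B i) (L m) - Y) 2 P :=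
    ⟨hL.1.sub hY.aestronglyMeasurable, hm.trans ENNReal.one_lt_top⟩
  simpa using hL.sub h3

lemma norm_exp_mul_I_sub_exp_mul_I_le (x y : ℝ) :
    ‖Complex.exp ((x : ℂ) * Complex.I) - Complex.exp ((y : ℂ) * Complex.I)‖ ≤ |x - y| := by
  have e : Complex.exp ((x : ℂ) * Complex.I) - Complex.exp ((y : ℂ) * Complex.I) =
      Complex.exp ((y : ℂ) * Complex.I) * (Complex.exp (Complex.I * ((x - y : ℝ) : ℂ)) - 1) := by
    rw [mul_sub, mul_one, ← Complex.exp_add]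
    congr 2
    push_cast
    ring
  rw [e, norm_mul, Complex.norm_exp_ofReal_mul_I, one_mul]
  exact Real.norm_exp_I_mul_ofReal_sub_one_le

/-- Linear combinations of Wiener integrals are centred Gaussian variables. -/
theorem IsCorrelatedBrownian.integral_cexp_sum [IsProbabilityMeasure P]
    (hB : IsCorrelatedBrownian P ρ B) (hρm : Measurable ρ)
    (hρ : ∀ t, 0 ≤ t → ρ t ∈ Set.Icc (-1 : ℝ) 1) {ι : Type*} [Fintype ι] (c : ι → ℝ)
    (κ : ι → Fin 2) {G : ι → ℝ → ℝ} {Y : ι → Ω → ℝ} (hG : ∀ p, MemLp (G p) 2 posVolume)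
    (hY : ∀ p, Measurable (Y p)) (h : ∀ p, IsWienerLimit P (B (κ p)) (G p) (Y p)) :
    ∫ ω, Complex.exp (((∑ p, c p * Y p ω : ℝ) : ℂ) * Complex.I) ∂P =
      Complex.exp (-((∑ p, ∑ q, c p * c q *
        ∫ u, (corr ρ (κ p) (κ q) u * G p u) * G q u ∂posVolume) / 2 : ℝ)) := by
  choose L hL1 hL2 using h
  set V : ℕ → Ω → ℝ := fun m ω => ∑ p, c p * comboIntegral (B (κ p)) (L p m) ω with hV
  have hVmem : ∀ m, MemLp (V m) 2 P := fun m =>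
    memLp_finsetSum _ fun p _ => (hB.memLp_comboIntegral _ _).const_mul _
  have hYm : Measurable (fun ω => ∑ p, c p * Y p ω) :=
    Finset.measurable_sum _ fun p _ => (hY p).const_mul _
  have hint : ∀ m, ∫ ω, V m ω * V m ω ∂P = ∑ p, ∑ q, c p * c q *
      ∫ u, (corr ρ (κ p) (κ q) u * comboEval (L p m) u) * comboEval (L q m) u ∂posVolume := by
    intro m
    have e : ∀ ω, V m ω * V m ω = ∑ p, ∑ q, c p * c q *
        (comboIntegral (B (κ p)) (L p m) ω * comboIntegral (B (κ q)) (L q m) ω) := by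
      intro ω
      simp only [hV, Finset.sum_mul_sum]
      exact Finset.sum_congr rfl fun _ _ => Finset.sum_congr rfl fun _ _ => by ring
    have hI : ∀ p q, Integrable (fun ω => comboIntegral (B (κ p)) (L p m) ω *
        comboIntegral (B (κ q)) (L q m) ω) P := fun p q =>
      (hB.memLp_comboIntegral _ _).integrable_mul (hB.memLp_comboIntegral _ _)
    simp only [e]
    rw [integral_finsetSum _ fun p _ => integrable_finsetSum _ fun q _ => (hI p q).const_mul _]
    refine Finset.sum_congr rfl fun p _ => ?_
    rw [integral_finsetSum _ fun q _ => (hI p q).const_mul _]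
    refine Finset.sum_congr rfl fun q _ => ?_
    rw [integral_const_mul, hB.integral_comboIntegral_mul hρm hρ]
  have hmean : ∀ m, ∫ ω, V m ω ∂P = 0 := by
    intro m
    simp only [hV]
    rw [integral_finsetSum _ fun p _ =>
      ((hB.memLp_comboIntegral _ _).integrable (by norm_num)).const_mul _]
    simp [integral_const_mul, hB.integral_comboIntegral]
  have hchar : ∀ m, ∫ ω, Complex.exp ((V m ω : ℂ) * Complex.I) ∂P =
      Complex.exp (-((∫ ω, V m ω * V m ω ∂P) / 2 : ℝ)) := fun m =>
    HasGaussianLaw.integral_cexp_of_integral_eq_zero (hB.hasGaussianLaw_sum c κ fun p => L p m)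
      (hmean m)
  -- Multiplication by a correlation bounded by `1` contracts `L²`, so the isometry passes to the
  -- limit.
  have hlim1 : Tendsto (fun m => ∫ ω, V m ω * V m ω ∂P) atTop (𝓝 (∑ p, ∑ q, c p * c q *
      ∫ u, (corr ρ (κ p) (κ q) u * G p u) * G q u ∂posVolume)) := by
    simp only [hint]
    refine tendsto_finsetSum _ fun p _ => tendsto_finsetSum _ fun q _ => ?_
    have hE : ∀ p m, MemLp (comboEval (L p m)) 2 posVolume := fun p m =>
      (memLp_comboEval _).restrict _
    refine (tendsto_integral_mul_of_tendsto_eLpNorm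
      (fun m => memLp_corr_mul hρm hρ (κ p) (κ q) (hE p m)) (fun m => hE q m)
      (memLp_corr_mul hρm hρ (κ p) (κ q) (hG p)) (hG q) ?_ (hL1 q)).const_mul _
    refine tendsto_of_tendsto_of_tendsto_of_le_of_le tendsto_const_nhds (hL1 p)
      (fun _ => zero_le) fun m => ?_
    refine eLpNorm_mono_ae ?_
    filter_upwards [ae_restrict_mem (μ := volume) measurableSet_Ioi] with u hu
    simp only [Pi.sub_apply]
    rw [← mul_sub, norm_mul]
    exact mul_le_of_le_one_left (norm_nonneg _) (abs_corr_le hρ _ _ (le_of_lt hu))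
  -- `x ↦ exp(ix)` is 1-Lipschitz, so `L¹` convergence, implied by `L²` convergence, suffices.
  have hlim2 : Tendsto (fun m => ∫ ω, Complex.exp ((V m ω : ℂ) * Complex.I) ∂P) atTop
      (𝓝 (∫ ω, Complex.exp (((∑ p, c p * Y p ω : ℝ) : ℂ) * Complex.I) ∂P)) := by
    rw [tendsto_iff_norm_sub_tendsto_zero]
    have hdiff : Tendsto (fun m => (eLpNorm (V m - fun ω => ∑ p, c p * Y p ω) 1 P)) atTop
        (𝓝 0) := by
      have hsum : Tendsto (fun m => ∑ p, ‖c p‖ₑ *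
          eLpNorm (comboIntegral (B (κ p)) (L p m) - Y p) 2 P) atTop (𝓝 0) := by
        have : Tendsto (fun m => ∑ p, ‖c p‖ₑ *
          eLpNorm (comboIntegral (B (κ p)) (L p m) - Y p) 2 P) atTop (𝓝 (∑ p : ι, ‖c p‖ₑ * 0)) :=
          tendsto_finsetSum _ fun p _ => ENNReal.Tendsto.const_mul (hL2 p) (Or.inr (by simp))
        simpa using this
      refine tendsto_of_tendsto_of_tendsto_of_le_of_le tendsto_const_nhds hsum
        (fun _ => zero_le) fun m => ?_
      have e : (V m - fun ω => ∑ p, c p * Y p ω) =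
          ∑ p, c p • (comboIntegral (B (κ p)) (L p m) - Y p) := by
        funext ω
        simp [hV, mul_sub, Finset.sum_sub_distrib]
      have hm : ∀ p, AEStronglyMeasurable (comboIntegral (B (κ p)) (L p m) - Y p) P := fun p =>
        (hB.memLp_comboIntegral _ _).1.sub (hY p).aestronglyMeasurable
      refine (eLpNorm_le_eLpNorm_of_exponent_le (q := 2) (by norm_num)
        ((hVmem m).1.sub hYm.aestronglyMeasurable)).trans ?_
      rw [e]
      refine (eLpNorm_sum_le (fun p _ => (hm p).const_smul _) (by norm_num)).trans ?_
      exact Finset.sum_le_sum fun p _ => eLpNorm_const_smul_le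
    have hdiff' := (ENNReal.tendsto_toReal ENNReal.zero_ne_top).comp hdiff
    rw [ENNReal.toReal_zero] at hdiff'
    refine squeeze_zero (fun m => norm_nonneg _) (fun m => ?_) hdiff'
    have hVY : Integrable (V m - fun ω => ∑ p, c p * Y p ω) P := by
      refine ((hVmem m).integrable (by norm_num)).sub (integrable_finsetSum _ fun p _ => ?_)
      exact ((hB.memLp_of_isWienerLimit (hY p) ⟨L p, hL1 p, hL2 p⟩).integrable
        (by norm_num)).const_mul _
    have i1 : ∀ {U : Ω → ℝ}, AEMeasurable U P →
        Integrable (fun ω => Complex.exp ((U ω : ℂ) * Complex.I)) P := fun hU =>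
      Integrable.of_bound (by fun_prop) 1
        (ae_of_all _ fun ω => (Complex.norm_exp_ofReal_mul_I _).le)
    rw [← integral_sub (i1 (hVmem m).1.aemeasurable) (i1 hYm.aemeasurable)]
    refine (norm_integral_le_integral_norm _).trans ?_
    rw [Function.comp_apply, eLpNorm_one_eq_lintegral_enorm,
      ← integral_norm_eq_lintegral_enorm hVY.1]
    exact integral_mono_of_nonneg (ae_of_all _ fun ω => norm_nonneg _) hVY.norm
      (ae_of_all _ fun ω => norm_exp_mul_I_sub_exp_mul_I_le _ _)
  have hlim3 : Tendsto (fun m => ∫ ω, Complex.exp ((V m ω : ℂ) * Complex.I) ∂P) atTop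
      (𝓝 (Complex.exp (-((∑ p, ∑ q, c p * c q *
        ∫ u, (corr ρ (κ p) (κ q) u * G p u) * G q u ∂posVolume) / 2 : ℝ)))) := by
    simp only [hchar]
    have hc : Continuous fun x : ℝ => Complex.exp (-((x / 2 : ℝ) : ℂ)) := by fun_prop
    exact (hc.tendsto _).comp hlim1
  exact tendsto_nhds_unique hlim2 hlim3

end WienerIntegral

end

end HYExpansion

/-! ### Geometry of the partitions and the coefficients `μ₂`, `μ₃`. -/

namespace HYExpansion

noncomputable section

section Geometry

/-- The standing assumptions on the coefficients. -/
structure AdmissibleCoeff (T : ℝ≥0) (ρ : ℝ → ℝ) (σ : Fin 2 → ℝ → ℝ) (s : ℝ) : Prop where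
  measurable_sigma : ∀ i, Measurable (σ i)
  pos : ∀ i, ∀ t ∈ Set.Icc (0 : ℝ) T, 0 < σ i t
  le : ∀ i, ∀ t ∈ Set.Icc (0 : ℝ) T, σ i t ≤ s
  measurable_rho : Measurable ρ
  rho_mem : ∀ t, 0 ≤ t → ρ t ∈ Set.Icc (-1 : ℝ) 1

variable {T : ℝ≥0} {ρ : ℝ → ℝ} {σ : Fin 2 → ℝ → ℝ} {s : ℝ}

lemma AdmissibleCoeff.bound_pos (h : AdmissibleCoeff T ρ σ s) : 0 < s :=
  (h.pos 0 0 ⟨le_rfl, T.2⟩).trans_le (h.le 0 0 ⟨le_rfl, T.2⟩)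

lemma AdmissibleCoeff.abs_corr_mul_le (h : AdmissibleCoeff T ρ σ s) (i j : Fin 2) {t : ℝ}
    (ht : t ∈ Set.Ioc (0 : ℝ) T) : |corr ρ i j t * σ i t * σ j t| ≤ s ^ 2 := by
  have ht' : t ∈ Set.Icc (0 : ℝ) T := ⟨ht.1.le, ht.2⟩
  have hi := h.pos i t ht'
  have hj := h.pos j t ht'
  have h1 : |corr ρ i j t| ≤ 1 := abs_corr_le h.rho_mem i j ht.1.le
  rw [abs_mul, abs_mul, abs_of_pos hi, abs_of_pos hj, sq]
  refine mul_le_mul ?_ (h.le j t ht') hj.le h.bound_pos.le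
  calc _ ≤ 1 * s := mul_le_mul h1 (h.le i t ht') hi.le zero_le_one
    _ = s := one_mul s

lemma AdmissibleCoeff.integrableOn (h : AdmissibleCoeff T ρ σ s) (i j : Fin 2) :
    IntegrableOn (fun t => corr ρ i j t * σ i t * σ j t) (Set.Ioc (0 : ℝ) T) := by
  refine Measure.integrableOn_of_bounded (M := s ^ 2) (by simp) ?_ ?_
  · exact (((measurable_corr h.measurable_rho i j).mul (h.measurable_sigma i)).mul
      (h.measurable_sigma j)).aestronglyMeasurable
  · filter_upwards [ae_restrict_mem measurableSet_Ioc] with t ht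
    exact h.abs_corr_mul_le i j ht

lemma AdmissibleCoeff.abs_setIntegral_le (h : AdmissibleCoeff T ρ σ s) (i j : Fin 2) {S : Set ℝ}
    (hS : S ⊆ Set.Ioc (0 : ℝ) T) :
    |∫ t in S, corr ρ i j t * σ i t * σ j t| ≤ s ^ 2 * volume.real S := by
  rw [← Real.norm_eq_abs]
  exact norm_setIntegral_le_of_norm_le_const ((measure_mono hS).trans_lt measure_Ioc_lt_top)
    fun t ht => h.abs_corr_mul_le i j (hS ht)

lemma vol_eq (S : Set ℝ) : vol ρ σ S = ∫ t in S, corr ρ 0 1 t * σ 0 t * σ 1 t := by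
  simp [vol, corr]

lemma qvol_eq (i : Fin 2) (S : Set ℝ) : qvol σ i S = ∫ t in S, corr ρ i i t * σ i t * σ i t := by
  simp [qvol, corr, sq]

lemma covariation_eq : covariation T ρ σ = vol ρ σ (Set.Ioc 0 T) :=
  intervalIntegral.integral_of_le T.2

namespace Partition

variable (π : Partition T)

lemma monotone_pt : Monotone π.pt := by
  refine monotone_nat_of_le_succ fun k => ?_
  by_cases hk : k < π.card
  · exact (π.pt_lt k hk).le
  · rw [π.pt_eq k (not_lt.1 hk), π.pt_eq (k + 1) (by omega)]

lemma pt_le (k : ℕ) : π.pt k ≤ T :=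
  (π.monotone_pt (le_max_left k π.card)).trans_eq (π.pt_eq _ (le_max_right _ _))

lemma monotone_coe_pt : Monotone fun k => (π.pt k : ℝ) := fun _ _ h => π.monotone_pt h

lemma interval_subset (k : ℕ) : π.interval k ⊆ Set.Ioc (0 : ℝ) T :=
  Set.Ioc_subset_Ioc (π.pt k).2 (π.pt_le (k + 1))

lemma pairwise_disjoint_interval : Pairwise (Function.onFun Disjoint π.interval) := by
  have h := π.monotone_coe_pt.pairwise_disjoint_on_Ioc_succ
  exact h

lemma biUnion_interval : ⋃ k ∈ Finset.range π.card, π.interval k = Set.Ioc (0 : ℝ) T := by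
  have h := π.monotone_coe_pt.biUnion_Ico_Ioc_map_succ 0 π.card
  rw [π.pt_zero, π.pt_eq _ le_rfl] at h
  rw [← NNReal.coe_zero, ← h]
  ext u
  simp [interval]

lemma measurableSet_interval (k : ℕ) : MeasurableSet (π.interval k) := measurableSet_Ioc

lemma sum_setIntegral {f : ℝ → ℝ} (hf : IntegrableOn f (Set.Ioc (0 : ℝ) T)) {S : Set ℝ}
    (hS : MeasurableSet S) :
    ∑ k ∈ Finset.range π.card, ∫ t in S ∩ π.interval k, f t =
      ∫ t in S ∩ Set.Ioc (0 : ℝ) T, f t := by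
  rw [← π.biUnion_interval, Set.inter_iUnion₂, integral_biUnion_finset]
  · exact fun k _ => hS.inter (π.measurableSet_interval k)
  · intro i _ j _ hij
    exact (π.pairwise_disjoint_interval hij).mono Set.inter_subset_right Set.inter_subset_right
  · exact fun k _ => hf.mono_set (Set.inter_subset_right.trans (π.interval_subset k))

lemma length_le_mesh {k : ℕ} (hk : k < π.card) : (π.pt (k + 1) : ℝ) - π.pt k ≤ π.mesh := by
  have h : π.pt (k + 1) - π.pt k ≤ π.mesh :=
    Finset.le_sup (f := fun k => π.pt (k + 1) - π.pt k) (Finset.mem_range.2 hk)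
  have h' := NNReal.coe_le_coe.2 h
  rwa [NNReal.coe_sub (π.monotone_pt k.le_succ)] at h'

lemma mesh_le : π.mesh ≤ T :=
  Finset.sup_le fun k _ => tsub_le_self.trans (π.pt_le (k + 1))

lemma sum_length : ∑ k ∈ Finset.range π.card, volume.real (π.interval k) = T := by
  have h : ∀ k, volume.real (π.interval k) = (π.pt (k + 1) : ℝ) - π.pt k := fun k => by
    exact Real.volume_real_Ioc_of_le (π.monotone_coe_pt k.le_succ)
  simp only [h]
  rw [Finset.sum_range_sub (fun k => (π.pt k : ℝ)), π.pt_eq _ le_rfl, π.pt_zero]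
  simp

end Partition

variable (π : Partition T × Partition T)

/-- The relation of overlapping intervals. -/
def overlapRel (i : Fin π.1.card) (j : Fin π.2.card) : Prop :=
  (π.1.interval i ∩ π.2.interval j).Nonempty

/-- Take `u` in the first overlap and `u'` in the second. From `i < i'` follows `u < u'`, whereas
`j' < j` would give `u' < u`. -/
lemma isStaircase_overlapRel : IsStaircase (overlapRel π) := by
  intro i j i' j' ⟨u, hu1, hu2⟩ ⟨u', hu1', hu2'⟩ hi
  by_contra! hj
  have h1 : (π.1.pt (i + 1) : ℝ) ≤ π.1.pt i' := π.1.monotone_coe_pt (by omega)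
  have h2 : (π.2.pt (j' + 1) : ℝ) ≤ π.2.pt j := π.2.monotone_coe_pt (by omega)
  have := hu1.2
  have := hu1'.1
  have := hu2.1
  have := hu2'.2
  linarith

lemma overlap_eq_indMatrix (i : Fin π.1.card) (j : Fin π.2.card) :
    overlap (π.1.interval i) (π.2.interval j) = indMatrix (overlapRel π) i j := by
  unfold overlap indMatrix overlapRel
  rfl

/-- The quadratic variation of the first component over the intervals of the first partition. -/
def rowVar (σ : Fin 2 → ℝ → ℝ) (i : Fin π.1.card) : ℝ := qvol σ 0 (π.1.interval i)

/-- The quadratic variation of the second component over the intervals of the second partition. -/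
def colVar (σ : Fin 2 → ℝ → ℝ) (j : Fin π.2.card) : ℝ := qvol σ 1 (π.2.interval j)

/-- The covariation over the intersections of intervals. -/
def crossCov (ρ : ℝ → ℝ) (σ : Fin 2 → ℝ → ℝ) (i : Fin π.1.card) (j : Fin π.2.card) : ℝ :=
  vol ρ σ (π.1.interval i ∩ π.2.interval j)

lemma overlapRel_of_crossCov_ne_zero (i : Fin π.1.card) (j : Fin π.2.card)
    (h : crossCov π ρ σ i j ≠ 0) : overlapRel π i j := by
  by_contra hR
  rw [overlapRel, Set.not_nonempty_iff_eq_empty] at hR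
  exact h (by simp [crossCov, hR, vol])

lemma AdmissibleCoeff.rowSum_crossCov (h : AdmissibleCoeff T ρ σ s) (i : Fin π.1.card) :
    rowSum (crossCov π ρ σ) i = vol ρ σ (π.1.interval i) := by
  have := π.2.sum_setIntegral (h.integrableOn 0 1) (π.1.measurableSet_interval i)
  rw [Set.inter_eq_self_of_subset_left (π.1.interval_subset i), Finset.sum_range] at this
  simp only [rowSum, crossCov, vol_eq, this]

lemma AdmissibleCoeff.colSum_crossCov (h : AdmissibleCoeff T ρ σ s) (j : Fin π.2.card) :
    colSum (crossCov π ρ σ) j = vol ρ σ (π.2.interval j) := by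
  have := π.1.sum_setIntegral (h.integrableOn 0 1) (π.2.measurableSet_interval j)
  rw [Set.inter_eq_self_of_subset_left (π.2.interval_subset j), Finset.sum_range] at this
  simp only [colSum, crossCov, vol_eq, Set.inter_comm (π.1.interval _), this]

lemma AdmissibleCoeff.sum_crossCov (h : AdmissibleCoeff T ρ σ s) :
    ∑ i, ∑ j, crossCov π ρ σ i j = covariation T ρ σ := by
  have h1 : ∀ i, ∑ j, crossCov π ρ σ i j = vol ρ σ (π.1.interval i) := h.rowSum_crossCov π
  have := π.1.sum_setIntegral (h.integrableOn 0 1) MeasurableSet.univ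
  simp only [Set.univ_inter] at this
  rw [Finset.sum_range] at this
  simp only [h1, vol_eq, this, covariation_eq]

/-- Identifies the cross sum produced by `IsStaircase.trace_mixed` with `v(I ∪ J)`. -/
lemma AdmissibleCoeff.vol_union (h : AdmissibleCoeff T ρ σ s) (i : Fin π.1.card)
    (j : Fin π.2.card) : vol ρ σ (π.1.interval i ∪ π.2.interval j) =
      rowSum (crossCov π ρ σ) i + colSum (crossCov π ρ σ) j - crossCov π ρ σ i j := by
  rw [h.rowSum_crossCov, h.colSum_crossCov]
  have hi := (h.integrableOn 0 1).mono_set (π.1.interval_subset i)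
  have hj := (h.integrableOn 0 1).mono_set (π.2.interval_subset j)
  have e := integral_inter_add_sdiff (π.1.measurableSet_interval i) hj
  have e2 := setIntegral_union (μ := volume) (Set.disjoint_sdiff_right (s := π.1.interval i)
    (t := π.2.interval j)) ((π.2.measurableSet_interval j).diff (π.1.measurableSet_interval i))
    hi (hj.mono_set Set.sdiff_subset)
  rw [Set.union_sdiff_self] at e2
  simp only [crossCov, vol_eq]
  rw [Set.inter_comm (π.1.interval i)]
  linarith

lemma mu2_eq (h : AdmissibleCoeff T ρ σ s) : mu2 ρ σ π =
    1 / 2 * (∑ i, ∑ j, rowVar π σ i * colVar π σ j * indMatrix (overlapRel π) i j +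
      ∑ i, rowSum (crossCov π ρ σ) i ^ 2 + ∑ j, colSum (crossCov π ρ σ) j ^ 2 -
      ∑ i, ∑ j, crossCov π ρ σ i j ^ 2) := by
  simp only [mu2, sum₂, Partition.sum, Finset.sum_range, overlap_eq_indMatrix, h.rowSum_crossCov,
    h.colSum_crossCov]
  rfl

lemma mu3_eq (h : AdmissibleCoeff T ρ σ s) : mu3 ρ σ π =
    1 / 4 * (∑ i, rowSum (crossCov π ρ σ) i ^ 3 + ∑ j, colSum (crossCov π ρ σ) j ^ 3 +
      2 * ∑ i, ∑ j, crossCov π ρ σ i j ^ 3 +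
      3 * ∑ i, ∑ j, rowVar π σ i * colVar π σ j * (rowSum (crossCov π ρ σ) i +
        colSum (crossCov π ρ σ) j - crossCov π ρ σ i j) * indMatrix (overlapRel π) i j -
      3 * ∑ i, ∑ j, (crossCov π ρ σ i j ^ 2 * (rowSum (crossCov π ρ σ) i +
        colSum (crossCov π ρ σ) j) - crossCov π ρ σ i j * rowSum (crossCov π ρ σ) i *
        colSum (crossCov π ρ σ) j)) := by
  simp only [mu3, sum₂, Partition.sum, Finset.sum_range, overlap_eq_indMatrix, h.vol_union]
  simp only [h.rowSum_crossCov, h.colSum_crossCov]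
  rfl

/-- Strictness matters because the Schur bound divides by these variances. -/
lemma AdmissibleCoeff.qvol_pos (h : AdmissibleCoeff T ρ σ s) (l : Fin 2) (p : Partition T)
    {k : ℕ} (hk : k < p.card) : 0 < qvol σ l (p.interval k) := by
  have hsub := p.interval_subset k
  have hpos : ∀ t ∈ p.interval k, 0 < σ l t ^ 2 := fun t ht =>
    pow_pos (h.pos l t ⟨(hsub ht).1.le, (hsub ht).2⟩) 2
  have hint : IntegrableOn (fun t => σ l t ^ 2) (p.interval k) := by
    have := (h.integrableOn l l).mono_set hsub
    simpa [corr, sq] using this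
  rw [qvol, setIntegral_pos_iff_support_of_nonneg_ae _ hint]
  · have : p.interval k ⊆ Function.support fun t => σ l t ^ 2 := fun t ht => (hpos t ht).ne'
    rw [Set.inter_eq_self_of_subset_right this, Partition.interval, Real.volume_Ioc]
    simpa using p.pt_lt k hk
  · filter_upwards [ae_restrict_mem (p.measurableSet_interval k)] with t ht
    exact (hpos t ht).le

/-- Intervals of length at most `D` meeting `(x, y]` lie in `(x - D, y + D]`, whose length is at
most `3D`. They are disjoint, so their variances add up to at most `s² · 3D`. -/
lemma AdmissibleCoeff.sum_qvol_mul_overlap_le (h : AdmissibleCoeff T ρ σ s) (l : Fin 2)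
    (p : Partition T) {D : ℝ} (hp : (p.mesh : ℝ) ≤ D) {x y : ℝ} (hxy : x ≤ y) (hyx : y - x ≤ D) :
    ∑ k ∈ Finset.range p.card, qvol σ l (p.interval k) * overlap (p.interval k) (Set.Ioc x y) ≤
      3 * s ^ 2 * D := by
  set E := Set.Ioc (x - D) (y + D) with hE
  have hf := h.integrableOn l l
  have hnn : ∀ t ∈ Set.Ioc (0 : ℝ) T, 0 ≤ corr ρ l l t * σ l t * σ l t := fun t _ => by
    simp only [corr, if_true, one_mul]; exact mul_self_nonneg _
  have h1 : ∀ k ∈ Finset.range p.card,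
      qvol σ l (p.interval k) * overlap (p.interval k) (Set.Ioc x y) ≤
        ∫ t in E ∩ p.interval k, corr ρ l l t * σ l t * σ l t := by
    intro k hk
    unfold overlap
    split_ifs with hn
    · obtain ⟨u, hu1, hu2⟩ := hn
      have hlen := p.length_le_mesh (Finset.mem_range.1 hk)
      have : p.interval k ⊆ E := by
        intro t ht
        have a1 := hu1.1
        have a2 := hu1.2
        have a3 := ht.1
        have a4 := ht.2
        have a5 := hu2.1
        have a6 := hu2.2
        constructor <;> linarith
      rw [mul_one, Set.inter_eq_self_of_subset_right this, qvol_eq (ρ := ρ)]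
    · rw [mul_zero]
      exact setIntegral_nonneg (measurableSet_Ioc.inter (p.measurableSet_interval k))
        fun t ht => hnn t (p.interval_subset k ht.2)
  refine (Finset.sum_le_sum h1).trans ?_
  rw [p.sum_setIntegral hf measurableSet_Ioc]
  refine (le_abs_self _).trans ((h.abs_setIntegral_le l l Set.inter_subset_right).trans ?_)
  have h2 : volume.real (E ∩ Set.Ioc (0 : ℝ) T) ≤ volume.real E :=
    measureReal_mono Set.inter_subset_left (by simp [hE])
  have hD : 0 ≤ D := p.mesh.2.trans hp
  have h3 : volume.real E = y + D - (x - D) := Real.volume_real_Ioc_of_le (by linarith)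
  have h4 : volume.real (E ∩ Set.Ioc (0 : ℝ) T) ≤ 3 * D := by linarith
  calc _ ≤ s ^ 2 * (3 * D) := mul_le_mul_of_nonneg_left h4 (sq_nonneg s)
    _ = _ := by ring

lemma mesh_nonneg : 0 ≤ mesh π := NNReal.coe_nonneg _

lemma mesh_le : mesh π ≤ T := NNReal.coe_le_coe.2 (max_le π.1.mesh_le π.2.mesh_le)

lemma fst_mesh_le : (π.1.mesh : ℝ) ≤ mesh π := NNReal.coe_le_coe.2 (le_max_left _ _)

lemma snd_mesh_le : (π.2.mesh : ℝ) ≤ mesh π := NNReal.coe_le_coe.2 (le_max_right _ _)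

lemma overlap_comm (I J : Set ℝ) : overlap I J = overlap J I := by
  rw [overlap, overlap, Set.inter_comm I J]

lemma AdmissibleCoeff.sum_rowVar_le (h : AdmissibleCoeff T ρ σ s) (j : Fin π.2.card) :
    ∑ i, rowVar π σ i * indMatrix (overlapRel π) i j ≤ 3 * s ^ 2 * mesh π := by
  have := h.sum_qvol_mul_overlap_le 0 π.1 (fst_mesh_le π)
    (π.2.monotone_coe_pt (j : ℕ).le_succ) ((π.2.length_le_mesh j.2).trans (snd_mesh_le π))
  rw [Finset.sum_range] at this
  simp only [← overlap_eq_indMatrix]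
  exact this

lemma AdmissibleCoeff.sum_colVar_le (h : AdmissibleCoeff T ρ σ s) (i : Fin π.1.card) :
    ∑ j, colVar π σ j * indMatrix (overlapRel π) i j ≤ 3 * s ^ 2 * mesh π := by
  have := h.sum_qvol_mul_overlap_le 1 π.2 (snd_mesh_le π)
    (π.1.monotone_coe_pt (i : ℕ).le_succ) ((π.1.length_le_mesh i.2).trans (fst_mesh_le π))
  rw [Finset.sum_range] at this
  simp only [← overlap_eq_indMatrix, overlap_comm (π.1.interval _)]
  exact this

lemma AdmissibleCoeff.abs_vol_le (h : AdmissibleCoeff T ρ σ s) {S : Set ℝ}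
    (hS : S ⊆ Set.Ioc (0 : ℝ) T) : |vol ρ σ S| ≤ s ^ 2 * volume.real S := by
  rw [vol_eq]; exact h.abs_setIntegral_le 0 1 hS

lemma AdmissibleCoeff.sum_vol_sq_le (h : AdmissibleCoeff T ρ σ s) (p : Partition T) :
    ∑ k ∈ Finset.range p.card, vol ρ σ (p.interval k) ^ 2 ≤ s ^ 4 * T ^ 2 := by
  have h1 : ∀ k ∈ Finset.range p.card, vol ρ σ (p.interval k) ^ 2 ≤
      s ^ 4 * T * volume.real (p.interval k) := by
    intro k _
    have h2 := h.abs_vol_le (p.interval_subset k)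
    have h3 : volume.real (p.interval k) ≤ T := by
      calc _ ≤ volume.real (Set.Ioc (0 : ℝ) T) := measureReal_mono (p.interval_subset k) (by simp)
        _ = T := by simp
    have h4 : 0 ≤ volume.real (p.interval k) := measureReal_nonneg
    rw [← sq_abs]
    calc _ ≤ (s ^ 2 * volume.real (p.interval k)) ^ 2 := by gcongr
      _ = s ^ 4 * volume.real (p.interval k) * volume.real (p.interval k) := by ring
      _ ≤ _ := by gcongr
  refine (Finset.sum_le_sum h1).trans ?_
  rw [← Finset.mul_sum, p.sum_length]
  exact le_of_eq (by ring)

/-- A crude bound valid for every pair of partitions, with the mesh replaced by `T`; it controls the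
exceptional event. The `5` is `3 + 1 + 1`. -/
lemma AdmissibleCoeff.mu2_le (h : AdmissibleCoeff T ρ σ s) : mu2 ρ σ π ≤ 5 * s ^ 4 * T ^ 2 := by
  have hs := h.bound_pos
  have h1 : sum₂ π (fun I J => qvol σ 0 I * qvol σ 1 J * overlap I J) ≤ 3 * s ^ 4 * T ^ 2 := by
    have h2 : ∀ i ∈ Finset.range π.1.card, ∑ j ∈ Finset.range π.2.card,
        qvol σ 0 (π.1.interval i) * qvol σ 1 (π.2.interval j) *
          overlap (π.1.interval i) (π.2.interval j) ≤
        s ^ 2 * volume.real (π.1.interval i) * (3 * s ^ 2 * T) := by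
      intro i hi
      have h3 := h.sum_qvol_mul_overlap_le 1 π.2 ((snd_mesh_le π).trans (mesh_le π))
        (π.1.monotone_coe_pt i.le_succ) ((π.1.length_le_mesh (Finset.mem_range.1 hi)).trans
          ((fst_mesh_le π).trans (mesh_le π)))
      simp only [mul_assoc (qvol σ 0 (π.1.interval i)), ← Finset.mul_sum]
      have h4 : qvol σ 0 (π.1.interval i) ≤ s ^ 2 * volume.real (π.1.interval i) := by
        rw [qvol_eq (ρ := ρ)]
        exact (le_abs_self _).trans (h.abs_setIntegral_le 0 0 (π.1.interval_subset i))
      have h5 := (h.qvol_pos 0 π.1 (Finset.mem_range.1 hi)).le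
      simp only [overlap_comm (π.1.interval _)]
      exact (mul_le_mul_of_nonneg_left h3 h5).trans (mul_le_mul_of_nonneg_right h4 (by positivity))
    refine (Finset.sum_le_sum h2).trans ?_
    rw [← Finset.sum_mul, ← Finset.mul_sum, π.1.sum_length]
    exact le_of_eq (by ring)
  have h2 := h.sum_vol_sq_le π.1
  have h3 := h.sum_vol_sq_le π.2
  have h4 : 0 ≤ sum₂ π (fun I J => vol ρ σ (I ∩ J) ^ 2) :=
    Finset.sum_nonneg fun _ _ => Finset.sum_nonneg fun _ _ => sq_nonneg _
  have h5 : 0 ≤ s ^ 4 * T ^ 2 := by positivity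
  unfold mu2 Partition.sum
  linarith

end Geometry

end

end HYExpansion

/-! ### Law of the increments and of the estimation error for fixed partitions. -/

namespace HYExpansion

noncomputable section

section Increments

open Matrix

variable {Ω : Type*} [MeasurableSpace Ω] {P : Measure Ω} {T : ℝ≥0} {ρ : ℝ → ℝ}
  {σ : Fin 2 → ℝ → ℝ} {s : ℝ} {B X : Fin 2 → ℝ≥0 → Ω → ℝ}

lemma AdmissibleCoeff.memLp_indicator (h : AdmissibleCoeff T ρ σ s) (i : Fin 2) (x : ℝ≥0)
    {y : ℝ≥0} (hy : y ≤ T) :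
    MemLp ((Set.Ioc (x : ℝ) y).indicator (σ i)) 2 posVolume := by
  have h1 : MemLp ((Set.Ioc (x : ℝ) y).indicator fun _ => s) 2 volume :=
    memLp_indicator_const 2 measurableSet_Ioc s (Or.inr (by simp))
  refine (h1.restrict _).of_le
    ((h.measurable_sigma i).indicator measurableSet_Ioc).aestronglyMeasurable
    (ae_of_all _ fun u => ?_)
  by_cases hu : u ∈ Set.Ioc (x : ℝ) y
  · have hu' : u ∈ Set.Icc (0 : ℝ) T :=
      ⟨x.2.trans hu.1.le, hu.2.trans (NNReal.coe_le_coe.2 hy)⟩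
    simp only [Set.indicator_of_mem hu, Real.norm_eq_abs]
    rw [abs_of_pos (h.pos i u hu')]
    exact (h.le i u hu').trans (le_abs_self s)
  · simp [hu]

lemma integral_corr_mul_indicator (i j : Fin 2) (x y x' y' : ℝ≥0) :
    ∫ u, (corr ρ i j u * (Set.Ioc (x : ℝ) y).indicator (σ i) u) *
      (Set.Ioc (x' : ℝ) y').indicator (σ j) u ∂posVolume =
    ∫ u in Set.Ioc (x : ℝ) y ∩ Set.Ioc (x' : ℝ) y', corr ρ i j u * σ i u * σ j u := by
  rw [posVolume, ← integral_indicator measurableSet_Ioi,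
    ← integral_indicator (measurableSet_Ioc.inter measurableSet_Ioc)]
  congr 1 with u
  by_cases h1 : u ∈ Set.Ioc (x : ℝ) y <;> by_cases h2 : u ∈ Set.Ioc (x' : ℝ) y'
  · have h3 : u ∈ Set.Ioi (0 : ℝ) := lt_of_le_of_lt x.2 h1.1
    rw [Set.indicator_of_mem h3, Set.indicator_of_mem h1, Set.indicator_of_mem h2,
      Set.indicator_of_mem (Set.mem_inter h1 h2)]
  all_goals
    rw [Set.indicator_of_notMem (s := Set.Ioc (x : ℝ) y ∩ Set.Ioc (x' : ℝ) y')
      (fun h => by first | exact h1 h.1 | exact h2 h.2)]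
    by_cases h3 : u ∈ Set.Ioi (0 : ℝ) <;>
      simp only [Set.indicator_of_mem, Set.indicator_of_notMem, h1, h2, h3, not_false_eq_true,
        mul_zero, zero_mul]

lemma IsDriftlessDiffusion.isWienerLimit (hB : IsCorrelatedBrownian P ρ B)
    (hX : IsDriftlessDiffusion P T σ B X) (h : AdmissibleCoeff T ρ σ s) (i : Fin 2) {x y : ℝ≥0}
    (hxy : x ≤ y) (hy : y ≤ T) :
    IsWienerLimit P (B i) ((Set.Ioc (x : ℝ) y).indicator (σ i)) (X i y - X i x) := by
  have hm : ∀ t ≤ T, Measurable (fun ω => X i t ω - X i 0 ω) := fun t ht =>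
    (hX.measurable i t ht).sub (hX.measurable i 0 zero_le)
  have h1 := (hX.integral_eq i y hy).isWienerLimit
  have h2 := (hX.integral_eq i x (hxy.trans hy)).isWienerLimit
  have h3 := hB.isWienerLimit_sub ((h.measurable_sigma i).indicator measurableSet_Ioc)
    ((h.measurable_sigma i).indicator measurableSet_Ioc) (hm y hy) (hm x (hxy.trans hy)) h1 h2
  convert! h3 using 1
  · funext u
    have hx : (x : ℝ) ≤ y := NNReal.coe_le_coe.2 hxy
    have hx0 : (0 : ℝ) ≤ x := x.2
    simp only [Pi.sub_apply, Set.indicator_apply, Set.mem_Ioc]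
    by_cases a : 0 < u <;> by_cases b : u ≤ x <;> by_cases c : u ≤ y <;>
      by_cases d : (x : ℝ) < u <;> simp only [a, b, c, d, and_self, and_true, and_false,
        if_true, if_false, sub_self, sub_zero] <;> exfalso <;> linarith
  · funext ω; simp

/-- Increments over the intervals of the two partitions. -/
def increments (π : Partition T × Partition T) (x : Fin 2 → ℝ≥0 → ℝ) :
    Fin π.1.card ⊕ Fin π.2.card → ℝ :=
  Sum.elim (fun i => x 0 (π.1.pt (i + 1)) - x 0 (π.1.pt i))
    (fun j => x 1 (π.2.pt (j + 1)) - x 1 (π.2.pt j))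

variable (π : Partition T × Partition T)

/-- The covariance matrix of the increments. -/
def incrementCov (ρ : ℝ → ℝ) (σ : Fin 2 → ℝ → ℝ) :
    Matrix (Fin π.1.card ⊕ Fin π.2.card) (Fin π.1.card ⊕ Fin π.2.card) ℝ :=
  bipartiteCov (rowVar π σ) (colVar π σ) (crossCov π ρ σ)

/-- One formula for all four blocks, matching the output of the isometry. The zeros off the diagonal
of the diagonal blocks come from the disjointness of the intervals of one partition. -/
lemma incrementCov_apply (p q : Fin π.1.card ⊕ Fin π.2.card) :
    incrementCov π ρ σ p q =
      ∫ u in Sum.elim (fun i : Fin π.1.card => π.1.interval i)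
          (fun j : Fin π.2.card => π.2.interval j) p ∩
        Sum.elim (fun i : Fin π.1.card => π.1.interval i)
          (fun j : Fin π.2.card => π.2.interval j) q,
        corr ρ (Sum.elim (fun _ => 0) (fun _ => 1) p) (Sum.elim (fun _ => 0) (fun _ => 1) q) u *
          σ (Sum.elim (fun _ => 0) (fun _ => 1) p) u *
          σ (Sum.elim (fun _ => 0) (fun _ => 1) q) u := by
  have hdisj : ∀ (p : Partition T) {k k' : ℕ}, k ≠ k' → p.interval k ∩ p.interval k' = ∅ :=
    fun p k k' hk => Set.disjoint_iff_inter_eq_empty.1 (p.pairwise_disjoint_interval hk)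
  rcases p with i | j <;> rcases q with i' | j'
  · by_cases hi : i = i'
    · subst hi
      simp [incrementCov, bipartiteCov, rowVar, qvol_eq (ρ := ρ)]
    · have : (i : ℕ) ≠ i' := fun h => hi (Fin.ext h)
      simp [incrementCov, bipartiteCov, hdisj π.1 this, hi]
  · simp [incrementCov, bipartiteCov, crossCov, vol_eq]
  · simp only [incrementCov, bipartiteCov, fromBlocks_apply₂₁, transpose_apply, of_apply, crossCov,
      vol_eq, Sum.elim_inl, Sum.elim_inr]
    rw [Set.inter_comm, corr_comm]
    congr 1 with u
    ring
  · by_cases hi : j = j'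
    · subst hi
      simp [incrementCov, bipartiteCov, colVar, qvol_eq (ρ := ρ)]
    · have : (j : ℕ) ≠ j' := fun h => hi (Fin.ext h)
      simp [incrementCov, bipartiteCov, hdisj π.2 this, hi]

lemma IsDriftlessDiffusion.measurable_increments (hX : IsDriftlessDiffusion P T σ B X) :
    Measurable fun ω => increments π fun i t => X i t ω := by
  refine measurable_pi_lambda _ fun p => ?_
  rcases p with i | j
  · exact (hX.measurable 0 _ (π.1.pt_le _)).sub (hX.measurable 0 _ (π.1.pt_le _))
  · exact (hX.measurable 1 _ (π.2.pt_le _)).sub (hX.measurable 1 _ (π.2.pt_le _))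

lemma IsDriftlessDiffusion.integral_cexp_increments [IsProbabilityMeasure P]
    (hB : IsCorrelatedBrownian P ρ B) (hX : IsDriftlessDiffusion P T σ B X)
    (h : AdmissibleCoeff T ρ σ s) (t : Fin π.1.card ⊕ Fin π.2.card → ℝ) :
    ∫ ω, Complex.exp (((t ⬝ᵥ (increments π fun i t => X i t ω) : ℝ) : ℂ) * Complex.I) ∂P =
      Complex.exp (-((t ⬝ᵥ (incrementCov π ρ σ *ᵥ t) / 2 : ℝ) : ℂ)) := by
  set κ : Fin π.1.card ⊕ Fin π.2.card → Fin 2 := Sum.elim (fun _ => 0) (fun _ => 1) with hκ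
  set lo : Fin π.1.card ⊕ Fin π.2.card → ℝ≥0 :=
    Sum.elim (fun i => π.1.pt i) (fun j => π.2.pt j) with hlo
  set hi : Fin π.1.card ⊕ Fin π.2.card → ℝ≥0 :=
    Sum.elim (fun i => π.1.pt (i + 1)) (fun j => π.2.pt (j + 1)) with hhi
  have hle : ∀ p, lo p ≤ hi p := by
    rintro (i | j)
    · exact π.1.monotone_pt (i : ℕ).le_succ
    · exact π.2.monotone_pt (j : ℕ).le_succ
  have hT : ∀ p, hi p ≤ T := by
    rintro (i | j)
    · exact π.1.pt_le _
    · exact π.2.pt_le _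
  have hinc : ∀ ω p, increments π (fun i t => X i t ω) p = (X (κ p) (hi p) - X (κ p) (lo p)) ω := by
    rintro ω (i | j) <;> rfl
  have key := hB.integral_cexp_sum h.measurable_rho h.rho_mem t κ
    (G := fun p => (Set.Ioc (lo p : ℝ) (hi p)).indicator (σ (κ p)))
    (Y := fun p => X (κ p) (hi p) - X (κ p) (lo p))
    (fun p => h.memLp_indicator _ _ (hT p))
    (fun p => (hX.measurable _ _ (hT p)).sub (hX.measurable _ _ ((hle p).trans (hT p))))
    (fun p => hX.isWienerLimit hB h _ (hle p) (hT p))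
  have hcov : ∀ p q, ∫ u in Set.Ioc (lo p : ℝ) (hi p) ∩ Set.Ioc (lo q : ℝ) (hi q),
      corr ρ (κ p) (κ q) u * σ (κ p) u * σ (κ q) u = incrementCov π ρ σ p q := by
    intro p q
    rw [incrementCov_apply]
    rcases p with i | j <;> rcases q with i' | j' <;> rfl
  simp only [integral_corr_mul_indicator, hcov] at key
  simp only [dotProduct, hinc, mulVec, Finset.mul_sum]
  rw [key]
  congr 4
  exact Finset.sum_congr rfl fun _ _ => Finset.sum_congr rfl fun _ _ => by ring

/-- A characteristic function has modulus at most `1`, so `exp(-q/2) ≤ 1` for the value `q` of the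
quadratic form, and hence `q ≥ 0`. -/
lemma IsDriftlessDiffusion.posSemidef_incrementCov [IsProbabilityMeasure P]
    (hB : IsCorrelatedBrownian P ρ B) (hX : IsDriftlessDiffusion P T σ B X)
    (h : AdmissibleCoeff T ρ σ s) : (incrementCov π ρ σ).PosSemidef := by
  refine Matrix.PosSemidef.of_dotProduct_mulVec_nonneg ?_ fun t => ?_
  · rw [Matrix.IsHermitian, conjTranspose_eq_transpose_of_trivial, incrementCov, bipartiteCov,
      fromBlocks_transpose, diagonal_transpose, diagonal_transpose, transpose_transpose]
  · rw [star_trivial]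
    by_contra! hneg
    have h1 := hX.integral_cexp_increments π hB h t
    have h2 : ‖∫ ω, Complex.exp (((t ⬝ᵥ (increments π fun i t => X i t ω) : ℝ) : ℂ) *
        Complex.I) ∂P‖ ≤ 1 := by
      refine (norm_integral_le_of_norm_le_const (C := 1) (ae_of_all _ fun ω => ?_)).trans (by simp)
      rw [Complex.norm_exp_ofReal_mul_I]
    rw [h1, ← Complex.ofReal_neg, Complex.norm_exp_ofReal, Real.exp_le_one_iff] at h2
    linarith

lemma hyEstimator_eq (x : Fin 2 → ℝ≥0 → ℝ) : hyEstimator π x =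
    ∑ i, ∑ j, increments π x (.inl i) * increments π x (.inr j) *
      indMatrix (overlapRel π) i j := by
  simp only [hyEstimator, Finset.sum_range, overlap_eq_indMatrix]
  rfl

/-- For a fixed pair of partitions, the estimation error has a centred weighted chi-square law
whose second and third power sums are `μ₂` and `μ₃`. -/
theorem IsDriftlessDiffusion.exists_map_eq_chiSqLaw [IsProbabilityMeasure P]
    (hB : IsCorrelatedBrownian P ρ B) (hX : IsDriftlessDiffusion P T σ B X)
    (h : AdmissibleCoeff T ρ σ s) :
    ∃ d : Fin π.1.card ⊕ Fin π.2.card → ℝ,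
      P.map (fun ω => hyEstimator π (fun i t => X i t ω) - covariation T ρ σ) = chiSqLaw d ∧
      ∑ k, d k ^ 2 = mu2 ρ σ π ∧ ∑ k, d k ^ 3 = mu3 ρ σ π ∧
      ∀ k, |d k| ≤ 3 * s ^ 2 * mesh π := by
  have hs : 0 ≤ 3 * s ^ 2 * mesh π := mul_nonneg (by positivity) (mesh_nonneg π)
  obtain ⟨d, h1, h2, h3, h4⟩ := exists_map_bilinear_eq_chiSqLaw P (isStaircase_overlapRel π)
    (overlapRel_of_crossCov_ne_zero π) (fun i => h.qvol_pos 0 π.1 i.2)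
    (fun j => h.qvol_pos 1 π.2 j.2) hs (h.sum_rowVar_le π) (h.sum_colVar_le π)
    (hX.measurable_increments π) (hX.posSemidef_incrementCov π hB h)
    (hX.integral_cexp_increments π hB h)
  refine ⟨d, ?_, h2.trans (mu2_eq π h).symm, h3.trans (mu3_eq π h).symm, h4⟩
  simp only [hyEstimator_eq]
  rw [h.sum_crossCov] at h1
  exact h1

end Increments

end

end HYExpansion

/-! ### Measurability in the partitions. -/

namespace HYExpansion

noncomputable section

section Measurability

variable {T : ℝ≥0} {ρ : ℝ → ℝ} {σ : Fin 2 → ℝ → ℝ}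

lemma measurable_sum_range_of_measurable {α : Type*} [MeasurableSpace α] {N : α → ℕ}
    (hN : Measurable N) {F : ℕ → α → ℝ} (hF : ∀ k, Measurable (F k)) :
    Measurable fun x => ∑ k ∈ Finset.range (N x), F k x := by
  have h : Measurable fun p : ℕ × α => ∑ k ∈ Finset.range p.1, F k p.2 :=
    measurable_from_prod_countable_right fun n =>
      Finset.measurable_fun_sum (Finset.range n) fun k _ => hF k
  exact h.comp (hN.prodMk measurable_id)

lemma measurable_setIntegral_of_measurableSet {α : Type*} [MeasurableSpace α] {S : α → Set ℝ}
    (hS : MeasurableSet {p : α × ℝ | p.2 ∈ S p.1}) {g : ℝ → ℝ} (hg : Measurable g) :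
    Measurable fun x => ∫ t in S x, g t := by
  have h1 : ∀ x, MeasurableSet (S x) := fun x => measurable_prodMk_left (x := x) hS
  have h2 : Measurable (Function.uncurry fun (x : α) (t : ℝ) => (S x).indicator g t) := by
    have : (Function.uncurry fun (x : α) (t : ℝ) => (S x).indicator g t) =
        {p : α × ℝ | p.2 ∈ S p.1}.indicator fun p => g p.2 := by
      funext p
      by_cases hp : p.2 ∈ S p.1 <;> simp [Function.uncurry, Set.indicator, hp]
    rw [this]
    exact (hg.comp measurable_snd).indicator hS
  have h3 := (h2.stronglyMeasurable.integral_prod_right (ν := (volume : Measure ℝ))).measurable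
  simpa only [integral_indicator (h1 _)] using h3

namespace Partition

lemma measurable_pt (k : ℕ) : Measurable fun π : Partition T => π.pt k :=
  (measurable_pi_apply k).comp (comap_measurable Partition.pt)

/-- The endpoints increase strictly until they reach `T`, so the number of intervals is a function
of the endpoints, which generate the σ-algebra. -/
lemma card_le_iff (π : Partition T) (k : ℕ) : π.card ≤ k ↔ π.pt k = T := by
  refine ⟨π.pt_eq k, fun h => ?_⟩
  by_contra! hk
  have h1 := π.pt_lt k hk
  rw [h] at h1
  exact absurd (π.pt_le (k + 1)) (not_le.2 h1)

lemma measurable_card : Measurable fun π : Partition T => π.card := by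
  refine measurable_of_Iic fun k => ?_
  have : (fun π : Partition T => π.card) ⁻¹' Set.Iic k = {π | π.pt k = T} := by
    ext π; exact π.card_le_iff k
  rw [this]
  exact measurable_pt k (measurableSet_singleton T)

lemma measurable_mesh : Measurable fun π : Partition T => π.mesh := by
  have h : ∀ n, Measurable fun π : Partition T =>
      (Finset.range n).sup fun k => π.pt (k + 1) - π.pt k := by
    intro n
    induction n with
    | zero => simp
    | succ n ih =>
      simp only [Finset.range_add_one, Finset.sup_insert]
      exact ((measurable_pt (n + 1)).sub (measurable_pt n)).sup ih
  have h' : Measurable fun p : ℕ × Partition T =>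
      (Finset.range p.1).sup fun k => p.2.pt (k + 1) - p.2.pt k :=
    measurable_from_prod_countable_right h
  exact h'.comp (measurable_card.prodMk measurable_id)

end Partition

lemma measurable_mesh : Measurable fun π : Partition T × Partition T => mesh π :=
  ((Partition.measurable_mesh.comp measurable_fst).max
    (Partition.measurable_mesh.comp measurable_snd)).coe_nnreal_real

/-- Families of intervals which depend measurably on the partitions. -/
def IsMeasurableFamily (S : Partition T × Partition T → Set ℝ) : Prop :=
  MeasurableSet {p : (Partition T × Partition T) × ℝ | p.2 ∈ S p.1}

lemma isMeasurableFamily_fst (k : ℕ) :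
    IsMeasurableFamily fun π : Partition T × Partition T => π.1.interval k := by
  have h : ∀ k, Measurable fun p : (Partition T × Partition T) × ℝ => (p.1.1.pt k : ℝ) := fun k =>
    ((Partition.measurable_pt k).comp (measurable_fst.comp measurable_fst)).coe_nnreal_real
  exact (measurableSet_lt (h k) measurable_snd).inter (measurableSet_le measurable_snd (h (k + 1)))

lemma isMeasurableFamily_snd (k : ℕ) :
    IsMeasurableFamily fun π : Partition T × Partition T => π.2.interval k := by
  have h : ∀ k, Measurable fun p : (Partition T × Partition T) × ℝ => (p.1.2.pt k : ℝ) := fun k =>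
    ((Partition.measurable_pt k).comp (measurable_snd.comp measurable_fst)).coe_nnreal_real
  exact (measurableSet_lt (h k) measurable_snd).inter (measurableSet_le measurable_snd (h (k + 1)))

variable {S S' : Partition T × Partition T → Set ℝ}

lemma IsMeasurableFamily.inter (h : IsMeasurableFamily S) (h' : IsMeasurableFamily S') :
    IsMeasurableFamily fun π => S π ∩ S' π := MeasurableSet.inter h h'

lemma IsMeasurableFamily.union (h : IsMeasurableFamily S) (h' : IsMeasurableFamily S') :
    IsMeasurableFamily fun π => S π ∪ S' π := MeasurableSet.union h h'

lemma IsMeasurableFamily.measurable_vol (h : IsMeasurableFamily S) (hσ : ∀ i, Measurable (σ i))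
    (hρ : Measurable ρ) : Measurable fun π => vol ρ σ (S π) :=
  measurable_setIntegral_of_measurableSet h ((hρ.mul (hσ 0)).mul (hσ 1))

lemma IsMeasurableFamily.measurable_qvol (h : IsMeasurableFamily S) (hσ : ∀ i, Measurable (σ i))
    (i : Fin 2) : Measurable fun π => qvol σ i (S π) :=
  measurable_setIntegral_of_measurableSet h ((hσ i).pow_const 2)

lemma measurable_overlap (i j : ℕ) : Measurable fun π : Partition T × Partition T =>
    overlap (π.1.interval i) (π.2.interval j) := by
  unfold overlap
  refine Measurable.ite ?_ measurable_const measurable_const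
  simp only [Partition.interval, Set.Ioc_inter_Ioc, Set.nonempty_Ioc]
  have h1 : ∀ k, Measurable fun π : Partition T × Partition T => (π.1.pt k : ℝ) := fun k =>
    ((Partition.measurable_pt k).comp measurable_fst).coe_nnreal_real
  have h2 : ∀ k, Measurable fun π : Partition T × Partition T => (π.2.pt k : ℝ) := fun k =>
    ((Partition.measurable_pt k).comp measurable_snd).coe_nnreal_real
  exact measurableSet_lt ((h1 i).sup (h2 j)) ((h1 (i + 1)).inf (h2 (j + 1)))

lemma measurable_sum_fst {F : Set ℝ → ℝ}
    (hF : ∀ i, Measurable fun π : Partition T × Partition T => F (π.1.interval i)) :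
    Measurable fun π : Partition T × Partition T => π.1.sum F :=
  measurable_sum_range_of_measurable (Partition.measurable_card.comp measurable_fst) hF

lemma measurable_sum_snd {F : Set ℝ → ℝ}
    (hF : ∀ i, Measurable fun π : Partition T × Partition T => F (π.2.interval i)) :
    Measurable fun π : Partition T × Partition T => π.2.sum F :=
  measurable_sum_range_of_measurable (Partition.measurable_card.comp measurable_snd) hF

lemma measurable_sum₂ {F : Set ℝ → Set ℝ → ℝ}
    (hF : ∀ i j, Measurable fun π : Partition T × Partition T =>
      F (π.1.interval i) (π.2.interval j)) :
    Measurable fun π : Partition T × Partition T => sum₂ π F :=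
  measurable_sum_range_of_measurable (Partition.measurable_card.comp measurable_fst) fun i =>
    measurable_sum_range_of_measurable (Partition.measurable_card.comp measurable_snd) fun j =>
      hF i j

lemma measurable_mu2 (hσ : ∀ i, Measurable (σ i)) (hρ : Measurable ρ) :
    Measurable fun π : Partition T × Partition T => mu2 ρ σ π := by
  have a := fun i => (isMeasurableFamily_fst (T := T) i)
  have b := fun i => (isMeasurableFamily_snd (T := T) i)
  refine Measurable.const_mul (Measurable.sub (Measurable.add (Measurable.add ?_ ?_) ?_) ?_) _
  · exact measurable_sum₂ fun i j => (((a i).measurable_qvol hσ 0).mul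
      ((b j).measurable_qvol hσ 1)).mul (measurable_overlap i j)
  · exact measurable_sum_fst (F := fun I => vol ρ σ I ^ 2) fun i =>
      ((a i).measurable_vol hσ hρ).pow_const 2
  · exact measurable_sum_snd (F := fun I => vol ρ σ I ^ 2) fun i =>
      ((b i).measurable_vol hσ hρ).pow_const 2
  · exact measurable_sum₂ (F := fun I J => vol ρ σ (I ∩ J) ^ 2) fun i j =>
      (((a i).inter (b j)).measurable_vol hσ hρ).pow_const 2

lemma measurable_mu3 (hσ : ∀ i, Measurable (σ i)) (hρ : Measurable ρ) :
    Measurable fun π : Partition T × Partition T => mu3 ρ σ π := by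
  have a := fun i => (isMeasurableFamily_fst (T := T) i)
  have b := fun i => (isMeasurableFamily_snd (T := T) i)
  have va := fun i => (a i).measurable_vol hσ hρ
  have vb := fun i => (b i).measurable_vol hσ hρ
  have vi := fun i j => ((a i).inter (b j)).measurable_vol hσ hρ
  have vu := fun i j => ((a i).union (b j)).measurable_vol hσ hρ
  refine Measurable.const_mul (Measurable.sub (Measurable.add (Measurable.add
    (Measurable.add ?_ ?_) (Measurable.const_mul ?_ _)) (Measurable.const_mul ?_ _))
    (Measurable.const_mul ?_ _)) _
  · exact measurable_sum_fst (F := fun I => vol ρ σ I ^ 3) fun i => (va i).pow_const 3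
  · exact measurable_sum_snd (F := fun I => vol ρ σ I ^ 3) fun i => (vb i).pow_const 3
  · exact measurable_sum₂ (F := fun I J => vol ρ σ (I ∩ J) ^ 3) fun i j => (vi i j).pow_const 3
  · exact measurable_sum₂ (F := fun I J => qvol σ 0 I * qvol σ 1 J * vol ρ σ (I ∪ J) *
      overlap I J) fun i j => ((((a i).measurable_qvol hσ 0).mul
      ((b j).measurable_qvol hσ 1)).mul (vu i j)).mul (measurable_overlap i j)
  · exact measurable_sum₂ (F := fun I J => vol ρ σ (I ∩ J) ^ 2 * (vol ρ σ I + vol ρ σ J) -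
      vol ρ σ (I ∩ J) * vol ρ σ I * vol ρ σ J) fun i j =>
      (((vi i j).pow_const 2).mul ((va i).add (vb j))).sub (((vi i j).mul (va i)).mul (vb j))

lemma measurable_lam2 (hσ : ∀ i, Measurable (σ i)) (hρ : Measurable ρ) (b : ℝ) :
    Measurable fun π : Partition T × Partition T => lam2 ρ σ b π :=
  (measurable_mu2 hσ hρ).const_mul _

lemma measurable_lam3 (hσ : ∀ i, Measurable (σ i)) (hρ : Measurable ρ) (b : ℝ) :
    Measurable fun π : Partition T × Partition T => lam3 ρ σ b π :=
  (measurable_mu3 hσ hρ).const_mul _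

end Measurability

/-! ### Separating the partitions from the path. -/

section Independence

variable {T : ℝ≥0} {ρ : ℝ → ℝ} {σ : Fin 2 → ℝ → ℝ}

/-- Discrete approximations of a time point in `[0, T]`. -/
def approxTime (T : ℝ≥0) (m k : ℕ) : Set.Iic T :=
  ⟨min ((k : ℝ≥0) / ((m : ℝ≥0) + 1)) T, Set.mem_Iic.2 (min_le_right _ _)⟩

lemma tendsto_approxTime {t : ℝ≥0} (ht : t ≤ T) :
    Tendsto (fun m : ℕ => (approxTime T m ⌊(t : ℝ) * ((m : ℝ) + 1)⌋₊ : ℝ≥0)) atTop (𝓝 t) := by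
  have h1 : Tendsto (fun m : ℕ => ((⌊(t : ℝ) * ((m : ℝ) + 1)⌋₊ : ℝ≥0) / ((m : ℝ≥0) + 1))) atTop
      (𝓝 t) := by
    rw [← NNReal.tendsto_coe]
    have h := (tendsto_nat_floor_mul_div_atTop (R := ℝ) t.2).comp
      (tendsto_atTop_add_const_right _ (1 : ℝ) tendsto_natCast_atTop_atTop)
    refine h.congr fun m => ?_
    simp
  have h2 := h1.min (tendsto_const_nhds (x := T))
  rw [min_eq_left ht] at h2
  exact h2

/-- The value at time `t` of a path known on `[0, T]`, as a measurable function. -/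
def pathEval (i : Fin 2) (y : Fin 2 × Set.Iic T → ℝ) (t : ℝ≥0) : ℝ :=
  limUnder atTop fun m : ℕ => y (i, approxTime T m ⌊(t : ℝ) * ((m : ℝ) + 1)⌋₊)

/-- Evaluation at a variable time need not be measurable for the product σ-algebra on all paths.
Taking limits along countably many grid times makes it so, and on continuous paths nothing is
changed. -/
lemma measurable_pathEval (i : Fin 2) :
    Measurable fun p : (Fin 2 × Set.Iic T → ℝ) × ℝ≥0 => pathEval i p.1 p.2 := by
  refine (StronglyMeasurable.limUnder fun m => Measurable.stronglyMeasurable ?_).measurable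
  have h1 : Measurable fun p : (Fin 2 × Set.Iic T → ℝ) × ℕ => p.1 (i, approxTime T m p.2) :=
    measurable_from_prod_countable_left fun k =>
      measurable_pi_apply (i, approxTime T m k)
  exact h1.comp (measurable_fst.prodMk
    (Nat.measurable_floor.comp (measurable_snd.coe_nnreal_real.mul_const _)))

lemma pathEval_eq {x : Fin 2 → ℝ≥0 → ℝ} (i : Fin 2) (hx : ContinuousOn (x i) (Set.Iic T))
    {t : ℝ≥0} (ht : t ≤ T) :
    pathEval i (fun p : Fin 2 × Set.Iic T => x p.1 p.2 - x p.1 0) t = x i t - x i 0 := by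
  refine Tendsto.limUnder_eq ?_
  refine Tendsto.sub_const ?_ _
  refine (hx t ht).tendsto.comp (tendsto_nhdsWithin_iff.2 ⟨tendsto_approxTime ht, ?_⟩)
  exact Eventually.of_forall fun m => (approxTime T m _).2

/-- The normalized error as a measurable function of the partitions and the path. -/
def pathError (ρ : ℝ → ℝ) (σ : Fin 2 → ℝ → ℝ) (b : ℝ)
    (p : (Partition T × Partition T) × (Fin 2 × Set.Iic T → ℝ)) : ℝ :=
  normError ρ σ b p.1 fun i t => pathEval i p.2 t

lemma measurable_pathError (b : ℝ) :
    Measurable fun p : (Partition T × Partition T) × (Fin 2 × Set.Iic T → ℝ) =>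
      pathError ρ σ b p := by
  refine Measurable.const_mul (Measurable.sub_const ?_ _) _
  have h1 : ∀ (i : Fin 2) (k : ℕ),
      Measurable fun p : (Partition T × Partition T) × (Fin 2 × Set.Iic T → ℝ) =>
        pathEval i p.2 (p.1.1.pt k) := fun i k =>
    (measurable_pathEval i).comp (measurable_snd.prodMk
      ((Partition.measurable_pt k).comp (measurable_fst.comp measurable_fst)))
  have h2 : ∀ (i : Fin 2) (k : ℕ),
      Measurable fun p : (Partition T × Partition T) × (Fin 2 × Set.Iic T → ℝ) =>
        pathEval i p.2 (p.1.2.pt k) := fun i k =>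
    (measurable_pathEval i).comp (measurable_snd.prodMk
      ((Partition.measurable_pt k).comp (measurable_snd.comp measurable_fst)))
  refine measurable_sum_range_of_measurable
    (Partition.measurable_card.comp (measurable_fst.comp measurable_fst)) fun i =>
    measurable_sum_range_of_measurable
      (Partition.measurable_card.comp (measurable_snd.comp measurable_fst)) fun j => ?_
  exact (((h1 0 (i + 1)).sub (h1 0 i)).mul ((h2 1 (j + 1)).sub (h2 1 j))).mul
    ((measurable_overlap i j).comp measurable_fst)

/-- The estimator involves only differences of path values, so subtracting the initial value changes
nothing. -/
lemma pathError_eq (b : ℝ) (π : Partition T × Partition T) {x : Fin 2 → ℝ≥0 → ℝ}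
    (hx : ∀ i, ContinuousOn (x i) (Set.Iic T)) :
    pathError ρ σ b (π, fun p => x p.1 p.2 - x p.1 0) = normError ρ σ b π x := by
  simp only [pathError, normError, hyEstimator, pathEval_eq _ (hx _) (Partition.pt_le _ _),
    sub_sub_sub_cancel_right]

variable {Ω : Type*} [MeasurableSpace Ω] {P : Measure Ω} [IsProbabilityMeasure P]
  {B X : Fin 2 → ℝ≥0 → Ω → ℝ}

/-- Partitions independent of the path may be sampled on a separate factor. -/
lemma IsDriftlessDiffusion.identDistrib_normError (hX : IsDriftlessDiffusion P T σ B X)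
    {Pi : Ω → Partition T × Partition T} (hPi : Measurable Pi)
    (hind : IndepFun Pi (fun ω (p : Fin 2 × Set.Iic T) => X p.1 p.2 ω - X p.1 0 ω) P) (b : ℝ) :
    IdentDistrib (fun ω => normError ρ σ b (Pi ω) fun i t => X i t ω)
      (fun p : Ω × Ω => normError ρ σ b (Pi p.1) fun i t => X i t p.2) P (P.prod P) := by
  set Y : Ω → (Fin 2 × Set.Iic T → ℝ) := fun ω p => X p.1 p.2 ω - X p.1 0 ω with hY
  have hYm : Measurable Y := measurable_pi_lambda _ fun p =>
    (hX.measurable p.1 _ p.2.2).sub (hX.measurable p.1 0 zero_le)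
  have h1 : IdentDistrib (fun ω => (Pi ω, Y ω)) (fun p : Ω × Ω => (Pi p.1, Y p.2)) P
      (P.prod P) := by
    refine ⟨(hPi.prodMk hYm).aemeasurable,
      ((hPi.comp measurable_fst).prodMk (hYm.comp measurable_snd)).aemeasurable, ?_⟩
    rw [(indepFun_iff_map_prod_eq_prod_map_map hPi.aemeasurable hYm.aemeasurable).1 hind,
      Measure.map_prod_map _ _ hPi hYm]
    rfl
  have h2 := h1.comp (measurable_pathError (ρ := ρ) (σ := σ) b)
  have e : ∀ (π : Partition T × Partition T) ω, pathError ρ σ b (π, Y ω) =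
      normError ρ σ b π fun i t => X i t ω := fun π ω =>
    pathError_eq b π (x := fun i t => X i t ω) fun i => hX.continuousOn i ω
  simpa only [Function.comp_def, e] using h2

end Independence

end

end HYExpansion

/-! ### Moment bounds and conditional expansion for fixed partitions. -/

namespace HYExpansion

noncomputable section

section FixedPartition

lemma map_const_mul_chiSqLaw {ι : Type*} [Fintype ι] (d : ι → ℝ) (r : ℝ) :
    (chiSqLaw d).map (fun z => r * z) = chiSqLaw fun k => r * d k := by
  rw [chiSqLaw, Measure.map_map (by fun_prop) (measurable_chiSqSum d), chiSqLaw]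
  congr 1
  funext g
  simp only [Function.comp_apply, Finset.mul_sum, mul_assoc]

lemma integrable_exp_abs_chiSqLaw {ι : Type*} [Fintype ι] (d : ι → ℝ) {t : ℝ}
    (ht : ∀ k, |t * d k| ≤ 1 / 4) :
    Integrable (fun z => Real.exp (t * |z|)) (chiSqLaw d) ∧
      ∫ z, Real.exp (t * |z|) ∂chiSqLaw d ≤ 2 * Real.exp (2 * t ^ 2 * ∑ k, d k ^ 2) := by
  have ht' : ∀ k, |-t * d k| ≤ 1 / 4 := fun k => by rw [neg_mul, abs_neg]; exact ht k
  have i1 := integrable_exp_chiSqLaw d (t := t) fun k => by linarith [(le_abs_self _).trans (ht k)]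
  have i2 := integrable_exp_chiSqLaw d (t := -t) fun k => by
    linarith [(le_abs_self _).trans (ht' k)]
  have h1 := integral_exp_chiSqLaw_le d ht
  have h2 := integral_exp_chiSqLaw_le d ht'
  rw [neg_sq] at h2
  have hi : Integrable (fun z => Real.exp (t * |z|)) (chiSqLaw d) := by
    refine (i1.add i2).mono' (by fun_prop) (ae_of_all _ fun z => ?_)
    rw [Real.norm_eq_abs, abs_of_pos (Real.exp_pos _)]
    exact exp_abs_le t z
  refine ⟨hi, (integral_mono hi (i1.add i2) fun z => exp_abs_le t z).trans ?_⟩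
  rw [integral_add' i1 i2]
  linarith

variable {Ω : Type*} [MeasurableSpace Ω] {P : Measure Ω} [IsProbabilityMeasure P]
  {T : ℝ≥0} {ρ : ℝ → ℝ} {σ : Fin 2 → ℝ → ℝ} {s : ℝ} {B X : Fin 2 → ℝ≥0 → Ω → ℝ}

lemma IsDriftlessDiffusion.measurable_error (hX : IsDriftlessDiffusion P T σ B X)
    (π : Partition T × Partition T) :
    Measurable fun ω => hyEstimator π (fun i t => X i t ω) - covariation T ρ σ := by
  refine Measurable.sub_const (Finset.measurable_fun_sum _ fun i _ =>
    Finset.measurable_fun_sum _ fun j _ => ?_) _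
  exact (((hX.measurable 0 _ (π.1.pt_le _)).sub (hX.measurable 0 _ (π.1.pt_le _))).mul
    ((hX.measurable 1 _ (π.2.pt_le _)).sub (hX.measurable 1 _ (π.2.pt_le _)))).mul_const _

lemma IsDriftlessDiffusion.mu2_nonneg (hB : IsCorrelatedBrownian P ρ B)
    (hX : IsDriftlessDiffusion P T σ B X) (h : AdmissibleCoeff T ρ σ s)
    (π : Partition T × Partition T) : 0 ≤ mu2 ρ σ π := by
  obtain ⟨d, -, h2, -⟩ := hX.exists_map_eq_chiSqLaw π hB h
  rw [← h2]
  exact Finset.sum_nonneg fun _ _ => sq_nonneg _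

/-- Through the spectral representation this is `|∑ d k ^ 3| ≤ max |d k| · ∑ d k ^ 2`. -/
lemma IsDriftlessDiffusion.abs_mu3_le (hB : IsCorrelatedBrownian P ρ B)
    (hX : IsDriftlessDiffusion P T σ B X) (h : AdmissibleCoeff T ρ σ s)
    (π : Partition T × Partition T) : |mu3 ρ σ π| ≤ 3 * s ^ 2 * mesh π * mu2 ρ σ π := by
  obtain ⟨d, -, h2, h3, h4⟩ := hX.exists_map_eq_chiSqLaw π hB h
  rw [← h2, ← h3]
  exact abs_sum_cube_le d h4

/-- A bound uniform over all partitions, for use where the mesh is not small. Always `|d k| ≤ D =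
3s²T`, so the exponential moment of order `1/(4D)` of the unscaled error is bounded; the
normalization costs a factor `(√b)⁻¹ ^ γ`. -/
lemma IsDriftlessDiffusion.exists_moment_bound (hT : 0 < T) (hB : IsCorrelatedBrownian P ρ B)
    (hX : IsDriftlessDiffusion P T σ B X) (h : AdmissibleCoeff T ρ σ s) {M γ : ℝ} (hM : 0 < M)
    (hγ : 0 < γ) :
    ∃ K > 0, ∀ (π : Partition T × Partition T) (b : ℝ), 0 < b → ∀ f ∈ growthClass M γ,
      Integrable (fun ω => f (normError ρ σ b π fun i t => X i t ω)) P ∧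
      ∫ ω, |f (normError ρ σ b π fun i t => X i t ω)| ∂P ≤ K * max 1 ((√b)⁻¹ ^ γ) := by
  have hs := h.bound_pos
  have hT' : (0 : ℝ) < T := NNReal.coe_pos.2 hT
  set D := 3 * s ^ 2 * (T : ℝ) with hD
  have hDpos : 0 < D := by positivity
  set t := (4 * D)⁻¹ with ht
  have htpos : 0 < t := by positivity
  obtain ⟨K₁, hK₁, hexp⟩ := exists_one_add_rpow_le_mul_exp hγ htpos
  set M2 := 5 * s ^ 4 * (T : ℝ) ^ 2 with hM2
  refine ⟨M * K₁ * (2 * Real.exp (2 * t ^ 2 * M2)), by positivity, fun π b hb f hf => ?_⟩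
  obtain ⟨d, h1, h2, -, h4⟩ := hX.exists_map_eq_chiSqLaw π hB h
  set W : Ω → ℝ := fun ω => hyEstimator π (fun i t => X i t ω) - covariation T ρ σ with hW
  have hWm : Measurable W := hX.measurable_error π
  have htd : ∀ k, |t * d k| ≤ 1 / 4 := fun k => by
    rw [abs_mul, abs_of_pos htpos]
    have : |d k| ≤ D := (h4 k).trans (mul_le_mul_of_nonneg_left (mesh_le π) (by positivity))
    calc t * |d k| ≤ t * D := mul_le_mul_of_nonneg_left this htpos.le
      _ = 1 / 4 := by rw [ht]; field_simp
  obtain ⟨hi, hle⟩ := integrable_exp_abs_chiSqLaw d htd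
  rw [← h1] at hi hle
  rw [integrable_map_measure (by fun_prop) hWm.aemeasurable] at hi
  rw [integral_map hWm.aemeasurable (by fun_prop)] at hle
  have hle' : ∫ ω, Real.exp (t * |W ω|) ∂P ≤ 2 * Real.exp (2 * t ^ 2 * M2) := by
    refine hle.trans ?_
    rw [h2]
    have := h.mu2_le π
    gcongr
  set m := max 1 ((√b)⁻¹ ^ γ) with hm
  have hm1 : 1 ≤ m := le_max_left _ _
  have hpt : ∀ ω, |f ((√b)⁻¹ * W ω)| ≤ M * K₁ * m * Real.exp (t * |W ω|) := by
    intro ω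
    have e1 := hf.2 ((√b)⁻¹ * W ω)
    have e2 : |(√b)⁻¹ * W ω| ^ γ ≤ m * |W ω| ^ γ := by
      rw [abs_mul, abs_of_nonneg (inv_nonneg.2 (Real.sqrt_nonneg b)),
        Real.mul_rpow (inv_nonneg.2 (Real.sqrt_nonneg b)) (abs_nonneg _)]
      exact mul_le_mul_of_nonneg_right (le_max_right _ _) (Real.rpow_nonneg (abs_nonneg _) _)
    have e3 := hexp |W ω| (abs_nonneg _)
    calc _ ≤ M * (1 + |(√b)⁻¹ * W ω| ^ γ) := e1
      _ ≤ M * (m * 1 + m * |W ω| ^ γ) := by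
          refine mul_le_mul_of_nonneg_left (by linarith) hM.le
      _ = M * m * (1 + |W ω| ^ γ) := by ring
      _ ≤ M * m * (K₁ * Real.exp (t * |W ω|)) := mul_le_mul_of_nonneg_left e3 (by positivity)
      _ = _ := by ring
  have hi' : Integrable (fun ω => M * K₁ * m * Real.exp (t * |W ω|)) P := hi.const_mul _
  have hfm : Measurable fun ω => f ((√b)⁻¹ * W ω) := hf.1.comp (hWm.const_mul _)
  have hint : Integrable (fun ω => f ((√b)⁻¹ * W ω)) P :=
    hi'.mono' hfm.aestronglyMeasurable (ae_of_all _ hpt)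
  refine ⟨hint, (integral_mono hint.abs hi' hpt).trans ?_⟩
  rw [integral_const_mul]
  calc _ ≤ M * K₁ * m * (2 * Real.exp (2 * t ^ 2 * M2)) :=
        mul_le_mul_of_nonneg_left hle' (by positivity)
    _ = _ := by ring

/-- Apply the chi-square expansion to the weights `d k / √b`. The mesh condition makes them at most
`3s²δ`, twice the sum of their squares is `λ̄₂`, and eight times the sum of their cubes is `√b λ̄₃`
because `b^(-3/2) = √b · b⁻²`. -/
lemma IsDriftlessDiffusion.exists_abs_integral_sub_le (hB : IsCorrelatedBrownian P ρ B)
    (hX : IsDriftlessDiffusion P T σ B X) (h : AdmissibleCoeff T ρ σ s) {M γ c : ℝ} (hM : 0 < M)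
    (hγ : 0 < γ) (hc : 0 < c) :
    ∃ δ₀ > 0, ∃ K > 0, ∀ (π : Partition T × Partition T) (b δ : ℝ), 0 < b → 0 < δ → δ ≤ δ₀ →
      mesh π ≤ √b * δ → |lam2 ρ σ b π - c| ≤ δ → ∀ f ∈ growthClass M γ,
      |∫ ω, f (normError ρ σ b π fun i t => X i t ω) ∂P -
        ∫ z, f z * edgeworthDensity c (lam2 ρ σ b π) (√b * lam3 ρ σ b π) z| ≤ K * δ ^ 2 := by
  have hs := h.bound_pos
  obtain ⟨δ₀, hδ₀, K, hK, key⟩ := exists_abs_integral_chiSqLaw_sub_le (C₀ := 3 * s ^ 2) hc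
    (by positivity) hM hγ
  refine ⟨δ₀, hδ₀, K, hK, fun π b δ hb hδ hδ' hmesh hlam f hf => ?_⟩
  obtain ⟨d, h1, h2, h3, h4⟩ := hX.exists_map_eq_chiSqLaw π hB h
  have hsb : 0 < √b := Real.sqrt_pos.2 hb
  have hsq : √b ^ 2 = b := Real.sq_sqrt hb.le
  have e2 : 2 * ∑ k, ((√b)⁻¹ * d k) ^ 2 = lam2 ρ σ b π := by
    simp only [mul_pow, ← Finset.mul_sum, h2, lam2, inv_pow, hsq]
    ring
  have e3 : 8 * ∑ k, ((√b)⁻¹ * d k) ^ 3 = √b * lam3 ρ σ b π := by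
    simp only [mul_pow, ← Finset.mul_sum, h3, lam3]
    have : (√b)⁻¹ ^ 3 = √b * (b ^ 2)⁻¹ := by
      rw [← hsq]; field_simp
      rw [Real.sqrt_sq hsb.le]
    rw [this]; ring
  have := key _ (fun k => (√b)⁻¹ * d k) δ hδ hδ' (fun k => ?_) (by rw [e2]; exact hlam) f hf
  · rw [e2, e3, ← map_const_mul_chiSqLaw, ← h1, Measure.map_map (by fun_prop)
      (hX.measurable_error π), integral_map
      ((measurable_const_mul _).comp (hX.measurable_error π)).aemeasurable
      hf.1.aestronglyMeasurable] at this
    exact this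
  · rw [abs_mul, abs_of_pos (inv_pos.2 hsb)]
    calc (√b)⁻¹ * |d k| ≤ (√b)⁻¹ * (3 * s ^ 2 * (√b * δ)) := by
          refine mul_le_mul_of_nonneg_left ((h4 k).trans ?_) (inv_nonneg.2 hsb.le)
          exact mul_le_mul_of_nonneg_left hmesh (by positivity)
      _ = 3 * s ^ 2 * δ := by field_simp

lemma IsDriftlessDiffusion.abs_lam3_le (hB : IsCorrelatedBrownian P ρ B)
    (hX : IsDriftlessDiffusion P T σ B X) (h : AdmissibleCoeff T ρ σ s)
    (π : Partition T × Partition T) {b : ℝ} (hb : 0 < b) :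
    |lam3 ρ σ b π| ≤ 12 * s ^ 2 * (mesh π / b) * lam2 ρ σ b π := by
  have h3 := hX.abs_mu3_le hB h π
  rw [lam3, lam2, abs_mul, abs_of_pos (by positivity)]
  calc _ ≤ 8 * (b ^ 2)⁻¹ * (3 * s ^ 2 * mesh π * mu2 ρ σ π) :=
        mul_le_mul_of_nonneg_left h3 (by positivity)
    _ = _ := by field_simp; ring

lemma IsDriftlessDiffusion.lam2_nonneg (hB : IsCorrelatedBrownian P ρ B)
    (hX : IsDriftlessDiffusion P T σ B X) (h : AdmissibleCoeff T ρ σ s)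
    (π : Partition T × Partition T) {b : ℝ} (hb : 0 < b) : 0 ≤ lam2 ρ σ b π :=
  mul_nonneg (by positivity) (hX.mu2_nonneg hB h π)

lemma AdmissibleCoeff.lam2_le (h : AdmissibleCoeff T ρ σ s) (π : Partition T × Partition T)
    {b : ℝ} (hb : 0 < b) : lam2 ρ σ b π ≤ 10 * s ^ 4 * T ^ 2 / b := by
  have := h.mu2_le π
  calc _ ≤ 2 * b⁻¹ * (5 * s ^ 4 * T ^ 2) := mul_le_mul_of_nonneg_left this (by positivity)
    _ = _ := by field_simp; ring

end FixedPartition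

end

end HYExpansion

/-! ### Integrals against the limit density and its positive part. -/

namespace HYExpansion

noncomputable section

section LimitDensity

variable {c : ℝ}

lemma exists_abs_hermite_le (c : ℝ) : ∃ K > 0, ∀ z : ℝ, 1 ≤ K * Real.exp (1 * |z|) ∧
    |(z ^ 2 - c) / c ^ 2| ≤ K * Real.exp (1 * |z|) ∧
    |(z ^ 3 - 3 * c * z) / c ^ 3| ≤ K * Real.exp (1 * |z|) := by
  -- The coefficients `(c + 2, 0)` and `(c, 6)` reduce the Edgeworth factor to `1 + h₂` and `1 +
  -- h₃`.
  obtain ⟨K2, h2⟩ := exists_abs_edgeworth_factor_le c (c + 2) 0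
  obtain ⟨K3, h3⟩ := exists_abs_edgeworth_factor_le c c 6
  refine ⟨|K2| + |K3| + 1, by positivity, fun z => ?_⟩
  have e2 := h2 z
  have e3 := h3 z
  have a2 : 1 + (c + 2 - c) / 2 * ((z ^ 2 - c) / c ^ 2) + 0 / 6 * ((z ^ 3 - 3 * c * z) / c ^ 3) =
      1 + (z ^ 2 - c) / c ^ 2 := by ring
  have a3 : 1 + (c - c) / 2 * ((z ^ 2 - c) / c ^ 2) + 6 / 6 * ((z ^ 3 - 3 * c * z) / c ^ 3) =
      1 + (z ^ 3 - 3 * c * z) / c ^ 3 := by ring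
  rw [a2] at e2
  rw [a3] at e3
  have h1 : 1 ≤ Real.exp (1 * |z|) := Real.one_le_exp (by positivity)
  have b2 : K2 * Real.exp (1 * |z|) ≤ |K2| * Real.exp (1 * |z|) :=
    mul_le_mul_of_nonneg_right (le_abs_self _) (Real.exp_pos _).le
  have b3 : K3 * Real.exp (1 * |z|) ≤ |K3| * Real.exp (1 * |z|) :=
    mul_le_mul_of_nonneg_right (le_abs_self _) (Real.exp_pos _).le
  have n2 : 0 ≤ |K2| * Real.exp (1 * |z|) := by positivity
  have n3 : 0 ≤ |K3| * Real.exp (1 * |z|) := by positivity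
  have c2 : |(z ^ 2 - c) / c ^ 2| ≤ |1 + (z ^ 2 - c) / c ^ 2| + 1 := by
    have := abs_sub (1 + (z ^ 2 - c) / c ^ 2) 1
    rwa [add_sub_cancel_left, abs_one] at this
  have c3 : |(z ^ 3 - 3 * c * z) / c ^ 3| ≤ |1 + (z ^ 3 - 3 * c * z) / c ^ 3| + 1 := by
    have := abs_sub (1 + (z ^ 3 - 3 * c * z) / c ^ 3) 1
    rwa [add_sub_cancel_left, abs_one] at this
  rw [add_mul, add_mul, one_mul (Real.exp _)]
  exact ⟨by linarith, by linarith, by linarith⟩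

/-- The integrals against an Edgeworth density depend on its coefficients in an affine way, with
uniformly bounded coefficients. -/
lemma exists_integral_mul_edgeworthDensity_eq (hc : 0 < c) {M γ : ℝ} (hM : 0 < M) (hγ : 0 < γ) :
    ∃ K > 0, ∀ f ∈ growthClass M γ, ∃ A₀ A₂ A₃ : ℝ, |A₀| ≤ K ∧ |A₂| ≤ K ∧ |A₃| ≤ K ∧
      ∀ l k, ∫ z, f z * edgeworthDensity c l k z = A₀ + (l - c) / 2 * A₂ + k / 6 * A₃ := by
  obtain ⟨K₁, hK₁, hf⟩ := exists_growthClass_bound hM hγ (κ := 1) one_pos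
  obtain ⟨K₂, hK₂, hh⟩ := exists_abs_hermite_le c
  set G : ℝ → ℝ := fun z => phi c z • (K₁ * K₂ * Real.exp (2 * |z|)) with hG
  have hGi : Integrable G := integrable_mul_phi hc (K := K₁ * K₂) (t := 2)
    (by exact (by fun_prop : Measurable fun z : ℝ => K₁ * K₂ * Real.exp (2 * |z|)).aestronglyMeasurable)
    fun z => by rw [Real.norm_eq_abs, abs_of_pos (by positivity)]
  have hG0 : 0 ≤ ∫ z, G z := integral_nonneg fun z => by
    simp only [hG, smul_eq_mul]
    exact mul_nonneg (phi_nonneg c z) (by positivity)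
  refine ⟨(∫ z, G z) + 1, by linarith, fun f hfm => ?_⟩
  have main : ∀ u : ℝ → ℝ, Measurable u → (∀ z, |u z| ≤ K₂ * Real.exp (1 * |z|)) →
      Integrable (fun z => f z * (u z * phi c z)) ∧
        |∫ z, f z * (u z * phi c z)| ≤ (∫ z, G z) + 1 := by
    intro u hu hub
    have hb : ∀ z, ‖f z * (u z * phi c z)‖ ≤ G z := by
      intro z
      rw [Real.norm_eq_abs, abs_mul, abs_mul, abs_of_nonneg (phi_nonneg c z)]
      calc |f z| * (|u z| * phi c z)
          ≤ (K₁ * Real.exp (1 * |z|)) * ((K₂ * Real.exp (1 * |z|)) * phi c z) :=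
            mul_le_mul (hf f hfm z) (mul_le_mul_of_nonneg_right (hub z) (phi_nonneg c z))
              (mul_nonneg (abs_nonneg _) (phi_nonneg c z)) (by positivity)
        _ = G z := by
            simp only [hG, smul_eq_mul]
            rw [two_mul, Real.exp_add, one_mul]; ring
    have hi : Integrable (fun z => f z * (u z * phi c z)) :=
      hGi.mono' (hfm.1.mul (hu.mul (measurable_phi c))).aestronglyMeasurable (ae_of_all _ hb)
    refine ⟨hi, ?_⟩
    have := norm_integral_le_of_norm_le hGi (ae_of_all _ hb)
    rw [Real.norm_eq_abs] at this
    linarith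
  obtain ⟨i0, b0⟩ := main (fun _ => 1) measurable_const fun z => by
    rw [abs_one]; exact (hh z).1
  obtain ⟨i2, b2⟩ := main (fun z => (z ^ 2 - c) / c ^ 2) (by fun_prop) fun z => (hh z).2.1
  obtain ⟨i3, b3⟩ := main (fun z => (z ^ 3 - 3 * c * z) / c ^ 3) (by fun_prop)
    fun z => (hh z).2.2
  refine ⟨_, _, _, b0, b2, b3, fun l k => ?_⟩
  have e : ∀ z, f z * edgeworthDensity c l k z = (f z * (1 * phi c z) +
      (l - c) / 2 * (f z * ((z ^ 2 - c) / c ^ 2 * phi c z))) +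
      k / 6 * (f z * ((z ^ 3 - 3 * c * z) / c ^ 3 * phi c z)) := fun z => by
    rw [edgeworthDensity_eq]; ring
  simp only [e]
  have j2 := i2.const_mul ((l - c) / 2)
  have j02 : Integrable fun z => f z * (1 * phi c z) +
      (l - c) / 2 * (f z * ((z ^ 2 - c) / c ^ 2 * phi c z)) := i0.add j2
  rw [integral_add j02 (i3.const_mul _), integral_add i0 j2, integral_const_mul,
    integral_const_mul]

lemma pStar_eq (hc : 0 < c) (b l : ℝ) : pStar c b l = edgeworthDensity c c (√b * l) := by
  funext z
  rw [pStar, edgeworthDensity, hermite_three hc]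
  ring

/-- The mass is the Laplace transform at `w = 0`. -/
lemma integral_edgeworthDensity (hc : 0 < c) (l k : ℝ) :
    Integrable (edgeworthDensity c l k) ∧ ∫ z, edgeworthDensity c l k z = 1 := by
  constructor
  · have := integrable_mul_edgeworthDensity hc l k (f := fun _ => 1) measurable_const
      (K := 1) (t := 0) (fun z => by simp)
    simpa using this
  · have := integral_cexp_mul_edgeworthDensity hc l k 0
    simp only [zero_mul, Complex.exp_zero, one_mul] at this
    rw [integral_complex_ofReal] at this
    have h2 : edgeworthLaplace c l k 0 = 1 := by simp [edgeworthLaplace]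
    rw [h2] at this
    exact_mod_cast this

lemma measurable_edgeworthDensity (c l k : ℝ) : Measurable (edgeworthDensity c l k) := by
  unfold edgeworthDensity
  exact (measurable_phi c).mul (by fun_prop)

/-- The mass of the positive part of an Edgeworth density. -/
lemma one_le_integral_max_edgeworthDensity (hc : 0 < c) (k : ℝ) :
    Integrable (fun z => max 0 (edgeworthDensity c c k z)) ∧
      1 ≤ ∫ z, max 0 (edgeworthDensity c c k z) := by
  obtain ⟨hi, h1⟩ := integral_edgeworthDensity hc c k
  have hm : Integrable (fun z => max 0 (edgeworthDensity c c k z)) := by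
    refine hi.abs.mono' (measurable_const.max (measurable_edgeworthDensity c c k)).aestronglyMeasurable
      (ae_of_all _ fun z => ?_)
    rw [Real.norm_eq_abs, abs_of_nonneg (le_max_left _ _)]
    exact max_le (abs_nonneg _) (le_abs_self _)
  refine ⟨hm, ?_⟩
  rw [← h1]
  exact integral_mono hi hm fun z => le_max_right _ _

/-- The density is `φ (1 + x)` with `x = (k/6) h₃`. It is negative only where `x < -1`, and there
`-(1 + x) ≤ x²`. -/
lemma max_zero_sub_edgeworthDensity_le (c k z : ℝ) :
    0 ≤ max 0 (edgeworthDensity c c k z) - edgeworthDensity c c k z ∧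
    max 0 (edgeworthDensity c c k z) - edgeworthDensity c c k z ≤
      phi c z * ((k / 6) ^ 2 * ((z ^ 3 - 3 * c * z) / c ^ 3) ^ 2) := by
  refine ⟨sub_nonneg.2 (le_max_right _ _), ?_⟩
  set x := k / 6 * ((z ^ 3 - 3 * c * z) / c ^ 3) with hx
  have e : edgeworthDensity c c k z = phi c z * (1 + x) := by
    rw [edgeworthDensity, hx]; ring
  have hp := phi_nonneg c z
  rw [e, ← mul_pow, ← hx]
  rcases le_total 0 (1 + x) with h | h
  · rw [max_eq_right (mul_nonneg hp h), sub_self]; positivity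
  · rw [max_eq_left (mul_nonpos_of_nonneg_of_nonpos hp h), zero_sub, ← mul_neg]
    exact mul_le_mul_of_nonneg_left (by nlinarith) hp

/-- The normalized positive part of the limit density is a small perturbation of it. -/
lemma exists_abs_integral_pPlus_sub_le (hc : 0 < c) {M γ : ℝ} (hM : 0 < M) (hγ : 0 < γ) :
    ∃ K > 0, ∀ k, |k| ≤ 1 → ∀ f ∈ growthClass M γ,
      |(∫ z, f z * (max 0 (edgeworthDensity c c k z) /
          ∫ u, max 0 (edgeworthDensity c c k u))) -
        ∫ z, f z * edgeworthDensity c c k z| ≤ K * k ^ 2 := by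
  obtain ⟨K₁, hK₁, hf⟩ := exists_growthClass_bound hM hγ (κ := 1) one_pos
  obtain ⟨K₂, hK₂, hh⟩ := exists_abs_hermite_le c
  obtain ⟨K₃, hK₃, hA⟩ := exists_integral_mul_edgeworthDensity_eq hc hM hγ
  set G : ℝ → ℝ := fun z => phi c z • ((K₁ + 1) * K₂ ^ 2 * Real.exp (3 * |z|)) with hG
  have hGi : Integrable G := integrable_mul_phi hc (K := (K₁ + 1) * K₂ ^ 2) (t := 3)
    (by exact (by fun_prop :
      Measurable fun z : ℝ => (K₁ + 1) * K₂ ^ 2 * Real.exp (3 * |z|)).aestronglyMeasurable)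
    fun z => by rw [Real.norm_eq_abs, abs_of_pos (by positivity)]
  have hG0 : 0 ≤ ∫ z, G z := integral_nonneg fun z => by
    simp only [hG, smul_eq_mul]
    exact mul_nonneg (phi_nonneg c z) (by positivity)
  set I := ∫ z, G z with hI
  refine ⟨I + 2 * K₃ * I + 1, by positivity, fun k hk f hfm => ?_⟩
  set p := edgeworthDensity c c k with hp
  have hdiff : ∀ (u : ℝ → ℝ), Measurable u → (∀ z, |u z| ≤ (K₁ + 1) * Real.exp (1 * |z|)) →
      Integrable (fun z => u z * (max 0 (p z) - p z)) ∧
      |∫ z, u z * (max 0 (p z) - p z)| ≤ k ^ 2 * I := by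
    intro u hu hub
    have hb : ∀ z, ‖u z * (max 0 (p z) - p z)‖ ≤ k ^ 2 * G z := by
      intro z
      obtain ⟨h0, h1⟩ := max_zero_sub_edgeworthDensity_le c k z
      have h2 : ((z ^ 3 - 3 * c * z) / c ^ 3) ^ 2 ≤ (K₂ * Real.exp (1 * |z|)) ^ 2 := by
        rw [← sq_abs]
        have := (hh z).2.2
        gcongr
      rw [Real.norm_eq_abs, abs_mul, abs_of_nonneg h0]
      calc _ ≤ (K₁ + 1) * Real.exp (1 * |z|) *
            (phi c z * ((k / 6) ^ 2 * (K₂ * Real.exp (1 * |z|)) ^ 2)) := by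
            refine mul_le_mul (hub z) (h1.trans ?_) h0 (by positivity)
            exact mul_le_mul_of_nonneg_left (mul_le_mul_of_nonneg_left h2 (sq_nonneg _))
              (phi_nonneg c z)
        _ = (1 / 36) * (k ^ 2 * G z) := by
            simp only [hG, smul_eq_mul]
            rw [show (3 : ℝ) * |z| = 1 * |z| + 1 * |z| + 1 * |z| by ring, Real.exp_add,
              Real.exp_add]
            ring
        _ ≤ 1 * (k ^ 2 * G z) := by
            refine mul_le_mul_of_nonneg_right (by norm_num) (mul_nonneg (sq_nonneg k) ?_)
            simp only [hG, smul_eq_mul]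
            exact mul_nonneg (phi_nonneg c z) (by positivity)
        _ = _ := one_mul _
    have hi : Integrable (fun z => u z * (max 0 (p z) - p z)) :=
      (hGi.const_mul _).mono' (hu.mul ((measurable_const.max
        (measurable_edgeworthDensity c c k)).sub
        (measurable_edgeworthDensity c c k))).aestronglyMeasurable (ae_of_all _ hb)
    refine ⟨hi, ?_⟩
    have := norm_integral_le_of_norm_le (hGi.const_mul (k ^ 2)) (ae_of_all _ hb)
    rwa [Real.norm_eq_abs, integral_const_mul] at this
  obtain ⟨hZi, hZ1⟩ := one_le_integral_max_edgeworthDensity hc k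
  obtain ⟨hpi, hp1⟩ := integral_edgeworthDensity hc c k
  set Z := ∫ u, max 0 (p u) with hZ
  have hZ2 : |Z - 1| ≤ k ^ 2 * I := by
    have := (hdiff (fun _ => 1) measurable_const fun z => by
      rw [abs_one]
      have := Real.one_le_exp (x := 1 * |z|) (by positivity)
      nlinarith).2
    simp only [one_mul] at this
    rwa [integral_sub hZi hpi, hp1] at this
  obtain ⟨hfi, hfb⟩ := hdiff f hfm.1 fun z => (hf f hfm z).trans
    (mul_le_mul_of_nonneg_right (by linarith) (Real.exp_pos _).le)
  have hfp : Integrable (fun z => f z * p z) :=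
    integrable_mul_edgeworthDensity hc c k hfm.1 (hf f hfm)
  have e1 : ∫ z, f z * (max 0 (p z) / Z) =
      ((∫ z, f z * (max 0 (p z) - p z)) + ∫ z, f z * p z) / Z := by
    rw [← integral_add hfi hfp, ← integral_div]
    congr 1 with z
    ring
  obtain ⟨A₀, A₂, A₃, b0, -, b3, hform⟩ := hA f hfm
  have hfpb : |∫ z, f z * p z| ≤ 2 * K₃ := by
    rw [hp, hform, sub_self, zero_div, zero_mul, add_zero]
    refine (abs_add_le _ _).trans ?_
    have : |k / 6 * A₃| ≤ K₃ := by
      rw [abs_mul, abs_div, abs_of_pos (by norm_num : (0 : ℝ) < 6)]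
      calc _ ≤ 1 * K₃ := mul_le_mul (by linarith) b3 (abs_nonneg _) zero_le_one
        _ = K₃ := one_mul _
    linarith
  have hZpos : 0 < Z := by linarith
  rw [e1]
  set D := ∫ z, f z * (max 0 (p z) - p z)
  set F := ∫ z, f z * p z
  -- `D` and `Z - 1` are `O(k²)` and `F` is bounded; division by `Z ≥ 1` does no harm.
  have e2 : (D + F) / Z - F = (D - F * (Z - 1)) / Z := by field_simp; ring
  rw [e2, abs_div, abs_of_pos hZpos]
  have h3 : |D - F * (Z - 1)| ≤ k ^ 2 * I + 2 * K₃ * (k ^ 2 * I) := by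
    refine (abs_sub _ _).trans (add_le_add hfb ?_)
    rw [abs_mul]
    exact mul_le_mul hfpb hZ2 (abs_nonneg _) (by positivity)
  calc _ ≤ |D - F * (Z - 1)| := div_le_self (abs_nonneg _) hZ1
    _ ≤ k ^ 2 * I + 2 * K₃ * (k ^ 2 * I) := h3
    _ = (I + 2 * K₃ * I) * k ^ 2 := by ring
    _ ≤ _ := mul_le_mul_of_nonneg_right (by linarith) (sq_nonneg k)

lemma integral_pPlus (hc : 0 < c) (b l : ℝ) :
    (∀ z, 0 ≤ pPlus c b l z) ∧ Integrable (pPlus c b l) ∧ ∫ z, pPlus c b l z = 1 := by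
  obtain ⟨hi, h1⟩ := one_le_integral_max_edgeworthDensity hc (√b * l)
  have e : pPlus c b l = fun z => max 0 (edgeworthDensity c c (√b * l) z) /
      ∫ u, max 0 (edgeworthDensity c c (√b * l) u) := by
    funext z; simp only [pPlus, pStar_eq hc]
  rw [e]
  refine ⟨fun z => div_nonneg (le_max_left _ _) (by linarith), hi.div_const _, ?_⟩
  rw [integral_div, div_self (by linarith)]

lemma integrable_mul_pPlus (hc : 0 < c) (b l : ℝ) {M γ : ℝ} (hM : 0 < M) (hγ : 0 < γ) {f : ℝ → ℝ}
    (hf : f ∈ growthClass M γ) : Integrable fun z => f z * pPlus c b l z := by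
  obtain ⟨K, -, hK⟩ := exists_growthClass_bound hM hγ (κ := 1) one_pos
  have hp := integrable_mul_edgeworthDensity hc c (√b * l) hf.1 (hK f hf)
  have h1 : Integrable fun z => f z * max 0 (edgeworthDensity c c (√b * l) z) := by
    refine hp.mono (hf.1.mul (measurable_const.max
      (measurable_edgeworthDensity c c _))).aestronglyMeasurable (ae_of_all _ fun z => ?_)
    rw [norm_mul, norm_mul]
    refine mul_le_mul_of_nonneg_left ?_ (norm_nonneg _)
    rw [Real.norm_eq_abs, abs_of_nonneg (le_max_left _ _)]
    exact max_le (norm_nonneg _) (le_abs_self _)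
  refine (h1.div_const (∫ u, max 0 (edgeworthDensity c c (√b * l) u))).congr
    (ae_of_all _ fun z => ?_)
  simp only [pPlus, pStar_eq hc]
  ring

end LimitDensity

end

end HYExpansion

/-! ### Averaging over the random partitions. -/

namespace HYExpansion

noncomputable section

section Averaging

variable {Ω : Type*} [MeasurableSpace Ω] {P : Measure Ω} [IsProbabilityMeasure P]
  {T : ℝ≥0} {ρ : ℝ → ℝ} {σ : Fin 2 → ℝ → ℝ} {s : ℝ} {B X : Fin 2 → ℝ≥0 → Ω → ℝ}

/-- The pairs of partitions for which the conditional expansion is accurate. -/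
def goodSet (T : ℝ≥0) (ρ : ℝ → ℝ) (σ : Fin 2 → ℝ → ℝ) (c b δ : ℝ) :
    Set (Partition T × Partition T) :=
  {π | (lam2 ρ σ b π - c) ^ 2 ≤ δ ^ 2 ∧ mesh π ≤ √b * δ}

lemma measurableSet_goodSet (h : AdmissibleCoeff T ρ σ s) (c b δ : ℝ) :
    MeasurableSet (goodSet T ρ σ c b δ) :=
  (measurableSet_le (((measurable_lam2 h.measurable_sigma h.measurable_rho b).sub_const
    c).pow_const 2) measurable_const).inter (measurableSet_le measurable_mesh measurable_const)

lemma one_le_inv_rpow {b p q : ℝ} (hb : 0 < b) (hb1 : b ≤ 1) (hpq : p ≤ q) :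
    b⁻¹ ^ p ≤ b⁻¹ ^ q :=
  Real.rpow_le_rpow_of_exponent_le ((one_le_inv₀ hb).2 hb1) hpq

lemma IsDriftlessDiffusion.abs_lam3_le' (hB : IsCorrelatedBrownian P ρ B)
    (hX : IsDriftlessDiffusion P T σ B X) (h : AdmissibleCoeff T ρ σ s)
    (π : Partition T × Partition T) {b : ℝ} (hb : 0 < b) :
    |lam3 ρ σ b π| ≤ 120 * s ^ 6 * T ^ 3 * (b⁻¹) ^ 2 := by
  have h1 := hX.abs_lam3_le hB h π hb
  have h2 := h.lam2_le π hb
  have h3 := hX.lam2_nonneg hB h π hb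
  have h4 := mesh_le π
  have h5 := mesh_nonneg π
  calc _ ≤ 12 * s ^ 2 * (mesh π / b) * lam2 ρ σ b π := h1
    _ ≤ 12 * s ^ 2 * (T / b) * (10 * s ^ 4 * T ^ 2 / b) := by gcongr
    _ = _ := by field_simp; ring

/-- On the good set, `|λ̄₃|` is at most `12 s² (mesh / b) λ̄₂` with `mesh ≤ √b δ` and `λ̄₂ ≤ c + 1`,
so `√b |λ̄₃| = O(δ)`. Elsewhere the crude bound by `b⁻²` is used. -/
lemma IsDriftlessDiffusion.exists_sqrt_mul_lam3_le (hB : IsCorrelatedBrownian P ρ B)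
    (hX : IsDriftlessDiffusion P T σ B X) (h : AdmissibleCoeff T ρ σ s) {c q : ℝ} (hc : 0 < c)
    (hq : 2 ≤ q) :
    ∃ K > 0, ∀ (π : Partition T × Partition T) (b δ : ℝ), 0 < b → b ≤ 1 → 0 < δ → δ ≤ 1 →
      √b * |lam3 ρ σ b π| ≤
        K * δ + K * b⁻¹ ^ q * (goodSet T ρ σ c b δ)ᶜ.indicator 1 π := by
  have hs := h.bound_pos
  refine ⟨12 * s ^ 2 * (c + 1) + 120 * s ^ 6 * T ^ 3, by positivity,
    fun π b δ hb hb1 hδ hδ1 => ?_⟩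
  have hsb : 0 < √b := Real.sqrt_pos.2 hb
  have hT : (0 : ℝ) ≤ T := T.2
  by_cases hg : π ∈ goodSet T ρ σ c b δ
  · rw [Set.indicator_of_notMem (by simpa using hg), mul_zero, add_zero]
    have h1 := hX.abs_lam3_le hB h π hb
    have h2 : lam2 ρ σ b π ≤ c + 1 := by
      have := abs_le_of_sq_le_sq hg.1 hδ.le
      linarith [le_abs_self (lam2 ρ σ b π - c)]
    have h3 := hX.lam2_nonneg hB h π hb
    have h5 := mesh_nonneg π
    have e : √b * (√b * δ / b) = δ := by
      have : √b * √b = b := Real.mul_self_sqrt hb.le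
      rw [show √b * (√b * δ / b) = √b * √b * δ / b by ring, this]; field_simp
    calc √b * |lam3 ρ σ b π| ≤ √b * (12 * s ^ 2 * (√b * δ / b) * (c + 1)) := by
          refine mul_le_mul_of_nonneg_left (h1.trans ?_) hsb.le
          have := hg.2
          gcongr
      _ = 12 * s ^ 2 * (c + 1) * (√b * (√b * δ / b)) := by ring
      _ = 12 * s ^ 2 * (c + 1) * δ := by rw [e]
      _ ≤ _ := mul_le_mul_of_nonneg_right (le_add_of_nonneg_right (by positivity)) hδ.le
  · rw [Set.indicator_of_mem (by simpa using hg), Pi.one_apply, mul_one]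
    have h1 := hX.abs_lam3_le' hB h π hb
    have h2 : √b ≤ 1 := Real.sqrt_le_one.2 hb1
    have h3 := one_le_inv_rpow hb hb1 hq
    rw [Real.rpow_two] at h3
    calc √b * |lam3 ρ σ b π| ≤ 1 * (120 * s ^ 6 * T ^ 3 * (b⁻¹) ^ 2) :=
          mul_le_mul h2 h1 (abs_nonneg _) zero_le_one
      _ ≤ 120 * s ^ 6 * T ^ 3 * b⁻¹ ^ q := by
          rw [one_mul]; exact mul_le_mul_of_nonneg_left h3 (by positivity)
      _ ≤ (12 * s ^ 2 * (c + 1) + 120 * s ^ 6 * T ^ 3) * b⁻¹ ^ q :=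
          mul_le_mul_of_nonneg_right (le_add_of_nonneg_left (by positivity))
            (Real.rpow_nonneg (inv_nonneg.2 hb.le) _)
      _ ≤ _ := le_add_of_nonneg_left (by positivity)

/-- Off the good set no cancellation is sought. The expectation is at most of order `b⁻¹ ^ γ` by the
moment bound, and the Edgeworth integral at most of order `b⁻²` through its coefficients, which
explains the two conditions on `q`. -/
lemma IsDriftlessDiffusion.exists_conditional_bound (hT : 0 < T)
    (hB : IsCorrelatedBrownian P ρ B) (hX : IsDriftlessDiffusion P T σ B X)
    (h : AdmissibleCoeff T ρ σ s) {M γ c q : ℝ} (hM : 0 < M) (hγ : 0 < γ) (hc : 0 < c)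
    (hq : 2 ≤ q) (hq' : γ ≤ q) :
    ∃ δ₀ > 0, ∃ K > 0, ∀ (π : Partition T × Partition T) (b δ : ℝ), 0 < b → b ≤ 1 → 0 < δ →
      δ ≤ δ₀ → ∀ f ∈ growthClass M γ,
      |∫ ω, f (normError ρ σ b π fun i t => X i t ω) ∂P -
        ∫ z, f z * edgeworthDensity c (lam2 ρ σ b π) (√b * lam3 ρ σ b π) z| ≤
      K * δ ^ 2 + K * b⁻¹ ^ q * (goodSet T ρ σ c b δ)ᶜ.indicator 1 π := by
  have hs := h.bound_pos
  obtain ⟨δ₀, hδ₀, K₁, hK₁, hgood⟩ := hX.exists_abs_integral_sub_le hB h hM hγ hc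
  obtain ⟨K₂, hK₂, hmom⟩ := hX.exists_moment_bound hT hB h hM hγ
  obtain ⟨K₃, hK₃, hA⟩ := exists_integral_mul_edgeworthDensity_eq hc hM hγ
  set C := 1 + (10 * s ^ 4 * T ^ 2 + c) + 120 * s ^ 6 * T ^ 3 with hC
  have hCpos : 0 < C := by positivity
  refine ⟨δ₀, hδ₀, K₁ + (K₂ + K₃ * C), by positivity, fun π b δ hb hb1 hδ hδ' f hf => ?_⟩
  by_cases hg : π ∈ goodSet T ρ σ c b δ
  · rw [Set.indicator_of_notMem (by simpa using hg), mul_zero, add_zero]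
    refine (hgood π b δ hb hδ hδ' hg.2 (abs_le_of_sq_le_sq' hg.1 hδ.le |> abs_le.2) f hf).trans ?_
    exact mul_le_mul_of_nonneg_right (le_add_of_nonneg_right (by positivity)) (sq_nonneg δ)
  · rw [Set.indicator_of_mem (by simpa using hg), Pi.one_apply, mul_one]
    have hbi : 0 ≤ b⁻¹ := inv_nonneg.2 hb.le
    have hq2 := one_le_inv_rpow hb hb1 hq
    rw [Real.rpow_two] at hq2
    have hq0 := one_le_inv_rpow hb hb1 (by linarith : (0 : ℝ) ≤ q)
    rw [Real.rpow_zero] at hq0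
    have hqg := one_le_inv_rpow hb hb1 hq'
    have h1 : |∫ ω, f (normError ρ σ b π fun i t => X i t ω) ∂P| ≤ K₂ * b⁻¹ ^ q := by
      refine (abs_integral_le_integral_abs).trans (((hmom π b hb f hf).2).trans ?_)
      refine mul_le_mul_of_nonneg_left (max_le hq0 (le_trans ?_ hqg)) hK₂.le
      refine Real.rpow_le_rpow (inv_nonneg.2 (Real.sqrt_nonneg b)) ?_ hγ.le
      refine inv_anti₀ hb ?_
      exact Real.le_sqrt_of_sq_le (by nlinarith)
    obtain ⟨A₀, A₂, A₃, a0, a2, a3, hform⟩ := hA f hf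
    have h2 : |∫ z, f z * edgeworthDensity c (lam2 ρ σ b π) (√b * lam3 ρ σ b π) z| ≤
        K₃ * C * b⁻¹ ^ q := by
      rw [hform]
      have l2 := h.lam2_le π hb
      have l2' := hX.lam2_nonneg hB h π hb
      have l3 := hX.abs_lam3_le' hB h π hb
      have hb1' : 1 ≤ b⁻¹ := (one_le_inv₀ hb).2 hb1
      have e2 : |(lam2 ρ σ b π - c) / 2| ≤ (10 * s ^ 4 * T ^ 2 + c) * b⁻¹ ^ q := by
        have : |lam2 ρ σ b π - c| ≤ 10 * s ^ 4 * T ^ 2 / b + c := by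
          rw [abs_le]; constructor <;> linarith
        have h3 : (b⁻¹ : ℝ) ≤ b⁻¹ ^ q := by
          have := one_le_inv_rpow hb hb1 (by linarith : (1 : ℝ) ≤ q)
          rwa [Real.rpow_one] at this
        rw [abs_div, abs_two]
        have h4 : 10 * s ^ 4 * T ^ 2 / b ≤ 10 * s ^ 4 * T ^ 2 * b⁻¹ ^ q := by
          rw [div_eq_mul_inv]; exact mul_le_mul_of_nonneg_left h3 (by positivity)
        have h5 : c ≤ c * b⁻¹ ^ q := le_mul_of_one_le_right hc.le hq0
        have h6 := abs_nonneg (lam2 ρ σ b π - c)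
        linarith
      have e3 : |√b * lam3 ρ σ b π / 6| ≤ 120 * s ^ 6 * T ^ 3 * b⁻¹ ^ q := by
        rw [abs_div, abs_mul, abs_of_nonneg (Real.sqrt_nonneg b),
          abs_of_pos (by norm_num : (0 : ℝ) < 6)]
        have hsb : √b ≤ 1 := Real.sqrt_le_one.2 hb1
        have h5 : √b * |lam3 ρ σ b π| ≤ 1 * (120 * s ^ 6 * T ^ 3 * b⁻¹ ^ 2) :=
          mul_le_mul hsb l3 (abs_nonneg _) zero_le_one
        have h6 : 120 * s ^ 6 * T ^ 3 * b⁻¹ ^ 2 ≤ 120 * s ^ 6 * T ^ 3 * b⁻¹ ^ q :=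
          mul_le_mul_of_nonneg_left hq2 (by positivity)
        have h7 : 0 ≤ √b * |lam3 ρ σ b π| := by positivity
        linarith
      have f2 : |(lam2 ρ σ b π - c) / 2 * A₂| ≤ (10 * s ^ 4 * T ^ 2 + c) * b⁻¹ ^ q * K₃ := by
        rw [abs_mul]
        exact mul_le_mul e2 a2 (abs_nonneg _) (by positivity)
      have f3 : |√b * lam3 ρ σ b π / 6 * A₃| ≤ 120 * s ^ 6 * T ^ 3 * b⁻¹ ^ q * K₃ := by
        rw [abs_mul]
        exact mul_le_mul e3 a3 (abs_nonneg _) (by positivity)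
      have f0 : |A₀| ≤ 1 * b⁻¹ ^ q * K₃ := by nlinarith
      calc _ ≤ |A₀| + |(lam2 ρ σ b π - c) / 2 * A₂| + |√b * lam3 ρ σ b π / 6 * A₃| :=
            abs_add_three _ _ _
        _ ≤ 1 * b⁻¹ ^ q * K₃ + (10 * s ^ 4 * T ^ 2 + c) * b⁻¹ ^ q * K₃ +
            120 * s ^ 6 * T ^ 3 * b⁻¹ ^ q * K₃ := add_le_add (add_le_add f0 f2) f3
        _ = _ := by rw [hC]; ring
    have h0 : 0 ≤ K₁ * b⁻¹ ^ q := by positivity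
    have h00 : 0 ≤ (K₁ + (K₂ + K₃ * C)) * δ ^ 2 := by positivity
    refine (abs_sub _ _).trans ?_
    have e : (K₁ + (K₂ + K₃ * C)) * b⁻¹ ^ q =
        K₁ * b⁻¹ ^ q + (K₂ * b⁻¹ ^ q + K₃ * C * b⁻¹ ^ q) := by ring
    linarith

variable {Pi : Ω → Partition T × Partition T}

lemma IsDriftlessDiffusion.integrable_lam2 (hB : IsCorrelatedBrownian P ρ B)
    (hX : IsDriftlessDiffusion P T σ B X) (h : AdmissibleCoeff T ρ σ s) (hPi : Measurable Pi)
    {b : ℝ} (hb : 0 < b) : Integrable (fun ω => lam2 ρ σ b (Pi ω)) P :=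
  Integrable.of_bound ((measurable_lam2 h.measurable_sigma h.measurable_rho b).comp
    hPi).aestronglyMeasurable (10 * s ^ 4 * T ^ 2 / b) (ae_of_all _ fun ω => by
      rw [Real.norm_eq_abs, abs_of_nonneg (hX.lam2_nonneg hB h _ hb)]
      exact h.lam2_le _ hb)

lemma IsDriftlessDiffusion.integrable_lam3 (hB : IsCorrelatedBrownian P ρ B)
    (hX : IsDriftlessDiffusion P T σ B X) (h : AdmissibleCoeff T ρ σ s) (hPi : Measurable Pi)
    {b : ℝ} (hb : 0 < b) : Integrable (fun ω => lam3 ρ σ b (Pi ω)) P :=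
  Integrable.of_bound ((measurable_lam3 h.measurable_sigma h.measurable_rho b).comp
    hPi).aestronglyMeasurable (120 * s ^ 6 * T ^ 3 * (b⁻¹) ^ 2) (ae_of_all _ fun _ =>
      hX.abs_lam3_le' hB h _ hb)

/-- By independence the partitions and the path can live on separate factors of `P.prod P`. The
moment bound, uniform in the partitions, then justifies Fubini. -/
lemma IsDriftlessDiffusion.integral_normError (hT : 0 < T) (hB : IsCorrelatedBrownian P ρ B)
    (hX : IsDriftlessDiffusion P T σ B X) (h : AdmissibleCoeff T ρ σ s) (hPi : Measurable Pi)
    (hind : IndepFun Pi (fun ω (p : Fin 2 × Set.Iic T) => X p.1 p.2 ω - X p.1 0 ω) P)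
    {M γ : ℝ} (hM : 0 < M) (hγ : 0 < γ) {b : ℝ} (hb : 0 < b) {f : ℝ → ℝ}
    (hf : f ∈ growthClass M γ) :
    Integrable (fun ω => f (normError ρ σ b (Pi ω) fun i t => X i t ω)) P ∧
    Integrable (fun ω => ∫ ω', f (normError ρ σ b (Pi ω) fun i t => X i t ω') ∂P) P ∧
    ∫ ω, f (normError ρ σ b (Pi ω) fun i t => X i t ω) ∂P =
      ∫ ω, ∫ ω', f (normError ρ σ b (Pi ω) fun i t => X i t ω') ∂P ∂P := by
  obtain ⟨K, hK, hmom⟩ := hX.exists_moment_bound hT hB h hM hγ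
  have hid := (hX.identDistrib_normError (ρ := ρ) hPi hind b).comp hf.1
  have hint : Integrable (fun p : Ω × Ω => f (normError ρ σ b (Pi p.1) fun i t => X i t p.2))
      (P.prod P) := by
    have hm : AEStronglyMeasurable
        (fun p : Ω × Ω => f (normError ρ σ b (Pi p.1) fun i t => X i t p.2)) (P.prod P) :=
      hid.aemeasurable_snd.aestronglyMeasurable
    rw [integrable_prod_iff hm]
    refine ⟨ae_of_all _ fun ω => (hmom (Pi ω) b hb f hf).1, ?_⟩
    refine Integrable.of_bound hm.norm.integral_prod_right' (K * max 1 ((√b)⁻¹ ^ γ))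
      (ae_of_all _ fun ω => ?_)
    rw [Real.norm_eq_abs, abs_of_nonneg (integral_nonneg fun _ => norm_nonneg _)]
    exact (hmom (Pi ω) b hb f hf).2
  refine ⟨hid.integrable_iff.2 hint, hint.integral_prod_left, ?_⟩
  rw [← integral_prod _ hint]
  exact hid.integral_eq

/-- The unconditional expansion, with an explicit remainder. -/
lemma IsDriftlessDiffusion.exists_expansion_bound (hT : 0 < T)
    (hB : IsCorrelatedBrownian P ρ B) (hX : IsDriftlessDiffusion P T σ B X)
    (h : AdmissibleCoeff T ρ σ s) {M γ c q : ℝ} (hM : 0 < M) (hγ : 0 < γ) (hc : 0 < c)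
    (hq : 2 ≤ q) (hq' : γ ≤ q) :
    ∃ δ₀ > 0, ∃ K > 0, ∀ (Pi : Ω → Partition T × Partition T), Measurable Pi →
      IndepFun Pi (fun ω (p : Fin 2 × Set.Iic T) => X p.1 p.2 ω - X p.1 0 ω) P →
      ∀ b δ : ℝ, 0 < b → b ≤ 1 → 0 < δ → δ ≤ δ₀ → ∀ f ∈ growthClass M γ,
      |∫ ω, f (normError ρ σ b (Pi ω) fun i t => X i t ω) ∂P -
        ∫ z, f z * pStar c b (∫ ω, lam3 ρ σ b (Pi ω) ∂P) z| ≤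
      K * δ ^ 2 + K * b⁻¹ ^ q * P.real (Pi ⁻¹' goodSet T ρ σ c b δ)ᶜ +
        K * |∫ ω, (lam2 ρ σ b (Pi ω) - c) ∂P| := by
  obtain ⟨δ₀, hδ₀, K₁, hK₁, hcond⟩ := hX.exists_conditional_bound hT hB h hM hγ hc hq hq'
  obtain ⟨K₃, hK₃, hA⟩ := exists_integral_mul_edgeworthDensity_eq hc hM hγ
  refine ⟨δ₀, hδ₀, K₁ + K₃, by positivity, fun Pi hPi hind b δ hb hb1 hδ hδ' f hf => ?_⟩
  obtain ⟨-, hgi, hge⟩ := hX.integral_normError hT hB h hPi hind hM hγ hb hf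
  obtain ⟨A₀, A₂, A₃, a0, a2, a3, hform⟩ := hA f hf
  have i2 := hX.integrable_lam2 hB h hPi hb
  have i3 := hX.integrable_lam3 hB h hPi hb
  have i2' : Integrable (fun ω => (lam2 ρ σ b (Pi ω) - c) / 2 * A₂) P :=
    ((i2.sub (integrable_const c)).div_const 2).mul_const A₂
  have i3' : Integrable (fun ω => √b * lam3 ρ σ b (Pi ω) / 6 * A₃) P :=
    ((i3.const_mul (√b)).div_const 6).mul_const A₃
  have i02 : Integrable (fun ω => A₀ + (lam2 ρ σ b (Pi ω) - c) / 2 * A₂) P :=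
    (integrable_const A₀).add i2'
  set g : Ω → ℝ := fun ω => ∫ ω', f (normError ρ σ b (Pi ω) fun i t => X i t ω') ∂P with hg
  set u : Ω → ℝ := fun ω => A₀ + (lam2 ρ σ b (Pi ω) - c) / 2 * A₂ +
    √b * lam3 ρ σ b (Pi ω) / 6 * A₃ with hu
  have hui : Integrable u P := i02.add i3'
  -- The conditional Edgeworth integral is affine in the random coefficients, so its mean involves
  -- only their means. Apart from the term in `E[λ̄₂ - c]` it is the integral against `pStar`.
  have huint : ∫ ω, u ω ∂P = A₀ + (∫ ω, (lam2 ρ σ b (Pi ω) - c) ∂P) / 2 * A₂ +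
      √b * (∫ ω, lam3 ρ σ b (Pi ω) ∂P) / 6 * A₃ := by
    simp only [hu]
    rw [integral_add i02 i3', integral_add (integrable_const A₀) i2', integral_mul_const,
      integral_mul_const, integral_div, integral_div, integral_const_mul]
    simp
  set S := (Pi ⁻¹' goodSet T ρ σ c b δ)ᶜ with hS
  have hSm : MeasurableSet S := (hPi (measurableSet_goodSet h c b δ)).compl
  have hpt : ∀ ω, ‖g ω - u ω‖ ≤ K₁ * δ ^ 2 + K₁ * b⁻¹ ^ q * S.indicator (fun _ => (1 : ℝ)) ω := by
    intro ω
    have := hcond (Pi ω) b δ hb hb1 hδ hδ' f hf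
    rw [hform] at this
    rw [Real.norm_eq_abs]
    exact this
  have hdom : Integrable (fun ω => K₁ * δ ^ 2 + K₁ * b⁻¹ ^ q * S.indicator (fun _ => (1 : ℝ)) ω)
      P := (integrable_const _).add (((integrable_const (1 : ℝ)).indicator hSm).const_mul _)
  have h1 : |∫ ω, g ω ∂P - ∫ ω, u ω ∂P| ≤ K₁ * δ ^ 2 + K₁ * b⁻¹ ^ q * P.real S := by
    rw [← integral_sub hgi hui, ← Real.norm_eq_abs]
    refine (norm_integral_le_of_norm_le hdom (ae_of_all _ hpt)).trans (le_of_eq ?_)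
    rw [integral_add (integrable_const _) (((integrable_const (1 : ℝ)).indicator hSm).const_mul _),
      integral_const, integral_const_mul, integral_indicator hSm]
    simp
  rw [pStar_eq hc, hform, sub_self, zero_div, zero_mul, add_zero, hge]
  set L := ∫ ω, (lam2 ρ σ b (Pi ω) - c) ∂P
  set V := ∫ ω, lam3 ρ σ b (Pi ω) ∂P
  have h2 : |L / 2 * A₂| ≤ K₃ * |L| := by
    rw [abs_mul, abs_div, abs_two, mul_comm]
    exact mul_le_mul a2 (by linarith [abs_nonneg L]) (by positivity) hK₃.le
  have e : ∫ ω, g ω ∂P - (A₀ + √b * V / 6 * A₃) = (∫ ω, g ω ∂P - ∫ ω, u ω ∂P) + L / 2 * A₂ := by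
    rw [huint]; ring
  rw [e]
  have hp : 0 ≤ b⁻¹ ^ q * P.real S :=
    mul_nonneg (Real.rpow_nonneg (inv_nonneg.2 hb.le) _) measureReal_nonneg
  have p1 : 0 ≤ K₃ * δ ^ 2 := by positivity
  have p2 : 0 ≤ K₃ * (b⁻¹ ^ q * P.real S) := mul_nonneg hK₃.le hp
  have p3 : 0 ≤ K₁ * |L| := by positivity
  refine (abs_add_le _ _).trans ((add_le_add h1 h2).trans ?_)
  linarith [mul_assoc K₃ (b⁻¹ ^ q) (P.real S), mul_assoc K₁ (b⁻¹ ^ q) (P.real S),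
    mul_assoc (K₁ + K₃) (b⁻¹ ^ q) (P.real S), add_mul K₁ K₃ (b⁻¹ ^ q * P.real S),
    add_mul K₁ K₃ (δ ^ 2), add_mul K₁ K₃ |L|]

/-- Shows that the skewness coefficient of the averaged density is `O(δ)`, so that its square is a
remainder in the passage to the positive part. -/
lemma IsDriftlessDiffusion.exists_sqrt_mul_integral_lam3_le (hB : IsCorrelatedBrownian P ρ B)
    (hX : IsDriftlessDiffusion P T σ B X) (h : AdmissibleCoeff T ρ σ s) {c q : ℝ} (hc : 0 < c)
    (hq : 2 ≤ q) :
    ∃ K > 0, ∀ (Pi : Ω → Partition T × Partition T), Measurable Pi → ∀ b δ : ℝ, 0 < b → b ≤ 1 →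
      0 < δ → δ ≤ 1 → |√b * ∫ ω, lam3 ρ σ b (Pi ω) ∂P| ≤
        K * δ + K * b⁻¹ ^ q * P.real (Pi ⁻¹' goodSet T ρ σ c b δ)ᶜ := by
  obtain ⟨K, hK, hpt⟩ := hX.exists_sqrt_mul_lam3_le hB h hc hq
  refine ⟨K, hK, fun Pi hPi b δ hb hb1 hδ hδ1 => ?_⟩
  set S := (Pi ⁻¹' goodSet T ρ σ c b δ)ᶜ with hS
  have hSm : MeasurableSet S := (hPi (measurableSet_goodSet h c b δ)).compl
  have hdom : Integrable (fun ω => K * δ + K * b⁻¹ ^ q * S.indicator (fun _ => (1 : ℝ)) ω) P :=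
    (integrable_const _).add (((integrable_const (1 : ℝ)).indicator hSm).const_mul _)
  rw [← integral_const_mul, ← Real.norm_eq_abs]
  refine (norm_integral_le_of_norm_le hdom (ae_of_all _ fun ω => ?_)).trans (le_of_eq ?_)
  · rw [norm_mul, Real.norm_eq_abs, Real.norm_eq_abs, abs_of_nonneg (Real.sqrt_nonneg b)]
    exact hpt (Pi ω) b δ hb hb1 hδ hδ1
  · rw [integral_add (integrable_const _) (((integrable_const (1 : ℝ)).indicator hSm).const_mul _),
      integral_const, integral_const_mul, integral_indicator hSm]
    simp

end Averaging

end

end HYExpansion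

/-! ### Rates in terms of `b`. -/

namespace HYExpansion

section Rates

variable {Ω : Type*} [MeasurableSpace Ω] {P : Measure Ω} {T : ℝ≥0}
  {ρ : ℝ → ℝ} {σ : Fin 2 → ℝ → ℝ} {a c : ℝ} {b : ℕ → ℝ}

lemma rpow_sub_half_sq {x : ℝ} (hx : 0 < x) (a : ℝ) :
    (x ^ (a - 1 / 2)) ^ 2 = x ^ (2 * a - 1) := by
  rw [← Real.rpow_natCast, ← Real.rpow_mul hx.le]
  congr 1; push_cast; ring

lemma sqrt_mul_rpow_sub_half {x : ℝ} (hx : 0 < x) (a : ℝ) :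
    √x * x ^ (a - 1 / 2) = x ^ a := by
  rw [Real.sqrt_eq_rpow, ← Real.rpow_add hx]
  congr 1; ring

/-- If the exceptional events have probability `o(b_n ^ p)` for all `p > 1`, their contribution
is eventually dominated by `b_n`. -/
lemma eventually_inv_rpow_mul_le (hb_pos : ∀ n, 0 < b n)
    {Pi : ℕ → Ω → Partition T × Partition T}
    (hA : ∀ p : ℝ, 1 < p →
      (fun n => P.real {ω | (lam2 ρ σ (b n) (Pi n ω) - c) ^ 2 ≤ b n ^ (2 * a - 1) ∧
        mesh (Pi n ω) ≤ b n ^ a}ᶜ) =o[atTop] (fun n => b n ^ p)) {q : ℝ} (hq : 0 < q) :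
    ∀ᶠ n in atTop, (b n)⁻¹ ^ q *
      P.real (Pi n ⁻¹' goodSet T ρ σ c (b n) (b n ^ (a - 1 / 2)))ᶜ ≤ b n := by
  -- The exponent `q + 1` pays for `b⁻¹ ^ q` and leaves one power of `b`.
  filter_upwards [(hA (q + 1) (by linarith)).bound one_pos] with n hn
  have hbn := hb_pos n
  -- With `δ = b^(a - 1/2)` one has `δ² = b^(2a-1)` and `√b δ = b^a`, so the good set is exactly
  -- `A_n(a)`.
  have e : Pi n ⁻¹' goodSet T ρ σ c (b n) (b n ^ (a - 1 / 2)) =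
      {ω | (lam2 ρ σ (b n) (Pi n ω) - c) ^ 2 ≤ b n ^ (2 * a - 1) ∧
        mesh (Pi n ω) ≤ b n ^ a} := by
    ext ω
    simp only [goodSet, Set.mem_preimage, Set.mem_ofPred_eq, rpow_sub_half_sq hbn,
      sqrt_mul_rpow_sub_half hbn]
  rw [Real.norm_of_nonneg measureReal_nonneg, one_mul,
    Real.norm_of_nonneg (Real.rpow_nonneg hbn.le _)] at hn
  rw [e]
  calc _ ≤ (b n)⁻¹ ^ q * b n ^ (q + 1) :=
        mul_le_mul_of_nonneg_left hn (Real.rpow_nonneg (inv_nonneg.2 hbn.le) _)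
    _ = b n := by
        rw [Real.inv_rpow hbn.le, Real.rpow_add_one hbn.ne', ← mul_assoc,
          inv_mul_cancel₀ (Real.rpow_pos_of_pos hbn q).ne', one_mul]

end Rates

end HYExpansion

/-! ### Assembly of the theorem. -/

theorem mainTheorem4
    {Ω : Type*} [MeasurableSpace Ω] (P : Measure Ω) [IsProbabilityMeasure P]
    -- the diffusion without drift observed on `[0, T]`
    (T : ℝ≥0) (hT : 0 < T)
    (σ : Fin 2 → ℝ → ℝ) (hσ_meas : ∀ i, Measurable (σ i))
    (hσ_pos : ∀ i, ∀ t ∈ Set.Icc (0 : ℝ) T, 0 < σ i t)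
    (hσ_bdd : ∃ s : ℝ, ∀ i, ∀ t ∈ Set.Icc (0 : ℝ) T, σ i t ≤ s)
    (ρ : ℝ → ℝ) (hρ_meas : Measurable ρ) (hρ : ∀ t, 0 ≤ t → ρ t ∈ Set.Icc (-1 : ℝ) 1)
    (B X : Fin 2 → ℝ≥0 → Ω → ℝ)
    (hB : HYExpansion.IsCorrelatedBrownian P ρ B)
    (hX : HYExpansion.IsDriftlessDiffusion P T σ B X)
    -- the random sampling schemes, independent of the increments `X_t - X_0`, `t ∈ [0, T]`
    (Pi : ℕ → Ω → HYExpansion.Partition T × HYExpansion.Partition T)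
    (hPi_meas : ∀ n, Measurable (Pi n))
    (hPi_indep : ∀ n, IndepFun (Pi n)
      (fun ω (p : Fin 2 × Set.Iic T) => X p.1 p.2 ω - X p.1 0 ω) P)
    -- the normalizing sequence
    (b : ℕ → ℝ) (hb_pos : ∀ n, 0 < b n) (hb : Tendsto b atTop (𝓝 0))
    -- the parameters
    (M γ η C r₀ cstar : ℝ) (hM : 0 < M) (hγ : 0 < γ) (hη : 0 < η) (hC : 0 < C) (hr₀ : 0 < r₀)
    (hcstar : 0 < cstar)
    (a : ℝ) (ha : a ∈ Set.Ioo (3 / 4 : ℝ) 1) (c : ℝ) (hc : c ∈ Set.Ioo (0 : ℝ) cstar)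
    -- `P(A_n(a)ᶜ) = o(b_n^p)` for every `p > 1`, and `E[λ̄_{2,n} - c] = O(b_n^{2a-1})`
    (hA : ∀ p : ℝ, 1 < p →
      (fun n => P.real {ω | (HYExpansion.lam2 ρ σ (b n) (Pi n ω) - c) ^ 2 ≤ b n ^ (2 * a - 1) ∧
        HYExpansion.mesh (Pi n ω) ≤ b n ^ a}ᶜ) =o[atTop] (fun n => b n ^ p))
    (hlam2 : (fun n => ∫ ω, (HYExpansion.lam2 ρ σ (b n) (Pi n ω) - c) ∂P)
      =O[atTop] (fun n => b n ^ (2 * a - 1))) :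
    (∀ n, Integrable (fun ω => HYExpansion.lam2 ρ σ (b n) (Pi n ω)) P ∧
      Integrable (fun ω => HYExpansion.lam3 ρ σ (b n) (Pi n ω)) P) ∧
    -- the expansion, uniformly over the class of test functions
    HYExpansion.UniformExpansion P
      (HYExpansion.growthClass M γ ∩ HYExpansion.oscClass C η r₀ cstar)
      (fun n ω => HYExpansion.normError ρ σ (b n) (Pi n ω) (fun i t => X i t ω))
      (fun n => HYExpansion.pStar c (b n) (∫ ω, HYExpansion.lam3 ρ σ (b n) (Pi n ω) ∂P))
      (fun n => b n ^ (2 * a - 1)) ∧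
    -- the version with the renormalized positive part, which is a probability density
    (BddAbove (Set.range fun n => ∫ ω, HYExpansion.lam3 ρ σ (b n) (Pi n ω) ∂P) →
      HYExpansion.UniformExpansion P
        (HYExpansion.growthClass M γ ∩ HYExpansion.oscClass C η r₀ cstar)
        (fun n ω => HYExpansion.normError ρ σ (b n) (Pi n ω) (fun i t => X i t ω))
        (fun n => HYExpansion.pPlus c (b n) (∫ ω, HYExpansion.lam3 ρ σ (b n) (Pi n ω) ∂P))
        (fun n => b n ^ (2 * a - 1)) ∧
      ∀ n,
        (∀ z, 0 ≤ HYExpansion.pPlus c (b n)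
          (∫ ω, HYExpansion.lam3 ρ σ (b n) (Pi n ω) ∂P) z) ∧
        Integrable (HYExpansion.pPlus c (b n)
          (∫ ω, HYExpansion.lam3 ρ σ (b n) (Pi n ω) ∂P)) ∧
        ∫ z, HYExpansion.pPlus c (b n)
          (∫ ω, HYExpansion.lam3 ρ σ (b n) (Pi n ω) ∂P) z = 1) := by
  obtain ⟨s, hs⟩ := hσ_bdd
  have h : HYExpansion.AdmissibleCoeff T ρ σ s := ⟨hσ_meas, hσ_pos, hs, hρ_meas, hρ⟩
  obtain ⟨ha1, ha2⟩ := ha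
  have hc0 : 0 < c := hc.1
  -- The exponent `q = max 2 γ` covers both polynomial losses off the good set.
  have hq2 : 2 ≤ max 2 γ := le_max_left _ _
  obtain ⟨δ₀, hδ₀, K₁, hK₁, hexp⟩ :=
    hX.exists_expansion_bound hT hB h hM hγ hc0 hq2 (le_max_right _ _)
  obtain ⟨K₂, hK₂, hskew⟩ := hX.exists_sqrt_mul_integral_lam3_le hB h hc0 hq2
  obtain ⟨K₃, hK₃, hplus⟩ := HYExpansion.exists_abs_integral_pPlus_sub_le hc0 hM hγ
  obtain ⟨L, hL⟩ := hlam2.bound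
  have hδlim : Tendsto (fun n => b n ^ (a - 1 / 2)) atTop (𝓝 0) := by
    have := hb.rpow_const (p := a - 1 / 2) (Or.inr (by linarith))
    rwa [Real.zero_rpow (by linarith)] at this
  have hsmall : ∀ᶠ n in atTop, b n ≤ 1 := hb.eventually_le_const one_pos
  have hrem := HYExpansion.eventually_inv_rpow_mul_le hb_pos hA (by linarith : 0 < max 2 γ)
  have hexp' : ∃ K : ℝ, ∀ᶠ n in atTop,
      ∀ f ∈ HYExpansion.growthClass M γ ∩ HYExpansion.oscClass C η r₀ cstar,
      |∫ ω, f (HYExpansion.normError ρ σ (b n) (Pi n ω) (fun i t => X i t ω)) ∂P -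
        ∫ z, f z * HYExpansion.pStar c (b n)
          (∫ ω, HYExpansion.lam3 ρ σ (b n) (Pi n ω) ∂P) z| ≤ K * b n ^ (2 * a - 1) := by
    refine ⟨K₁ + K₁ + K₁ * L, ?_⟩
    filter_upwards [hsmall, hδlim.eventually_le_const hδ₀, hL, hrem] with n hb1 hδ hLn hr f hf
    have hbn := hb_pos n
    have h1 := hexp (Pi n) (hPi_meas n) (hPi_indep n) (b n) _ hbn hb1
      (Real.rpow_pos_of_pos hbn _) hδ f hf.1
    rw [HYExpansion.rpow_sub_half_sq hbn, mul_assoc K₁ ((b n)⁻¹ ^ _)] at h1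
    rw [Real.norm_eq_abs, Real.norm_of_nonneg (Real.rpow_nonneg hbn.le _)] at hLn
    -- Uses `b n ≤ 1` and `a < 1`: the exceptional event contributes no more than the main error.
    have h2 : b n ≤ b n ^ (2 * a - 1) := by
      simpa using Real.rpow_le_rpow_of_exponent_ge hbn hb1 (by linarith : 2 * a - 1 ≤ 1)
    refine h1.trans ?_
    have h3 := mul_le_mul_of_nonneg_left (hr.trans h2) hK₁.le
    have h4 := mul_le_mul_of_nonneg_left hLn hK₁.le
    linarith [add_mul (K₁ + K₁) (K₁ * L) (b n ^ (2 * a - 1)),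
      add_mul K₁ K₁ (b n ^ (2 * a - 1)), mul_assoc K₁ L (b n ^ (2 * a - 1))]
  have hint : ∀ n, ∀ f ∈ HYExpansion.growthClass M γ ∩ HYExpansion.oscClass C η r₀ cstar,
      Integrable (fun ω => f (HYExpansion.normError ρ σ (b n) (Pi n ω) fun i t => X i t ω)) P :=
    fun n f hf => (hX.integral_normError hT hB h (hPi_meas n) (hPi_indep n) hM hγ
      (hb_pos n) hf.1).1
  refine ⟨fun n => ⟨hX.integrable_lam2 hB h (hPi_meas n) (hb_pos n),
    hX.integrable_lam3 hB h (hPi_meas n) (hb_pos n)⟩,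
    ⟨fun n f hf => ⟨hint n f hf, ?_⟩, hexp'⟩, fun _ =>
    ⟨⟨fun n f hf => ⟨hint n f hf, HYExpansion.integrable_mul_pPlus hc0 _ _ hM hγ hf.1⟩, ?_⟩,
      fun n => HYExpansion.integral_pPlus hc0 _ _⟩⟩
  · obtain ⟨K, -, hK⟩ := HYExpansion.exists_growthClass_bound hM hγ (κ := 1) one_pos
    simp only [HYExpansion.pStar_eq hc0]
    exact HYExpansion.integrable_mul_edgeworthDensity hc0 c _ hf.1.1 (hK f hf.1)
  obtain ⟨K, hK⟩ := hexp'
  refine ⟨K + K₃ * (K₂ + K₂) ^ 2, ?_⟩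
  -- Eventually the skewness coefficient is at most `1`, as the comparison with the positive part
  -- requires.
  have hlim : Tendsto (fun n => (K₂ + K₂) * b n ^ (a - 1 / 2)) atTop (𝓝 0) := by
    simpa using hδlim.const_mul (K₂ + K₂)
  filter_upwards [hsmall, hδlim.eventually_le_const one_pos, hlim.eventually_le_const one_pos,
    hrem, hK] with n hb1 hδ hk1 hr hKn f hf
  have hbn := hb_pos n
  have h1 := hskew (Pi n) (hPi_meas n) (b n) _ hbn hb1 (Real.rpow_pos_of_pos hbn _) hδ
  rw [mul_assoc K₂ ((b n)⁻¹ ^ _)] at h1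
  have h2 : b n ≤ b n ^ (a - 1 / 2) := by
    simpa using Real.rpow_le_rpow_of_exponent_ge hbn hb1 (by linarith : a - 1 / 2 ≤ 1)
  have h3 := mul_le_mul_of_nonneg_left (hr.trans h2) hK₂.le
  have h4 : |√(b n) * ∫ ω, HYExpansion.lam3 ρ σ (b n) (Pi n ω) ∂P| ≤
      (K₂ + K₂) * b n ^ (a - 1 / 2) := by
    linarith [add_mul K₂ K₂ (b n ^ (a - 1 / 2))]
  have h5 := hplus _ (h4.trans hk1) f hf.1
  have h6 : (√(b n) * ∫ ω, HYExpansion.lam3 ρ σ (b n) (Pi n ω) ∂P) ^ 2 ≤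
      (K₂ + K₂) ^ 2 * b n ^ (2 * a - 1) := by
    rw [← HYExpansion.rpow_sub_half_sq hbn, ← mul_pow, ← sq_abs]
    exact pow_le_pow_left₀ (abs_nonneg _) h4 2
  have h7 := hKn f hf
  simp only [HYExpansion.pPlus]
  simp only [HYExpansion.pStar_eq hc0] at h7 ⊢
  rw [abs_sub_comm] at h5
  -- Triangle inequality through `pStar`: the expansion error plus `K₃` times the squared skewness
  -- coefficient, both `O(b^(2a-1))`.
  refine (abs_sub_le _ _ _).trans ((add_le_add h7 h5).trans ?_)
  have h8 := mul_le_mul_of_nonneg_left h6 hK₃.le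
  linarith [add_mul K (K₃ * (K₂ + K₂) ^ 2) (b n ^ (2 * a - 1)),
    mul_assoc K₃ ((K₂ + K₂) ^ 2) (b n ^ (2 * a - 1))]
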